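/- Fix a signature with countably many function symbols and predicate symbols of every arity (constants are nullary function symbols) and countably many variables. A clause is a finite set of literals, a clause set is a finite set of clauses; $C^+$ and $C^-$ denote the sets of positive and of negative literals of a clause $C$. For an expression $E$ let $\mathrm{var}(E)$ be the set of its variables, $\mathrm{occ}(v,E)$ the number of occurrences of $v$ in $E$, and, for $v\in\mathrm{var}(E)$, let $\tau_{\max}(v,E)$ and $\tau_{\min}(v,E)$ be the maximal and the minimal depth of an occurrence of $v$ in $E$, where for terms $\tau_{\max}(v,v)=0$ and $\tau_{\max}(v,f(t_1,\dots,t_n))=1+\max\{\tau_{\max}(v,t_i) : v\in\mathrm{var}(t_i)\}$, for a literal $\tau_{\max}(v,(\neg)P(t_1,\dots,t_n))=\max\{\tau_{\max}(v,t_i): v\in\mathrm{var}(t_i)\}$, for a set of literals one takes the maximum over its members that contain $v$, and $\tau_{\min}$ is defined likewise with $\min$. A clause set $S$ is in the class OCC1N if every $C\in S$ satisfies $\mathrm{occ}(v,C^+)=1$ for all $v\in\mathrm{var}(C^+)$, and $\tau_{\max}(v,C^+)\le\tau_{\min}(v,C^-)$ for all $v\in\mathrm{var}(C^-)\cap\mathrm{var}(C^+)$.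 A renaming is a set $\rho$ of predicate symbols; $\rho(S)$ arises from $S$ by replacing every literal whose predicate symbol is in $\rho$ by its dual. $S$ is renamable to OCC1N if $\rho(S)$ is in OCC1N for some renaming $\rho$. For a literal $L=(\neg)P(\dots)$ let $\mathrm{skel}(L)$ be the propositional literal $(\neg)P$, with the predicate symbol $P$ as a propositional variable, and let $\overline{K}$ be the dual of a literal $K$. For a clause set $S$ let $\mathrm{ren}(S)$ be the set consisting, for all $C\in S$, of the clauses - $\{\mathrm{skel}(L)\}$ for $L\in C$ with $\mathrm{occ}(v,L)>1$ for some $v$; - $\{\mathrm{skel}(L),\mathrm{skel}(L')\}$ for $L,L'\in C$ with $L\ne L'$ and $\mathrm{var}(L)\cap\mathrm{var}(L')\neq\emptyset$; - $\{\mathrm{skel}(L),\overline{\mathrm{skel}(L')}\}$ for $L,L'\in C$ with $\tau_{\max}(v,L)>\tau_{\min}(v,L')$ for some $v\in\mathrm{var}(L)\cap\mathrm{var}(L')$. Clause sets are written as strings over a finite alphabet in the usual way (as lists of lists of literals, with arities and indices of symbols and variables in binary). Then: 1. It is decidable in polynomial time, by a multi-stack Turing machine, whether a given clause set is renamable to OCC1N.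 2. $\mathrm{ren}(S)$ is a polynomially bounded set of propositional Krom clauses: all its clauses have at most two literals, and there is a polynomial $p$ such that for every clause set $S$, given by a string of length $n$, the set $\mathrm{ren}(S)$ can be written as a string of length at most $p(n)$. 3. It is decidable in polynomial time, by a multi-stack Turing machine, whether a given finite set of propositional Krom clauses (clauses with at most two literals) is satisfiable. -/

import Mathlib

namespace OccRen

open FirstOrder

/-! ### Clause logic

The signature has, for every arity `n`, countably many `n`-ary function symbols and countably many
`n`-ary predicate symbols; constants are nullary function symbols. Variables are indexed by `ℕ`. -/

/-- The signature with symbols `f^n_i` and `P^n_i` for all `n i : ℕ`. -/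
abbrev sig : Language where
  Functions := fun _ => ℕ
  Relations := fun _ => ℕ

/-- First-order terms. -/
abbrev Term : Type := sig.Term ℕ

/-- A predicate symbol, together with its arity. -/
abbrev PredSym : Type := Σ n : ℕ, sig.Relations n

/-- A literal `P(t₁,…,tₙ)` (`sign = true`) or `¬P(t₁,…,tₙ)` (`sign = false`). -/
structure Literal where
  sign : Bool
  pred : PredSym
  args : Fin pred.1 → Term

noncomputable instance : DecidableEq Literal := Classical.decEq _

/-- A clause is a finite set of literals. -/
abbrev Clause : Type := Finset Literal

/-- A clause set is a finite set of clauses. -/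
abbrev ClauseSet : Type := Finset Clause

namespace Term

/-- The number of occurrences of the variable `v` in a term. -/
def occ (v : ℕ) : Term → ℕ
  | .var w => if w = v then 1 else 0
  | .func _ ts => ∑ i, occ v (ts i)

/-- The maximal depth of occurrence of `v` in a term; only used when `v` occurs in the term. -/
def tmax (v : ℕ) : Term → ℕ
  | .var _ => 0
  | .func _ ts => 1 + (Finset.univ.filter fun i => v ∈ (ts i).varFinset).sup fun i => tmax v (ts i)

/-- The minimal depth of occurrence of `v` in a term; only used when `v` occurs in the term. -/
noncomputable def tmin (v : ℕ) : Term → ℕ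
  | .var _ => 0
  | .func _ ts => 1 + sInf {d | ∃ i, v ∈ (ts i).varFinset ∧ d = tmin v (ts i)}

end Term

namespace Literal

/-- The dual literal. -/
def dual (l : Literal) : Literal := { l with sign := !l.sign }

/-- The variables occurring in a literal. -/
def vars (l : Literal) : Finset ℕ := Finset.univ.biUnion fun i => (l.args i).varFinset

/-- The number of occurrences of `v` in a literal. -/
def occ (v : ℕ) (l : Literal) : ℕ := ∑ i, Term.occ v (l.args i)

/-- The maximal depth of occurrence of `v` in a literal; only used when `v` occurs in it. -/
def tmax (v : ℕ) (l : Literal) : ℕ :=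
  (Finset.univ.filter fun i => v ∈ (l.args i).varFinset).sup fun i => Term.tmax v (l.args i)

/-- The minimal depth of occurrence of `v` in a literal; only used when `v` occurs in it. -/
noncomputable def tmin (v : ℕ) (l : Literal) : ℕ :=
  sInf {d | ∃ i, v ∈ (l.args i).varFinset ∧ d = Term.tmin v (l.args i)}

open Classical in
/-- The application of a renaming (a set of predicate symbols) to a literal. -/
noncomputable def rename (ρ : Set PredSym) (l : Literal) : Literal :=
  if l.pred ∈ ρ then l.dual else l

end Literal

namespace Clause

/-- The subset of the positive literals. -/
def posPart (C : Clause) : Clause := C.filter fun l => l.sign = true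

/-- The subset of the negative literals. -/
def negPart (C : Clause) : Clause := C.filter fun l => l.sign = false

/-- The variables occurring in a clause. -/
def vars (C : Clause) : Finset ℕ := C.biUnion Literal.vars

/-- The number of occurrences of `v` in a clause. -/
def occ (v : ℕ) (C : Clause) : ℕ := ∑ l ∈ C, l.occ v

/-- The maximal depth of occurrence of `v` in a clause; only used when `v` occurs in it. -/
def tmax (v : ℕ) (C : Clause) : ℕ := (C.filter fun l => v ∈ l.vars).sup (Literal.tmax v)

/-- The minimal depth of occurrence of `v` in a clause; only used when `v` occurs in it. -/
noncomputable def tmin (v : ℕ) (C : Clause) : ℕ :=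
  sInf {d | ∃ l ∈ C, v ∈ l.vars ∧ d = l.tmin v}

/-- The application of a renaming to a clause. -/
noncomputable def rename (ρ : Set PredSym) (C : Clause) : Clause := C.image (Literal.rename ρ)

end Clause

/-- The application of a renaming to a clause set. -/
noncomputable def ClauseSet.rename (ρ : Set PredSym) (S : ClauseSet) : ClauseSet :=
  S.image (Clause.rename ρ)

/-- Membership in the class OCC1N. -/
def IsOCC1N (S : ClauseSet) : Prop :=
  ∀ C ∈ S,
    (∀ v ∈ Clause.vars (Clause.posPart C), Clause.occ v (Clause.posPart C) = 1) ∧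
    (∀ v ∈ Clause.vars (Clause.negPart C) ∩ Clause.vars (Clause.posPart C),
      Clause.tmax v (Clause.posPart C) ≤ Clause.tmin v (Clause.negPart C))

/-- Renamability to OCC1N. -/
def RenamableToOCC1N (S : ClauseSet) : Prop :=
  ∃ ρ : Set PredSym, IsOCC1N (ClauseSet.rename ρ S)

/-! ### Propositional clauses; predicate symbols serve as propositional variables -/

/-- A propositional literal: `P` (`sign = true`) or `¬P` (`sign = false`). -/
structure PropLit where
  sign : Bool
  pvar : PredSym
  deriving DecidableEq

/-- The dual propositional literal. -/
def PropLit.dual (l : PropLit) : PropLit := { l with sign := !l.sign }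

/-- Truth of a propositional literal, where `M` is the set of the variables that are true. -/
def PropLit.Holds (M : Set PredSym) (l : PropLit) : Prop := l.sign = true ↔ l.pvar ∈ M

/-- Satisfiability of a set of propositional clauses. -/
def PropSatisfiable (T : Set (Finset PropLit)) : Prop :=
  ∃ M : Set PredSym, ∀ C ∈ T, ∃ l ∈ C, l.Holds M

/-- The propositional skeleton of a literal. -/
def skel (l : Literal) : PropLit := ⟨l.sign, l.pred⟩

/-- The units forcing every literal with a repeated variable to become negative. -/
def ren₁ (C : Clause) : Set (Finset PropLit) :=
  {c | ∃ l ∈ C, (∃ v, 1 < l.occ v) ∧ c = {skel l}}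

/-- The clauses forbidding two different positive literals with a common variable. -/
def ren₂ (C : Clause) : Set (Finset PropLit) :=
  {c | ∃ l ∈ C, ∃ k ∈ C, l ≠ k ∧ (l.vars ∩ k.vars).Nonempty ∧ c = {skel l, skel k}}

/-- The clauses for the condition on depths of occurrence. -/
def ren₃ (C : Clause) : Set (Finset PropLit) :=
  {c | ∃ l ∈ C, ∃ k ∈ C, (∃ v ∈ l.vars ∩ k.vars, k.tmin v < l.tmax v) ∧
    c = {skel l, (skel k).dual}}

/-- The set `ren(S)` of propositional clauses. -/
def ren (S : ClauseSet) : Set (Finset PropLit) :=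
  ⋃ C ∈ S, ren₁ C ∪ ren₂ C ∪ ren₃ C

/-! ### Representation by strings over a finite alphabet -/

/-- The alphabet for writing down clause sets. -/
inductive Letter
  | bit (b : Bool)
  | colon
  | comma
  | lpar
  | rpar
  | lbrace
  | rbrace
  | variable
  | function
  | pos
  | neg
  deriving DecidableEq, Fintype

/-- The binary notation of a natural number. -/
def encodeIndex (n : ℕ) : List Letter := (Computability.encodeNat n).map Letter.bit

/-- A symbol with arity `n` and index `i` is written `n:i`, in binary. -/
def encodeSymbol (n i : ℕ) : List Letter := encodeIndex n ++ Letter.colon :: encodeIndex i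

/-- A term is written as a variable or as `f(t₁,…,tₙ,)`. -/
def encodeTerm : Term → List Letter
  | .var v => Letter.variable :: encodeIndex v
  | @Language.Term.func _ _ n f ts =>
      Letter.function :: encodeSymbol n f ++ Letter.lpar ::
        (List.ofFn fun i => encodeTerm (ts i) ++ [Letter.comma]).flatten ++ [Letter.rpar]

/-- The sign of a literal. -/
def encodeSign (b : Bool) : Letter := if b then Letter.pos else Letter.neg

/-- A literal is written as its sign followed by `P(t₁,…,tₙ,)`. -/
def encodeLiteral (l : Literal) : List Letter :=
  encodeSign l.sign :: encodeSymbol l.pred.1 l.pred.2 ++ Letter.lpar ::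
    (List.ofFn fun i => encodeTerm (l.args i) ++ [Letter.comma]).flatten ++ [Letter.rpar]

/-- A list of lists of literals is written `{L…L}…{L…L}`. -/
def encodeClauses (S : List (List Literal)) : List Letter :=
  S.flatMap fun C => Letter.lbrace :: C.flatMap encodeLiteral ++ [Letter.rbrace]

/-- The clause set that a list of lists of literals represents: order and repetitions do not
matter. -/
noncomputable def clauseSetOf (S : List (List Literal)) : ClauseSet :=
  (S.map List.toFinset).toFinset

/-- A propositional literal is written as its sign followed by its variable. -/
def encodePropLit (l : PropLit) : List Letter :=
  encodeSign l.sign :: encodeSymbol l.pvar.1 l.pvar.2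

/-- A representation of a finite set of propositional Krom clauses, that is, of clauses with at
most two literals. -/
abbrev KromClauses : Type := {T : List (List PropLit) // ∀ C ∈ T, C.length ≤ 2}

/-- A list of lists of propositional literals is written `{L…L}…{L…L}`. -/
def encodeKrom (T : KromClauses) : List Letter :=
  T.1.flatMap fun C => Letter.lbrace :: C.flatMap encodePropLit ++ [Letter.rbrace]

/-- The set of propositional clauses that a list of lists represents. -/
def kromSetOf (T : KromClauses) : Set (Finset PropLit) := {c | ∃ C ∈ T.1, c = C.toFinset}

/-- The problem `P`, whose instances are written down by `e`, is decidable in polynomial time: a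
multi-stack Turing machine answers every instance within a number of steps that is polynomial in
the length of the string that represents the instance. -/
def DecidableInPolyTime {α Γ : Type} (e : α → List Γ) (P : α → Prop) : Prop :=
  ∃ f : α → Bool, (∀ a, f a = true ↔ P a) ∧
    Nonempty (Turing.TM2ComputableInPolyTime e Computability.encodeBool f)

end OccRen

/-! Read a set `ρ` of predicate symbols as a propositional interpretation. A literal is negative
after renaming by `ρ` exactly when its skeleton is true in `ρ` (`Literal.rename_sign`). The clauses
of `ren` then state the demands of OCC1N one by one: a literal with a repeated variable must become
negative; of two different literals with a common variable, one must become negative; and if `l` has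
a variable deeper than some occurrence of it in `k`, then `l` must not become positive while `k`
becomes negative. So renamability of `S` and satisfiability of `ren S` have the same witnesses `ρ`
(`renamableToOCC1N_iff`). Each ordered pair of literals of a clause contributes at most three
clauses with at most two literals each, which gives the polynomial bound (`exists_poly_length_ren`).

Satisfiability of Krom clauses is decided by saturation under resolution: if no two complementary
units are derived, a maximal consistent set of literals closed under implication is a model
(`exists_model`).

For polynomial time an actual machine is needed. Instead of programming each algorithm separately,
one machine is built that evaluates Datalog programs on the positions of the input word. Relations
are binary, rules have a fixed finite set of variables, and guards test single letters. A word of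
length `n` admits at most `|J| * (n + 2) ^ 2` facts; every productive round over all rule instances
adds at least one, so saturation is polynomial (`Datalog.decidableInPolyTime`). The machine is
written as a structured program with loops over stacks, and `Run.leads` transfers its step count to
`TM2`.

Both decision problems then become sets of rules. A fact `cl s t` about positions `i` and `j` stands
for the clause formed by the literals written there, with polarities `s` and `t`. The rules in
`Common` compare names, measure nesting depth and perform resolution; what remains is to read off
the clauses (`KromRule`, `RenRule`). For renamability, the clauses of `ren` are recognised directly
in the word for `S` and never written out. Soundness is an invariant (`Spec`) preserved by all
rules; completeness is `propSatisfiable_of_not_der`. -/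

/-! ### Structured programs for multi-stack machines -/

namespace StackProgram

open Turing

/-- Structured programs over stacks `K` with alphabet `Γ`. The finite control consists of a register
for a letter and of a flag in `τ`. -/
inductive Prog (K Γ τ : Type)
  | push (k : K) (f : Option Γ → τ → Γ)
  | pop (k : K)
  | peek (k : K)
  | load (f : Option Γ → τ → τ)
  | seq (P Q : Prog K Γ τ)
  | ite (p : τ → Bool) (P Q : Prog K Γ τ)
  /-- pop from `k` and run `P`, until `k` is found empty -/
  | whilePop (k : K) (P : Prog K Γ τ)

/-- States of a structured program. -/
structure State (K Γ τ : Type) where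
  reg : Option Γ
  flag : τ
  stk : K → List Γ

variable {K Γ τ : Type}

/-- The labels that the compiled program uses. -/
def Lab : Prog K Γ τ → Type
  | .seq P Q => Lab P ⊕ Lab Q
  | .ite _ P Q => Option (Lab P ⊕ Lab Q)
  | .whilePop _ P => Option (Lab P)
  | _ => Unit

theorem finite_lab : ∀ P : Prog K Γ τ, Finite (Lab P)
  | .push _ _ | .pop _ | .peek _ | .load _ => inferInstanceAs (Finite Unit)
  | .seq P Q =>
    have := finite_lab P; have := finite_lab Q; inferInstanceAs (Finite (Lab P ⊕ Lab Q))
  | .ite _ P Q =>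
    have := finite_lab P; have := finite_lab Q; inferInstanceAs (Finite (Option (Lab P ⊕ Lab Q)))
  | .whilePop _ P => have := finite_lab P; inferInstanceAs (Finite (Option (Lab P)))

open Function (update)

variable [DecidableEq K]

/-- `Run P a b t`: started in `a`, the program `P` stops in `b` after at most `t` steps. -/
inductive Run : Prog K Γ τ → State K Γ τ → State K Γ τ → ℕ → Prop
  | push {k f a t} :
      Run (.push k f) a ⟨a.reg, a.flag, update a.stk k (f a.reg a.flag :: a.stk k)⟩ (t + 1)
  | pop {k a t} : Run (.pop k) a ⟨(a.stk k).head?, a.flag, update a.stk k (a.stk k).tail⟩ (t + 1)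
  | peek {k a t} : Run (.peek k) a ⟨(a.stk k).head?, a.flag, a.stk⟩ (t + 1)
  | load {f a t} : Run (.load f) a ⟨a.reg, f a.reg a.flag, a.stk⟩ (t + 1)
  | seq {P Q a b c t u} : Run P a b t → Run Q b c u → Run (.seq P Q) a c (t + u)
  | iteTrue {p P Q a b t} : p a.flag = true → Run P a b t → Run (.ite p P Q) a b (t + 1)
  | iteFalse {p P Q a b t} : p a.flag = false → Run Q a b t → Run (.ite p P Q) a b (t + 1)
  | whileNil {k P a t} : a.stk k = [] → Run (.whilePop k P) a ⟨none, a.flag, a.stk⟩ (t + 1)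
  | whileCons {k P a b c x l t u} : a.stk k = x :: l →
      Run P ⟨some x, a.flag, update a.stk k l⟩ b t → Run (.whilePop k P) b c u →
      Run (.whilePop k P) a c (t + u + 1)

/-- The leaves of a run already allow slack (`t + 1` for one step), so additional time can be pushed
down to the last leaf. -/
theorem Run.mono {P : Prog K Γ τ} {a b t t'} (h : Run P a b t) (ht : t ≤ t') : Run P a b t' := by
  induction h generalizing t' with
  | push => obtain ⟨s, rfl⟩ := Nat.exists_eq_add_of_le' (Nat.le_of_add_left_le ht); exact .push
  | pop => obtain ⟨s, rfl⟩ := Nat.exists_eq_add_of_le' (Nat.le_of_add_left_le ht); exact .pop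
  | peek => obtain ⟨s, rfl⟩ := Nat.exists_eq_add_of_le' (Nat.le_of_add_left_le ht); exact .peek
  | load => obtain ⟨s, rfl⟩ := Nat.exists_eq_add_of_le' (Nat.le_of_add_left_le ht); exact .load
  | @seq P Q a b c t u h₁ h₂ ih₁ ih₂ =>
    obtain ⟨s, rfl⟩ := Nat.exists_eq_add_of_le ht
    rw [Nat.add_assoc]
    exact .seq h₁ (ih₂ (Nat.le_add_right u s))
  | iteTrue hp _ ih =>
    obtain ⟨s, rfl⟩ := Nat.exists_eq_add_of_le' (Nat.le_of_add_left_le ht)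
    exact .iteTrue hp (ih (Nat.le_of_succ_le_succ ht))
  | iteFalse hp _ ih =>
    obtain ⟨s, rfl⟩ := Nat.exists_eq_add_of_le' (Nat.le_of_add_left_le ht)
    exact .iteFalse hp (ih (Nat.le_of_succ_le_succ ht))
  | whileNil hk =>
    obtain ⟨s, rfl⟩ := Nat.exists_eq_add_of_le' (Nat.le_of_add_left_le ht); exact .whileNil hk
  | @whileCons k P a b c x l t u hk h₁ h₂ ih₁ ih₂ =>
    obtain ⟨s, rfl⟩ := Nat.exists_eq_add_of_le ht
    have := Run.whileCons hk h₁ (ih₂ (Nat.le_add_right u s))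
    rwa [show t + u + 1 + s = t + (u + s) + 1 by omega]

/-- Every step pushes at most one letter. -/
theorem Run.length_le {P : Prog K Γ τ} {a b t} (h : Run P a b t) (k : K) :
    (b.stk k).length ≤ (a.stk k).length + t := by
  induction h with
  | @push k' f a t => by_cases h : k = k' <;> simp [update, h]
  | @pop k' a t => by_cases h : k = k' <;> simp [update, h]; omega
  | peek => simp
  | load => simp
  | seq _ _ ih₁ ih₂ => omega
  | iteTrue _ _ ih => omega
  | iteFalse _ _ ih => omega
  | whileNil => simp
  | @whileCons k' P a b c x l t u hk _ _ ih₁ ih₂ =>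
    have : (update a.stk k' l k).length ≤ (a.stk k).length := by
      by_cases h : k = k' <;> simp [update, h, hk]
    simp only at ih₁
    omega

/-! ### Compilation to `TM2` -/

/-- The label at which the compiled program starts. -/
def entry : (P : Prog K Γ τ) → Lab P
  | .push _ _ | .pop _ | .peek _ | .load _ => ()
  | .seq P _ => .inl (entry P)
  | .ite _ _ _ => none
  | .whilePop _ _ => none

/-- The stack alphabets of the compiled program: there is an additional stack for the answer. -/
@[reducible] def Alph (K Γ : Type) : Option K → Type
  | none => Bool
  | some _ => Γ

/-- The compiled program, which jumps to `exit` at the end. -/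
def code {Λ : Type} : (P : Prog K Γ τ) → (Lab P → Λ) → Λ → Lab P →
    TM2.Stmt (Alph K Γ) Λ (Option Γ × τ)
  | .push k f, _, exit, _ => .push (some k) (fun s => f s.1 s.2) (.goto fun _ => exit)
  | .pop k, _, exit, _ => .pop (some k) (fun s x => (x, s.2)) (.goto fun _ => exit)
  | .peek k, _, exit, _ => .peek (some k) (fun s x => (x, s.2)) (.goto fun _ => exit)
  | .load f, _, exit, _ => .load (fun s => (s.1, f s.1 s.2)) (.goto fun _ => exit)
  | .seq P Q, emb, exit, l =>
    match (l : Lab P ⊕ Lab Q) with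
    | .inl l => code P (fun l => emb (Sum.inl l : Lab P ⊕ Lab Q))
        (emb (Sum.inr (entry Q) : Lab P ⊕ Lab Q)) l
    | .inr l => code Q (fun l => emb (Sum.inr l : Lab P ⊕ Lab Q)) exit l
  | .ite p P Q, emb, exit, l =>
    match (l : Option (Lab P ⊕ Lab Q)) with
    | none => .branch (fun s => p s.2)
        (.goto fun _ => emb (some (.inl (entry P)) : Option (Lab P ⊕ Lab Q)))
        (.goto fun _ => emb (some (.inr (entry Q)) : Option (Lab P ⊕ Lab Q)))
    | some (.inl l) => code P (fun l => emb (some (.inl l) : Option (Lab P ⊕ Lab Q))) exit l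
    | some (.inr l) => code Q (fun l => emb (some (.inr l) : Option (Lab P ⊕ Lab Q))) exit l
  | .whilePop k P, emb, exit, l =>
    match (l : Option (Lab P)) with
    | none => .pop (some k) (fun s x => (x, s.2)) (.branch (fun s => s.1.isSome)
        (.goto fun _ => emb (some (entry P) : Option (Lab P))) (.goto fun _ => exit))
    | some l => code P (fun l => emb (some l : Option (Lab P))) (emb (none : Option (Lab P))) l

/-- The stacks of the compiled program. -/
def liftStk (S : K → List Γ) : ∀ k, List (Alph K Γ k)
  | none => []
  | some k => S k

/-- The configurations of the compiled program. -/
def liftCfg {Λ : Type} (l : Λ) (a : State K Γ τ) : TM2.Cfg (Alph K Γ) Λ (Option Γ × τ) :=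
  ⟨some l, (a.reg, a.flag), liftStk a.stk⟩

theorem update_liftStk (S : K → List Γ) (k : K) (l : List Γ) :
    update (liftStk S) (some k) l = liftStk (update S k l) := by
  funext k'
  cases k' with
  | none => simp [liftStk]
  | some k' =>
    by_cases h : k' = k
    · subst h; simp [liftStk]
    · simp [liftStk, h]

/-- `c` leads to `c'` in at most `t` steps. -/
def Leads {Λ : Type} (m : Λ → TM2.Stmt (Alph K Γ) Λ (Option Γ × τ))
    (c c' : TM2.Cfg (Alph K Γ) Λ (Option Γ × τ)) (t : ℕ) : Prop :=
  ∃ n ≤ t, (flip bind (TM2.step m))^[n] (some c) = some c'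

theorem Leads.trans {Λ : Type} {m : Λ → TM2.Stmt (Alph K Γ) Λ (Option Γ × τ)} {c c' c'' t u}
    (h : Leads m c c' t) (h' : Leads m c' c'' u) : Leads m c c'' (t + u) := by
  obtain ⟨n, hn, h⟩ := h
  obtain ⟨n', hn', h'⟩ := h'
  exact ⟨n' + n, by omega, by rw [Function.iterate_add_apply, h, h']⟩

theorem Leads.single {Λ : Type} {m : Λ → TM2.Stmt (Alph K Γ) Λ (Option Γ × τ)} {c c' t}
    (h : TM2.step m c = some c') : Leads m c c' (t + 1) :=
  ⟨1, by omega, by simpa [flip] using h⟩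

/-- Correctness of the compiler. The label embedding and the exit label are arbitrary, so that the
induction hypothesis applies to a subprogram sitting inside a larger machine. Each constructor costs
exactly the steps that it is charged for. -/
theorem Run.leads {Λ : Type} {m : Λ → TM2.Stmt (Alph K Γ) Λ (Option Γ × τ)}
    {P : Prog K Γ τ} {a b : State K Γ τ} {t : ℕ} (h : Run P a b t) :
    ∀ (emb : Lab P → Λ) (exit : Λ), (∀ l, m (emb l) = code P emb exit l) →
      Leads m (liftCfg (emb (entry P)) a) (liftCfg exit b) t := by
  induction h with
  | push =>
    intro emb exit hm
    apply Leads.single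
    simp only [liftCfg, TM2.step, hm]
    simp [code, ← update_liftStk, liftStk]
  | pop =>
    intro emb exit hm
    apply Leads.single
    simp only [liftCfg, TM2.step, hm]
    simp [code, ← update_liftStk, liftStk]
  | peek =>
    intro emb exit hm
    apply Leads.single
    simp only [liftCfg, TM2.step, hm]
    simp [code, liftStk]
  | load =>
    intro emb exit hm
    apply Leads.single
    simp only [liftCfg, TM2.step, hm]
    simp [code]
  | @seq P Q a b c t u _ _ ih₁ ih₂ =>
    intro emb exit hm
    exact (ih₁ (fun l => emb (Sum.inl l : Lab P ⊕ Lab Q)) (emb (Sum.inr (entry Q) : Lab P ⊕ Lab Q))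
      (fun l => hm _)).trans (ih₂ (fun l => emb (Sum.inr l : Lab P ⊕ Lab Q)) exit (fun l => hm _))
  | @iteTrue p P Q a b t hp _ ih =>
    intro emb exit hm
    rw [Nat.add_comm]
    refine Leads.trans (Leads.single (t := 0) ?_)
      (ih (fun l => emb (some (.inl l) : Option (Lab P ⊕ Lab Q))) exit (fun l => hm _))
    simp only [liftCfg, TM2.step, hm]
    simp [code, entry, hp]
  | @iteFalse p P Q a b t hp _ ih =>
    intro emb exit hm
    rw [Nat.add_comm]
    refine Leads.trans (Leads.single (t := 0) ?_)
      (ih (fun l => emb (some (.inr l) : Option (Lab P ⊕ Lab Q))) exit (fun l => hm _))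
    simp only [liftCfg, TM2.step, hm]
    simp [code, entry, hp]
  | @whileNil k P a t hk =>
    intro emb exit hm
    apply Leads.single
    simp only [liftCfg, TM2.step, hm]
    have : update (liftStk a.stk) (some k) [] = liftStk a.stk := by
      rw [update_liftStk, ← hk, Function.update_eq_self]
    simp [code, entry, liftStk, hk, this]
  | @whileCons k P a b c x l t u hk _ _ ih₁ ih₂ =>
    intro emb exit hm
    rw [Nat.add_comm]
    refine Leads.trans (Leads.single (t := 0) ?_)
      ((ih₁ (fun l => emb (some l : Option (Lab P))) (emb (none : Option (Lab P)))
        (fun l => hm _)).trans (ih₂ emb exit hm))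
    simp only [liftCfg, TM2.step, hm]
    simp [code, entry, liftStk, hk, ← update_liftStk]

/-! ### Programs that answer a question -/

/-- Empty all the stacks in a list. -/
def clear (τ : Type) : List K → Prog K Γ τ
  | [] => .load fun _ s => s
  | k :: ks => .seq (.whilePop k (.load fun _ s => s)) (clear τ ks)

theorem run_clear_one (k : K) : ∀ (l : List Γ) (a : State K Γ τ), a.stk k = l → ∃ r,
    Run (.whilePop k (.load fun _ s => s)) a ⟨r, a.flag, update a.stk k []⟩ (2 * l.length + 1)
  | [], a, h => ⟨none, by
      have := Run.whileNil (P := (.load fun _ s => s)) (t := 0) h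
      rw [← h, Function.update_eq_self]
      exact this.mono (by omega)⟩
  | x :: l, a, h => by
    obtain ⟨r, hr⟩ := run_clear_one k l ⟨some x, a.flag, update a.stk k l⟩ (by simp)
    refine ⟨r, (Run.whileCons h (Run.load (t := 0)) (by simpa using hr)).mono (by simp; omega)⟩

/-- A halting configuration must have empty stacks apart from the output. The last conjunct carries
the induction: a stack that has been emptied stays empty while the others are cleared. -/
theorem run_clear (N : ℕ) : ∀ (ks : List K) (a : State K Γ τ), (∀ k, (a.stk k).length ≤ N) →
    ∃ r S, Run (clear τ ks) a ⟨r, a.flag, S⟩ (ks.length * (2 * N + 1) + 1) ∧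
      (∀ k ∈ ks, S k = []) ∧ ∀ k, a.stk k = [] → S k = []
  | [], a, _ => ⟨a.reg, a.stk, by simpa [clear] using Run.load (t := 0), by simp, fun _ h => h⟩
  | k :: ks, a, h => by
    obtain ⟨r, hr⟩ := run_clear_one k _ a rfl
    obtain ⟨r', S, hS, h₁, h₂⟩ := run_clear N ks ⟨r, a.flag, update a.stk k []⟩ (by
      intro k'
      by_cases hk : k' = k
      · subst hk; simp
      · simpa [hk] using h k')
    refine ⟨r', S, (Run.seq hr hS).mono ?_, ?_, ?_⟩
    · have := h k
      simp only [List.length_cons, Nat.add_mul]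
      omega
    · intro k' hk'
      rcases List.mem_cons.1 hk' with rfl | hk'
      · exact h₂ _ (by simp)
      · exact h₁ _ hk'
    · intro k' hk'
      refine h₂ _ ?_
      by_cases hk : k' = k
      · subst hk; simp
      · simpa [hk] using hk'

/-- Functions with a polynomial bound. -/
def PolyBounded (f : ℕ → ℕ) : Prop := ∃ p : Polynomial ℕ, ∀ n, f n ≤ p.eval n

theorem PolyBounded.const (c : ℕ) : PolyBounded fun _ => c := ⟨.C c, by simp⟩

theorem PolyBounded.id : PolyBounded fun n => n := ⟨.X, by simp⟩

theorem PolyBounded.add {f g : ℕ → ℕ} (hf : PolyBounded f) (hg : PolyBounded g) :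
    PolyBounded fun n => f n + g n := by
  obtain ⟨p, hp⟩ := hf
  obtain ⟨q, hq⟩ := hg
  exact ⟨p + q, fun n => by simpa using Nat.add_le_add (hp n) (hq n)⟩

theorem PolyBounded.mul {f g : ℕ → ℕ} (hf : PolyBounded f) (hg : PolyBounded g) :
    PolyBounded fun n => f n * g n := by
  obtain ⟨p, hp⟩ := hf
  obtain ⟨q, hq⟩ := hg
  exact ⟨p * q, fun n => by simpa using Nat.mul_le_mul (hp n) (hq n)⟩

/-- The machine that runs `P`, empties the stacks, and writes down the answer. -/
noncomputable def machine [Fintype K] [Fintype Γ] [Fintype τ] (P : Prog K Γ τ) (k₀ : K) (s₀ : τ)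
    (ans : τ → Bool) : FinTM2 :=
  letI := finite_lab (Prog.seq P (clear τ Finset.univ.toList))
  { K := Option K
    k₀ := some k₀
    k₁ := none
    Γ := Alph K Γ
    Λ := Option (Lab (.seq P (clear τ Finset.univ.toList)))
    main := some (entry _)
    ΛFin := Fintype.ofFinite _
    σ := Option Γ × τ
    initialState := (none, s₀)
    Γk₀Fin := inferInstanceAs (Fintype Γ)
    m := fun l => match l with
      | some l => code _ some none l
      | none => .push none (fun s => ans s.2) (.load (fun _ => (none, s₀)) .halt) }

/-- The program only has to leave the answer in its flag. Clearing the stacks afterwards is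
polynomial because a run of `T n` steps cannot make them longer than `n + T n`. -/
theorem decidableInPolyTime_of_run [Fintype K] [Fintype Γ] [Fintype τ] {α : Type} {e : α → List Γ}
    {p : α → Prop} (P : Prog K Γ τ) (k₀ : K) (s₀ : τ) (ans : τ → Bool) (T : ℕ → ℕ)
    (hT : PolyBounded T)
    (h : ∀ a, ∃ b, Run P ⟨none, s₀, update (fun _ => []) k₀ (e a)⟩ b (T (e a).length) ∧
      (ans b.flag = true ↔ p a)) :
    OccRen.DecidableInPolyTime e p := by
  classical
  obtain ⟨q, hq⟩ : PolyBounded fun n =>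
      T n + (Fintype.card K * (2 * (n + T n) + 1) + 1) + 1 :=
    (hT.add (((PolyBounded.const _).mul (((PolyBounded.const 2).mul
      (PolyBounded.id.add hT)).add (.const 1))).add (.const 1))).add (.const 1)
  refine ⟨fun a => decide (p a), by simp, ⟨⟨⟨machine P k₀ s₀ ans, Equiv.refl Γ, Equiv.refl Bool⟩,
    q, fun a => ?_⟩⟩⟩
  apply Classical.choice
  obtain ⟨b, hb, hans⟩ := h a
  have hlen : ∀ k, (b.stk k).length ≤ (e a).length + T (e a).length := by
    intro k
    refine (hb.length_le k).trans (Nat.add_le_add_right ?_ _)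
    by_cases hk : k = k₀
    · subst hk; simp
    · simp [hk]
  obtain ⟨r, S, hS, hS₁, -⟩ := run_clear _ (Finset.univ.toList (α := K)) b hlen
  obtain rfl : S = fun _ => [] := funext fun k => hS₁ k (by simp)
  have hl := (hb.seq hS).leads (m := (machine P k₀ s₀ ans).m) some none (fun _ => rfl)
  -- The label `none` pushes the answer to the extra stack and resets the register and the flag,
  -- since `haltList` prescribes the initial internal state.
  have hl' := hl.trans (Leads.single (t := 0) (c' :=
    (haltList (machine P k₀ s₀ ans) (Computability.encodeBool (decide (p a))))) (by
      simp only [liftCfg, TM2.step, machine, TM2.stepAux, haltList]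
      congr 2
      funext k
      cases k with
      | none =>
        have : ans b.flag = decide (p a) := by
          rw [Bool.eq_iff_iff, hans, decide_eq_true_iff]
        simp [liftStk, Computability.encodeBool, this]
        rfl
      | some k => simp [liftStk]))
  obtain ⟨n, hn, hn'⟩ := hl'
  refine ⟨⟨⟨n, ?_⟩, ?_⟩⟩
  · refine Eq.trans ?_ (hn'.trans ?_)
    · congr 2
      simp only [liftCfg, initList, machine]
      congr 1
      funext k
      cases k with
      | none => simp [liftStk]
      | some k =>
        by_cases hk : k = k₀
        · subst hk
          simp only [liftStk, Function.update_self, ↓reduceDIte]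
          exact List.map_id _
        · simp [liftStk, hk]
    · exact congrArg (fun l => some (haltList (machine P k₀ s₀ ans) l)) (List.map_id _).symm
  · refine hn.trans (le_trans ?_ (hq _))
    simp

end StackProgram

/-! ### Reasoning about programs without the register; moving stacks and counting loops. -/

namespace StackProgram

open Function (update)

variable {K Γ τ : Type} [DecidableEq K]

/-- `Run`, with the contents of the register left out. -/
def Runs (P : Prog K Γ τ) (f : τ) (S : K → List Γ) (f' : τ) (S' : K → List Γ) (t : ℕ) : Prop :=
  ∀ r, ∃ r', Run P ⟨r, f, S⟩ ⟨r', f', S'⟩ t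

theorem Runs.mono {P : Prog K Γ τ} {f S f' S' t t'} (h : Runs P f S f' S' t) (ht : t ≤ t') :
    Runs P f S f' S' t' := fun r => (h r).imp fun _ h => h.mono ht

theorem Run.congr {P : Prog K Γ τ} {a r f S S' t t'} (h : Run P a ⟨r, f, S⟩ t) (hS : S = S')
    (ht : t ≤ t') : Run P a ⟨r, f, S'⟩ t' := hS ▸ h.mono ht

theorem Runs.congr {P : Prog K Γ τ} {f S f' S₁ S₂ t t'} (h : Runs P f S f' S₁ t) (hS : S₁ = S₂)
    (ht : t ≤ t') : Runs P f S f' S₂ t' := hS ▸ h.mono ht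

theorem Runs.seq {P Q : Prog K Γ τ} {f S f₁ S₁ f₂ S₂ t u} (h : Runs P f S f₁ S₁ t)
    (h' : Runs Q f₁ S₁ f₂ S₂ u) : Runs (.seq P Q) f S f₂ S₂ (t + u) := fun r =>
  let ⟨r₁, h₁⟩ := h r
  let ⟨r₂, h₂⟩ := h' r₁
  ⟨r₂, .seq h₁ h₂⟩

/-- The program that does nothing. -/
def skip : Prog K Γ τ := .load fun _ f => f

theorem runs_skip (f : τ) (S : K → List Γ) : Runs skip f S f S 1 := fun r => ⟨r, .load (t := 0)⟩

/-- Set the flag. -/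
theorem runs_load (g : τ → τ) (f : τ) (S : K → List Γ) : Runs (.load fun _ => g) f S (g f) S 1 :=
  fun r => ⟨r, .load (t := 0)⟩

theorem runs_push (k : K) (x : Γ) (f : τ) (S : K → List Γ) :
    Runs (.push k fun _ _ => x) f S f (update S k (x :: S k)) 1 :=
  fun r => ⟨r, .push (t := 0)⟩

theorem runs_whileNil {k : K} {P : Prog K Γ τ} {f : τ} {S : K → List Γ} (h : S k = []) :
    Runs (.whilePop k P) f S f S 1 :=
  fun r => ⟨none, Run.whileNil (a := ⟨r, f, S⟩) (t := 0) h⟩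

theorem runs_whileCons {k : K} {P : Prog K Γ τ} {f f₁ f₂ : τ} {S S₁ S₂ : K → List Γ} {x l t u}
    (h : S k = x :: l) (h₁ : Runs P f (update S k l) f₁ S₁ t)
    (h₂ : Runs (.whilePop k P) f₁ S₁ f₂ S₂ u) : Runs (.whilePop k P) f S f₂ S₂ (t + u + 1) :=
  fun r =>
    let ⟨r₁, h₁⟩ := h₁ (some x)
    let ⟨r₂, h₂⟩ := h₂ r₁
    ⟨r₂, Run.whileCons (a := ⟨r, f, S⟩) h h₁ h₂⟩

theorem runs_iteTrue {p : τ → Bool} {P Q : Prog K Γ τ} {f f' : τ} {S S' : K → List Γ} {t}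
    (hp : p f = true) (h : Runs P f S f' S' t) : Runs (.ite p P Q) f S f' S' (t + 1) :=
  fun r => (h r).imp fun _ h => .iteTrue hp h

theorem runs_iteFalse {p : τ → Bool} {P Q : Prog K Γ τ} {f f' : τ} {S S' : K → List Γ} {t}
    (hp : p f = false) (h : Runs Q f S f' S' t) : Runs (.ite p P Q) f S f' S' (t + 1) :=
  fun r => (h r).imp fun _ h => .iteFalse hp h

variable [Inhabited Γ]

/-- Push the letter in the register. -/
def pushReg (k : K) : Prog K Γ τ := .push k fun r _ => r.getD default

/-- Push the letter in the register to several stacks. -/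
def pushRegs : List K → Prog K Γ τ
  | [] => skip
  | k :: ks => .seq (pushReg k) (pushRegs ks)

theorem run_pushRegs (x : Γ) (f : τ) : ∀ (ks : List K), ks.Nodup → ∀ S : K → List Γ,
    Run (pushRegs ks) ⟨some x, f, S⟩ ⟨some x, f, fun k => if k ∈ ks then x :: S k else S k⟩
      (ks.length + 1)
  | [], _, S => (Run.load (t := 0)).congr (by simp) (by simp)
  | k :: ks, h, S => by
    have h' := List.nodup_cons.1 h
    have := Run.seq (Run.push (k := k) (f := fun r _ => r.getD default) (t := 0)
      (a := ⟨some x, f, S⟩)) (run_pushRegs x f ks h'.2 _)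
    refine this.congr ?_ (by simp; omega)
    funext k'
    by_cases hk : k' = k
    · subst hk; simp [h'.1]
    · simp [hk]

/-- Move the contents of `k` to several stacks. -/
def moveAll (k : K) (ks : List K) : Prog K Γ τ := .whilePop k (pushRegs ks)

/-- Copying to several stacks at once is how words are duplicated. Every transfer reverses the word,
so a faithful copy takes two of them. -/
theorem runs_moveAll (k : K) (ks : List K) (hk : k ∉ ks) (hks : ks.Nodup) (f : τ) :
    ∀ (l : List Γ) (S : K → List Γ), S k = l →
    Runs (moveAll k ks) f S f
      (fun k' => if k' = k then [] else if k' ∈ ks then l.reverse ++ S k' else S k')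
      (l.length * (ks.length + 2) + 1)
  | [], S, h => fun r => ⟨none, by
      have := Run.whileNil (P := pushRegs ks) (a := ⟨r, f, S⟩) (t := 0) h
      refine this.congr ?_ (by simp)
      funext k'
      by_cases hk' : k' = k
      · subst hk'; simp [h]
      · simp [hk']⟩
  | x :: l, S, h => fun r => by
    obtain ⟨r', hr'⟩ := runs_moveAll k ks hk hks f l
      (fun k' => if k' ∈ ks then x :: update S k l k' else update S k l k') (by simp [hk])
      (some x)
    refine ⟨r', ?_⟩
    have := Run.whileCons (a := ⟨r, f, S⟩) h (run_pushRegs x f ks hks (update S k l)) hr'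
    refine this.congr ?_ (by simp only [List.length_cons]; ring_nf; omega)
    funext k'
    by_cases hk' : k' = k
    · simp [hk']
    · by_cases hm : k' ∈ ks <;> simp [hk', hm]

/-- Move the contents of `k` to `k'`. -/
def move (k k' : K) : Prog K Γ τ := moveAll k [k']

theorem runs_move {k k' : K} (hk : k ≠ k') (f : τ) (S : K → List Γ) :
    Runs (move k k') f S f (update (update S k []) k' ((S k).reverse ++ S k'))
      (3 * (S k).length + 1) := by
  have := runs_moveAll k [k'] (by simpa using hk) (by simp) f _ S rfl
  refine this.congr ?_ (by simp; omega)
  funext i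
  by_cases h : i = k'
  · subst h; simp [hk.symm]
  · by_cases h' : i = k <;> simp [h, h', update, hk]

/-- Run `P` once for every letter on `k`; meanwhile the letters are moved to `k'`. -/
def forEach (k k' : K) (P : Prog K Γ τ) : Prog K Γ τ :=
  .seq (.whilePop k (.seq (pushReg k') P)) (move k' k)

/-- Loop invariant: after `i` rounds the stacks are `S i`, except that `k` holds the letters still
to come and `k'` those already used, reversed. The body must therefore work for arbitrary contents
`A`, `B` of these two stacks. -/
theorem runs_forEach_aux {k k' : K} (hk : k ≠ k') {P : Prog K Γ τ} {f : τ} {T : ℕ}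
    (S : ℕ → K → List Γ) (n : ℕ) (hP : ∀ i < n, ∀ A B,
      Runs P f (update (update (S i) k A) k' B) f (update (update (S (i + 1)) k A) k' B) T) :
    ∀ (l : List Γ) (B : List Γ) (i : ℕ), i + l.length = n →
      Runs (.whilePop k (.seq (pushReg k') P)) f (update (update (S i) k l) k' B) f
        (update (update (S n) k []) k' (l.reverse ++ B)) (l.length * (T + 2) + 1)
  | [], B, i, h => fun r => ⟨none, by
      obtain rfl : i = n := by simpa using h
      have := Run.whileNil (P := .seq (pushReg k') P)
        (a := ⟨r, f, update (update (S i) k []) k' B⟩) (t := 0) (k := k) (by simp [hk])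
      simpa using this⟩
  | x :: l, B, i, h => fun r => by
    obtain ⟨r₁, h₁⟩ := hP i (by simp at h; omega) l (x :: B) (some x)
    obtain ⟨r₂, h₂⟩ := runs_forEach_aux hk S n hP l (x :: B) (i + 1) (by simp at h; omega) r₁
    refine ⟨r₂, ?_⟩
    have e : update (update (update (update (S i) k (x :: l)) k' B) k l) k' (x :: B) =
        update (update (S i) k l) k' (x :: B) := by
      rw [Function.update_comm hk.symm, Function.update_idem, Function.update_idem]
    have := Run.whileCons (a := ⟨r, f, update (update (S i) k (x :: l)) k' B⟩) (k := k) (x := x)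
      (l := l) (by simp [hk]) (Run.seq (Run.push (t := 0) (k := k')
        (f := fun r _ => r.getD default)) (by simpa [hk.symm, e] using h₁)) h₂
    refine this.congr (by simp) ?_
    simp only [List.length_cons, Nat.add_mul]; omega

/-- A stack serves as a unary counter that survives the loop: the final move from `k'` puts the
letters back in their original order. -/
theorem runs_forEach {k k' : K} (hk : k ≠ k') {P : Prog K Γ τ} {f : τ} {T : ℕ}
    (S : ℕ → K → List Γ) (l : List Γ) (hS : ∀ i ≤ l.length, S i k = l ∧ S i k' = [])
    (hP : ∀ i < l.length, ∀ A B,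
      Runs P f (update (update (S i) k A) k' B) f (update (update (S (i + 1)) k A) k' B) T) :
    Runs (forEach k k' P) f (S 0) f (S l.length) (l.length * (T + 5) + 2) := by
  have h := runs_forEach_aux hk S l.length hP l [] 0 (by simp)
  have h' := h.seq (runs_move hk.symm f _)
  have e : update (update (S 0) k l) k' [] = S 0 := by
    rw [← (hS 0 (by simp)).1, Function.update_eq_self, ← (hS 0 (by simp)).2,
      Function.update_eq_self]
  rw [e] at h'
  refine h'.congr ?_ (by simp; ring_nf; omega)
  funext i
  by_cases hi : i = k
  · subst hi; simp [hk, (hS l.length le_rfl).1]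
  · by_cases hi' : i = k'
    · subst hi'; simp [hi, (hS l.length le_rfl).2]
    · simp [hi, hi']

end StackProgram

/-! ### Datalog over words -/

namespace Datalog

open StackProgram OccRen
open Function (update)

/-- The terms `x`, `x + 1`, `0` and `1`. -/
structure Tm (ν : Type) where
  base : Option ν
  succ : Bool

/-- The value of a term. -/
def Tm.eval {ν : Type} (ρ : ν → ℕ) (t : Tm ν) : ℕ := t.base.elim 0 ρ + t.succ.toNat

/-- Atoms of binary relations. -/
structure Atom (J ν : Type) where
  rel : J
  fst : Tm ν
  snd : Tm ν

/-- The fact that an atom states. -/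
def Atom.eval {J ν : Type} (ρ : ν → ℕ) (a : Atom J ν) : J × ℕ × ℕ :=
  (a.rel, a.fst.eval ρ, a.snd.eval ρ)

/-- A rule derives its head from its body; the guards test the letters at the positions that are
the values of the variables. -/
structure Rule (J ν : Type) where
  guards : List (ν × (Option Letter → Bool))
  body : List (Atom J ν)
  head : Atom J ν

variable {J ν : Type}

/-- The facts about the positions of a word that are derivable by the rules. -/
inductive Der (R : List (Rule J ν)) (w : List Letter) : J × ℕ × ℕ → Prop
  | intro (r : Rule J ν) (hr : r ∈ R) (ρ : ν → ℕ) (hρ : ∀ x, ρ x ≤ w.length)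
      (hg : ∀ g ∈ r.guards, g.2 w[ρ g.1]? = true) (hb : ∀ a ∈ r.body, Der R w (a.eval ρ)) :
      Der R w (r.head.eval ρ)

/-- Variables range over `0, …, n`, where `n` is the position after the last letter, and a term may
add one. Hence tables with `n + 2` rows and columns. -/
theorem Tm.eval_lt {ρ : ν → ℕ} {n : ℕ} (hρ : ∀ x, ρ x ≤ n) (t : Tm ν) : t.eval ρ < n + 2 := by
  obtain ⟨b, s⟩ := t
  have : s.toNat ≤ 1 := Bool.toNat_le s
  cases b with
  | none => simp [Tm.eval]; omega
  | some x => have := hρ x; simp [Tm.eval]; omega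

theorem Der.lt {R : List (Rule J ν)} {w : List Letter} {a} (h : Der R w a) :
    a.2.1 < w.length + 2 ∧ a.2.2 < w.length + 2 := by
  obtain ⟨r, hr, ρ, hρ, -, -⟩ := h
  exact ⟨Tm.eval_lt hρ _, Tm.eval_lt hρ _⟩

/-- The stacks of the machine that computes the derivable facts. -/
inductive Stk (J ν : Type)
  | input
  /-- the letters before the position of `x` -/
  | left (x : ν)
  /-- the letters from the position of `x` onwards -/
  | right (x : ν)
  | table (j : J)
  /-- the part of a table that has been passed -/
  | walked
  | saved
  | row
  | savedRow
  | token
  deriving DecidableEq, Fintype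

instance : Inhabited Letter := ⟨.bit true⟩

/-- The programs of the machine; the flags tell whether the current rule is applicable, and whether
a fact has been added. -/
abbrev Pr (J ν : Type) : Type := Prog (Stk J ν) Letter (Bool × Bool)

variable [DecidableEq J]

/-- The table of the relation `j`. -/
def tab (M : ℕ) (D : Finset (J × ℕ × ℕ)) (j : J) : List Letter :=
  (List.range (M * M)).map fun p => Letter.bit (decide ((j, p / M, p % M) ∈ D))

theorem length_tab (M : ℕ) (D : Finset (J × ℕ × ℕ)) (j : J) : (tab M D j).length = M * M := by
  simp [tab]

theorem index_lt {M x y : ℕ} (hx : x < M) (hy : y < M) : x * M + y < M * M := by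
  nlinarith [Nat.mul_le_mul_right M (Nat.succ_le_of_lt hx)]

/-- Tables are stored in row-major order. -/
theorem getElem_tab {M x y : ℕ} (D : Finset (J × ℕ × ℕ)) (j : J) (hx : x < M) (hy : y < M) :
    (tab M D j)[x * M + y]? = some (Letter.bit (decide ((j, x, y) ∈ D))) := by
  have hM : 0 < M := by omega
  have h1 : (x * M + y) / M = x := by
    rw [Nat.mul_comm, Nat.mul_add_div hM, Nat.div_eq_of_lt hy, Nat.add_zero]
  have h2 : (x * M + y) % M = y := by rw [Nat.mul_comm, Nat.mul_add_mod, Nat.mod_eq_of_lt hy]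
  simp [tab, index_lt hx hy, h1, h2]

theorem set_tab {M x y : ℕ} (D : Finset (J × ℕ × ℕ)) (j : J) (hx : x < M) (hy : y < M) :
    (tab M D j).set (x * M + y) (Letter.bit true) = tab M (insert (j, x, y) D) j := by
  have hM : 0 < M := by omega
  apply List.ext_getElem (by simp [tab])
  intro p hp _
  have hp' : p < M * M := by simpa [tab] using hp
  by_cases h : x * M + y = p
  · subst h
    have h1 : (x * M + y) / M = x := by
      rw [Nat.mul_comm, Nat.mul_add_div hM, Nat.div_eq_of_lt hy, Nat.add_zero]
    have h2 : (x * M + y) % M = y := by rw [Nat.mul_comm, Nat.mul_add_mod, Nat.mod_eq_of_lt hy]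
    simp [tab, h1, h2]
  · have : ¬ (p / M = x ∧ p % M = y) := by
      rintro ⟨rfl, rfl⟩
      exact h (by rw [Nat.mul_comm]; exact Nat.div_add_mod p M)
    simp [tab, h, this]

theorem tab_insert_of_ne {M : ℕ} {D : Finset (J × ℕ × ℕ)} {j j' : J} (h : j' ≠ j) (x y : ℕ) :
    tab M (insert (j, x, y) D) j' = tab M D j' := by
  simp [tab, h]

/-- The stacks, where the variables have the values given by `ρ` and the facts in `D` have been
derived. -/
def st (w : List Letter) (ρ : ν → ℕ) (D : Finset (J × ℕ × ℕ)) : Stk J ν → List Letter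
  | .left x => (w.take (ρ x)).reverse
  | .right x => w.drop (ρ x)
  | .table j => tab (w.length + 2) D j
  | .row => .bit true :: .bit true :: w
  | _ => []

/-- Stacks in which the variables have the values given by `ρ`. -/
def envSet (J : Type) (M : ℕ) (ρ : ν → ℕ) : Set (Stk J ν → List Letter) :=
  {S | ((S .row).length = M ∧ S .savedRow = []) ∧ (∀ x, (S (.left x)).length = ρ x) ∧ S .saved = []}

theorem st_mem_envSet {w : List Letter} {ρ : ν → ℕ} (hρ : ∀ x, ρ x ≤ w.length)
    (D : Finset (J × ℕ × ℕ)) : st w ρ D ∈ envSet J (w.length + 2) ρ := by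
  simp [envSet, st, hρ]

variable [DecidableEq ν]

/-- The stacks `S`, where the table of `j` is `L` and has been passed up to `p`. -/
def cur (S : Stk J ν → List Letter) (j : J) (L : List Letter) (p : ℕ) : Stk J ν → List Letter :=
  update (update S (.table j) (L.drop p)) .walked (L.take p).reverse

theorem update_cur (S : Stk J ν → List Letter) {j : J} {L : List Letter} {p : ℕ} {k : Stk J ν}
    (h₁ : k ≠ .table j) (h₂ : k ≠ .walked) (A : List Letter) :
    update (cur S j L p) k A = cur (update S k A) j L p := by
  rw [cur, cur, Function.update_comm h₂.symm, Function.update_comm h₁.symm]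

/-- `P` advances by `d` in the table of `j`. -/
def Walks (P : Pr J ν) (d : ℕ) (j : J) (𝒮 : Set (Stk J ν → List Letter)) (t : ℕ) : Prop :=
  ∀ S ∈ 𝒮, ∀ L p f, p + d ≤ L.length → Runs P f (cur S j L p) f (cur S j L (p + d)) t

theorem Walks.mono {P : Pr J ν} {d j 𝒮 𝒮' t t'} (h : Walks P d j 𝒮 t) (h𝒮 : 𝒮' ⊆ 𝒮)
    (ht : t ≤ t') : Walks P d j 𝒮' t' :=
  fun S hS L p f hp => (h S (h𝒮 hS) L p f hp).mono ht

theorem Walks.seq {P Q : Pr J ν} {d e j 𝒮 t u} (h : Walks P d j 𝒮 t) (h' : Walks Q e j 𝒮 u) :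
    Walks (.seq P Q) (d + e) j 𝒮 (t + u) := fun S hS L p f hp => by
  have := (h S hS L p f (by omega)).seq (h' S hS L (p + d) f (by omega))
  rwa [Nat.add_assoc] at this

theorem walks_skip (j : J) (𝒮) : Walks (ν := ν) skip 0 j 𝒮 1 := fun _ _ _ _ _ _ => runs_skip _ _

/-- Advance by one entry. -/
def walkOne (j : J) : Pr J ν := .seq (.pop (.table j)) (pushReg .walked)

theorem walks_walkOne (j : J) (𝒮) : Walks (ν := ν) (walkOne j) 1 j 𝒮 2 := by
  intro S _ L p f hp r
  refine ⟨_, (Run.seq (Run.pop (t := 0)) (Run.push (t := 0))).congr ?_ le_rfl⟩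
  have hp' : p < L.length := by omega
  funext k
  by_cases h : k = .walked
  · subst h
    have h₁ : (L.drop p).head? = some L[p] := by
      rw [List.head?_drop, List.getElem?_eq_getElem hp']
    have h₂ : L.take (p + 1) = L.take p ++ [L[p]] := List.take_succ_eq_append_getElem hp'
    simp only [cur, Function.update_self, ne_eq, reduceCtorEq, not_false_eq_true,
      Function.update_of_ne, h₁, h₂, Option.getD_some, List.reverse_append, List.reverse_singleton,
      List.singleton_append]
  · by_cases h' : k = .table j
    · subst h'; simp [cur]
    · simp [cur, h, h']

/-- Multiplication by iteration: repeating a walk by `d` once per letter of a counter of length `m`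
walks by `m * d`. Index arithmetic on tables is done entirely in this way. -/
theorem walks_forEach {P : Pr J ν} {d j 𝒮 𝒮' t} {k k' : Stk J ν} (hk : k ≠ k') {m : ℕ}
    (hkj : k ≠ .table j) (hkw : k ≠ .walked) (hkj' : k' ≠ .table j) (hkw' : k' ≠ .walked)
    (h : Walks P d j 𝒮 t) (h₁ : ∀ S ∈ 𝒮', ∀ A B, update (update S k A) k' B ∈ 𝒮)
    (h₂ : ∀ S ∈ 𝒮', (S k).length = m ∧ S k' = []) :
    Walks (forEach k k' P) (m * d) j 𝒮' (m * (t + 5) + 2) := by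
  intro S hS L p f hp
  obtain ⟨rfl, h₂'⟩ := h₂ S hS
  have := runs_forEach (f := f) (T := t) hk (P := P) (fun i => cur S j L (p + i * d)) (S k) (by
    intro i _
    simp [cur, hkj, hkw, hkj', hkw', h₂']) (by
    intro i hi A B
    rw [update_cur _ hkj hkw, update_cur _ hkj' hkw', update_cur _ hkj hkw,
      update_cur _ hkj' hkw']
    have := h _ (h₁ S hS A B) L (p + i * d) f (by
      have : (i + 1) * d ≤ (S k).length * d := Nat.mul_le_mul_right _ hi
      rw [Nat.add_mul] at this
      omega)
    rwa [show p + i * d + d = p + (i + 1) * d by ring] at this)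
  simpa using this

/-- Advance by one row. -/
def walkRow (j : J) : Pr J ν := forEach .row .savedRow (walkOne j)

/-- Stacks in which the lengths of `row` is `M`. -/
def rowSet (J ν : Type) (M : ℕ) : Set (Stk J ν → List Letter) :=
  {S | (S .row).length = M ∧ S .savedRow = []}

theorem walks_walkRow (j : J) (M : ℕ) : Walks (ν := ν) (walkRow j) M j (rowSet J ν M) (M * 7 + 2) := by
  have := walks_forEach (ν := ν) (k := .row) (k' := .savedRow) (by simp) (by simp) (by simp)
    (by simp) (by simp) (walks_walkOne j Set.univ) (𝒮' := rowSet J ν M) (m := M)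
    (fun _ _ _ _ => Set.mem_univ _) (fun S hS => hS)
  rwa [Nat.mul_one] at this

/-- Advance by the value of a term, where `P` advances by one unit. -/
def walkTm (P : Pr J ν) (t : Tm ν) : Pr J ν :=
  .seq (t.base.elim skip fun x => forEach (.left x) .saved P) (if t.succ then P else skip)

theorem walks_walkTm {P : Pr J ν} {d j M t n} {ρ : ν → ℕ} (hρ : ∀ x, ρ x ≤ n)
    (h : Walks P d j (rowSet J ν M) t) (u : Tm ν) :
    Walks (walkTm P u) (u.eval ρ * d) j (envSet J M ρ) (n * (t + 5) + 3 + t) := by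
  have hsub : envSet J M ρ ⊆ rowSet J ν M := fun S hS => hS.1
  have h₁ : Walks (u.base.elim skip fun x => forEach (.left x) .saved P) (u.base.elim 0 ρ * d) j
      (envSet J M ρ) (n * (t + 5) + 2) := by
    cases u.base with
    | none => simpa using (walks_skip j _).mono subset_rfl (by omega)
    | some x =>
      refine (walks_forEach (by simp) (by simp) (by simp) (by simp) (by simp) h
        (𝒮' := envSet J M ρ) (m := ρ x) ?_ ?_).mono subset_rfl ?_
      · intro S hS A B
        exact ⟨by simpa using hS.1.1, by simpa using hS.1.2⟩
      · exact fun S hS => ⟨hS.2.1 x, hS.2.2⟩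
      · have := Nat.mul_le_mul_right (t + 5) (hρ x)
        omega
  have h₂ : Walks (if u.succ then P else skip) (u.succ.toNat * d) j (envSet J M ρ) (t + 1) := by
    cases u.succ with
    | false => simpa using (walks_skip j _).mono subset_rfl (by omega)
    | true => simpa using h.mono hsub (by omega)
  have := h₁.seq h₂
  rw [← Nat.add_mul] at this
  exact this.mono subset_rfl (by omega)

/-- Advance to the entry of an atom. -/
def goTo (a : Atom J ν) : Pr J ν :=
  .seq (walkTm (walkRow a.rel) a.fst) (walkTm (walkOne a.rel) a.snd)

/-- The time for `goTo`. -/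
def goToTime (n : ℕ) : ℕ := (n * ((n + 2) * 7 + 2 + 5) + 3 + ((n + 2) * 7 + 2)) + (n * 7 + 5)

/-- Walk whole rows for the first argument and single entries for the second. The value of a
variable `x` is available as the length of the stack `left x`. -/
theorem walks_goTo {n : ℕ} {ρ : ν → ℕ} (hρ : ∀ x, ρ x ≤ n) (a : Atom J ν) :
    Walks (goTo a) (a.fst.eval ρ * (n + 2) + a.snd.eval ρ) a.rel (envSet J (n + 2) ρ)
      (goToTime n) := by
  have := (walks_walkTm hρ (walks_walkRow a.rel (n + 2)) a.fst).seq
    (walks_walkTm hρ (walks_walkOne a.rel (rowSet J ν (n + 2))) a.snd)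
  rw [Nat.mul_one] at this
  exact this

/-- Return to the beginning of the table. -/
def unwind (j : J) : Pr J ν := move .walked (.table j)

theorem cur_st_zero (w : List Letter) (ρ : ν → ℕ) (D : Finset (J × ℕ × ℕ)) (j : J) :
    cur (st w ρ D) j (tab (w.length + 2) D j) 0 = st w ρ D := by
  funext k
  by_cases h : k = .walked
  · subst h; simp [cur, st]
  · by_cases h' : k = .table j
    · subst h'; simp [cur, st]
    · simp [cur, h, h']

theorem runs_unwind (S : Stk J ν → List Letter) (j : J) (A B : List Letter) (f : Bool × Bool) :
    Runs (unwind j) f (update (update S (.table j) B) .walked A) f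
      (update (update S (.table j) (A.reverse ++ B)) .walked []) (3 * A.length + 1) := by
  refine (runs_move (k := Stk.walked) (k' := Stk.table j) (by simp) f _).congr ?_ (by simp)
  funext k
  by_cases h : k = .walked
  · subst h; simp
  · by_cases h' : k = .table j
    · subst h'; simp
    · simp [h, h']

/-- Test whether an atom has been derived. -/
def testAtom (a : Atom J ν) : Pr J ν :=
  .seq (goTo a) (.seq (.peek (.table a.rel))
    (.seq (.load fun r f => (f.1 && decide (r = some (.bit true)), f.2)) (unwind a.rel)))

/-- The time to handle an atom. -/
def atomTime (n : ℕ) : ℕ := goToTime n + 3 * ((n + 2) * (n + 2)) + 4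

theorem runs_testAtom {w : List Letter} {ρ : ν → ℕ} (hρ : ∀ x, ρ x ≤ w.length)
    (D : Finset (J × ℕ × ℕ)) (a : Atom J ν) (f : Bool × Bool) :
    Runs (testAtom a) f (st w ρ D) (f.1 && decide (a.eval ρ ∈ D), f.2) (st w ρ D)
      (atomTime w.length) := by
  intro r
  have hx := Tm.eval_lt hρ a.fst
  have hy := Tm.eval_lt hρ a.snd
  have hlt := index_lt hx hy
  obtain ⟨r₁, h₁⟩ := walks_goTo hρ a _ (st_mem_envSet hρ D) (tab (w.length + 2) D a.rel) 0 f
    (by rw [length_tab]; omega) r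
  rw [cur_st_zero, Nat.zero_add] at h₁
  obtain ⟨r₂, h₂⟩ := runs_unwind (st w ρ D) a.rel
    ((tab (w.length + 2) D a.rel).take (a.fst.eval ρ * (w.length + 2) + a.snd.eval ρ)).reverse
    ((tab (w.length + 2) D a.rel).drop (a.fst.eval ρ * (w.length + 2) + a.snd.eval ρ))
    (f.1 && decide (a.eval ρ ∈ D), f.2) (some (Letter.bit (decide (a.eval ρ ∈ D))))
  have h₀ := cur_st_zero w ρ D a.rel
  refine ⟨r₂, (Run.seq h₁ (Run.seq (Run.peek (t := 0)) (Run.seq (Run.load (t := 0)) ?_))).congr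
    (t := goToTime w.length + (0 + 1 + (0 + 1 + (3 * ((w.length + 2) * (w.length + 2)) + 1))))
    h₀ (by simp only [atomTime]; omega)⟩
  have e : (cur (st w ρ D) a.rel (tab (w.length + 2) D a.rel)
      (a.fst.eval ρ * (w.length + 2) + a.snd.eval ρ) (.table a.rel)).head? =
      some (Letter.bit (decide (a.eval ρ ∈ D))) := by
    simp only [cur]
    rw [Function.update_of_ne (by simp), Function.update_self, List.head?_drop,
      getElem_tab D a.rel hx hy]
    rfl
  simp only [e]
  have e' : decide (some (Letter.bit (decide (a.eval ρ ∈ D))) = some (Letter.bit true)) =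
      decide (a.eval ρ ∈ D) := by simp
  rw [e']
  refine h₂.congr ?_ ?_
  · simp [cur]
  · simp [length_tab]

/-- Add an atom if the current rule is applicable. -/
def addAtom (a : Atom J ν) : Pr J ν :=
  .seq (goTo a) (.seq (.seq (.pop (.table a.rel))
    (.seq (.load fun r f => (f.1, f.2 || (f.1 && !decide (r = some (.bit true)))))
      (.push (.table a.rel) fun r f => if f.1 then .bit true else r.getD default)))
        (unwind a.rel))

theorem update_table_insert (w : List Letter) (ρ : ν → ℕ) (D : Finset (J × ℕ × ℕ)) (j : J)
    (x y : ℕ) : update (st w ρ D) (.table j) (tab (w.length + 2) (insert (j, x, y) D) j) =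
      st w ρ (insert (j, x, y) D) := by
  funext k
  by_cases h : k = .table j
  · subst h; simp [st]
  · rw [Function.update_of_ne h]
    cases k with
    | table j' => simp only [st]; rw [tab_insert_of_ne (fun h' => h (by rw [h']))]
    | _ => rfl

/-- The second flag is raised only if the fact is new; this is what makes "a round without change"
detectable. -/
theorem runs_addAtom {w : List Letter} {ρ : ν → ℕ} (hρ : ∀ x, ρ x ≤ w.length)
    (D : Finset (J × ℕ × ℕ)) (a : Atom J ν) (f : Bool × Bool) :
    Runs (addAtom a) f (st w ρ D) (f.1, f.2 || (f.1 && !decide (a.eval ρ ∈ D)))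
      (st w ρ (if f.1 then insert (a.eval ρ) D else D)) (atomTime w.length + 1) := by
  intro r
  have hx := Tm.eval_lt hρ a.fst
  have hy := Tm.eval_lt hρ a.snd
  have hlt := index_lt hx hy
  obtain ⟨r₁, h₁⟩ := walks_goTo hρ a _ (st_mem_envSet hρ D) (tab (w.length + 2) D a.rel) 0 f
    (by rw [length_tab]; omega) r
  rw [cur_st_zero, Nat.zero_add] at h₁
  set p := a.fst.eval ρ * (w.length + 2) + a.snd.eval ρ with hp
  set L := tab (w.length + 2) D a.rel with hL
  have hget : L[p]? = some (Letter.bit (decide (a.eval ρ ∈ D))) := getElem_tab D a.rel hx hy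
  have hpL : p < L.length := by rw [hL, length_tab]; exact hlt
  have e : (cur (st w ρ D) a.rel L p (.table a.rel)).head? =
      some (Letter.bit (decide (a.eval ρ ∈ D))) := by
    simp only [cur]
    rw [Function.update_of_ne (by simp), Function.update_self, List.head?_drop, hget]
  obtain ⟨r₂, h₂⟩ := runs_unwind (st w ρ D) a.rel (L.take p).reverse
    ((if f.1 then Letter.bit true else Letter.bit (decide (a.eval ρ ∈ D))) :: L.drop (p + 1))
    (f.1, f.2 || (f.1 && !decide (a.eval ρ ∈ D))) (some (Letter.bit (decide (a.eval ρ ∈ D))))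
  have h₃ := Run.seq (Run.pop (t := 0) (a := ⟨r₁, f, cur (st w ρ D) a.rel L p⟩)
    (k := .table a.rel)) (Run.seq (Run.load (t := 0)
      (f := fun r f => (f.1, f.2 || (f.1 && !decide (r = some (.bit true))))))
      (Run.push (t := 0) (k := .table a.rel)
        (f := fun r f => if f.1 then .bit true else r.getD default)))
  have e' : decide (some (Letter.bit (decide (a.eval ρ ∈ D))) = some (Letter.bit true)) =
      decide (a.eval ρ ∈ D) := by simp
  simp only [e, e', Option.getD_some, Function.update_self, Function.update_idem] at h₃
  have e'' : ∀ x, update (cur (st w ρ D) a.rel L p) (.table a.rel)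
      (x :: (cur (st w ρ D) a.rel L p (.table a.rel)).tail) =
      update (update (st w ρ D) (.table a.rel) (x :: L.drop (p + 1))) .walked
        (L.take p).reverse := by
    intro x
    funext k
    by_cases h : k = .walked
    · subst h; simp [cur]
    · by_cases h' : k = .table a.rel
      · subst h'; simp [cur]
      · simp [cur, h, h']
  rw [e''] at h₃
  refine ⟨r₂, (h₁.seq (h₃.seq h₂)).congr ?_ ?_⟩
  · rw [List.reverse_reverse]
    have hw : ∀ l, update (update (st w ρ D) (.table a.rel) l) .walked [] =
        update (st w ρ D) (.table a.rel) l := fun l => by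
      rw [Function.update_eq_iff]; simp [st]
    rw [hw]
    -- An applicable rule overwrites the entry, which is an insertion into `D`; otherwise the popped
    -- letter is put back and nothing changes.
    by_cases hf : f.1 = true
    · simp only [hf, if_true]
      refine Eq.trans ?_ (update_table_insert w ρ D a.rel (a.fst.eval ρ) (a.snd.eval ρ))
      congr 1
      rw [← set_tab D a.rel hx hy, List.set_eq_take_append_cons_drop, if_pos hpL]
    · simp only [hf]
      have : L.take p ++ Letter.bit (decide (a.eval ρ ∈ D)) :: L.drop (p + 1) = L := by
        have h3 : L[p] = Letter.bit (decide (a.eval ρ ∈ D)) := by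
          rw [List.getElem?_eq_getElem hpL] at hget
          exact Option.some.inj hget
        rw [← h3, List.getElem_cons_drop, List.take_append_drop]
      simp only [Bool.false_eq_true, if_false, this]
      exact Function.update_eq_self (f := st w ρ D) (.table a.rel)
  · simp only [List.length_reverse, List.length_take, atomTime]
    have := Nat.min_le_left p L.length
    omega

end Datalog

/-! ### Saturation under the rules, its initialization, and its cost. -/

namespace Datalog

open StackProgram OccRen
open Function (update)

variable {J ν : Type}

/-- Run programs one after the other. -/
def seqs : List (Pr J ν) → Pr J ν
  | [] => skip
  | P :: Ps => .seq P (seqs Ps)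

/-- The body and the guards of a rule are satisfied by the facts in `D`. -/
def Applicable (w : List Letter) (D : Finset (J × ℕ × ℕ)) (r : Rule J ν) (ρ : ν → ℕ) : Prop :=
  (∀ g ∈ r.guards, g.2 w[ρ g.1]? = true) ∧ ∀ a ∈ r.body, a.eval ρ ∈ D

/-- The effect of trying the instances of rules in `A`: facts are added to `D`, and the flag is set
if this is the case. -/
structure Tried (R : List (Rule J ν)) (w : List Letter) (A : Set (Rule J ν × (ν → ℕ))) (c : Bool)
    (D : Finset (J × ℕ × ℕ)) (c' : Bool) (D' : Finset (J × ℕ × ℕ)) : Prop where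
  sub : D ⊆ D'
  sound : (∀ a ∈ D, Der R w a) → ∀ a ∈ D', Der R w a
  closed : c' = false → c = false ∧ D' = D ∧
    ∀ p ∈ A, Applicable w D p.1 p.2 → p.1.head.eval p.2 ∈ D
  grows : c = false → c' = true → D ⊂ D'

/-- Closure under the tried instances is claimed only if the flag stays down. Then no fact was added
in either stage, so both closure statements speak of the same `D` and can be joined. -/
theorem Tried.trans {R : List (Rule J ν)} {w A B c D c' D' c'' D''} (h : Tried R w A c D c' D')
    (h' : Tried R w B c' D' c'' D'') : Tried R w (A ∪ B) c D c'' D'' where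
  sub := h.sub.trans h'.sub
  sound hD := h'.sound (h.sound hD)
  closed hc := by
    obtain ⟨hc', rfl, h₁⟩ := h'.closed hc
    obtain ⟨hc, rfl, h₂⟩ := h.closed hc'
    exact ⟨hc, rfl, fun p hp => hp.elim (h₂ p) (h₁ p)⟩
  grows hc hc'' := by
    cases c' with
    | true => exact (h.grows hc rfl).trans_subset h'.sub
    | false =>
      obtain ⟨-, rfl, -⟩ := h.closed rfl
      exact h'.grows rfl hc''

theorem Tried.mono {R : List (Rule J ν)} {w A B c D c' D'} (h : Tried R w A c D c' D')
    (hB : B ⊆ A) : Tried R w B c D c' D' :=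
  { h with closed := fun hc => (h.closed hc).imp_right (And.imp_right fun h p hp => h p (hB hp)) }

theorem Tried.refl (R : List (Rule J ν)) (w c D) : Tried R w ∅ c D c D where
  sub := subset_rfl
  sound := id
  closed hc := ⟨hc, rfl, by simp⟩
  grows hc hc' := by simp [hc] at hc'

/-! Running times -/

/-- The time for trying a rule. -/
def ruleTime (r : Rule J ν) (n : ℕ) : ℕ :=
  1 + ((r.guards.length * 2 + 1) + ((r.body.length * atomTime n + 1) + (atomTime n + 1)))

/-- The time for trying rules one after the other. -/
def rulesTime (R : List (Rule J ν)) (n : ℕ) : ℕ := (R.map fun r => ruleTime r n).sum + 1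

/-- The time for `tryAll`. -/
def tryAllTime (R : List (Rule J ν)) : List ν → ℕ → ℕ
  | [], n => rulesTime R n
  | _ :: vs, n => (3 * n + 1) + (tryAllTime R vs n + (n * (tryAllTime R vs n + 2) + 1))

/-- The time for `setUp`, with `a` relations and `b` variables. -/
def setUpTime (a b n : ℕ) : ℕ :=
  (3 * n + 1) + ((n * (b + 4) + 1) + (4 +
    ((n + 2) * ((n + 2) * (a + 1 + 5) + 3) + 1)))

theorem polyBounded_goToTime : PolyBounded goToTime := by
  have h : PolyBounded fun n => n + 2 := PolyBounded.id.add (.const 2)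
  have h' := h.mul (.const 7)
  exact (((PolyBounded.id.mul ((h'.add (.const 2)).add (.const 5))).add (.const 3)).add
    (h'.add (.const 2))).add ((PolyBounded.id.mul (.const 7)).add (.const 5))

theorem polyBounded_atomTime : PolyBounded atomTime := by
  have h : PolyBounded fun n => n + 2 := PolyBounded.id.add (.const 2)
  exact (polyBounded_goToTime.add ((PolyBounded.const 3).mul (h.mul h))).add (.const 4)

theorem polyBounded_rulesTime : ∀ R : List (Rule J ν), PolyBounded (rulesTime R)
  | [] => PolyBounded.const 1
  | r :: R => by
    have h : PolyBounded (ruleTime r) := (PolyBounded.const 1).add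
      ((PolyBounded.const (r.guards.length * 2 + 1)).add
        ((((PolyBounded.const r.body.length).mul polyBounded_atomTime).add (.const 1)).add
          (polyBounded_atomTime.add (.const 1))))
    have := h.add (polyBounded_rulesTime R)
    unfold rulesTime at this ⊢
    simpa [Nat.add_assoc] using this

theorem polyBounded_tryAllTime (R : List (Rule J ν)) :
    ∀ vs : List ν, PolyBounded (tryAllTime R vs)
  | [] => polyBounded_rulesTime R
  | _ :: vs =>
    have h := polyBounded_tryAllTime R vs
    (((PolyBounded.const 3).mul .id).add (.const 1)).add
      (h.add ((PolyBounded.id.mul (h.add (.const 2))).add (.const 1)))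

theorem polyBounded_setUpTime (a b : ℕ) : PolyBounded (setUpTime a b) := by
  have h : PolyBounded fun n => n + 2 := PolyBounded.id.add (.const 2)
  exact (((PolyBounded.const 3).mul .id).add (.const 1)).add
    (((PolyBounded.id.mul (.const _)).add (.const 1)).add ((PolyBounded.const 4).add
      ((h.mul ((h.mul (.const _)).add (.const 3))).add (.const 1))))

/-! Correctness -/

variable [DecidableEq J] [DecidableEq ν]

theorem runs_tests {α : Type} (P : α → Pr J ν) (b : α → Bool) {S : Stk J ν → List Letter} {T : ℕ}
    (h : ∀ x f, Runs (P x) f S (f.1 && b x, f.2) S T) : ∀ (l : List α) (f : Bool × Bool),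
    Runs (seqs (l.map P)) f S (f.1 && l.all b, f.2) S (l.length * T + 1)
  | [], f => by simpa [seqs] using runs_skip f S
  | x :: l, f => by
    have := (h x f).seq (runs_tests P b h l _)
    simp only [Bool.and_assoc] at this
    refine this.mono ?_
    simp only [List.length_cons, Nat.add_mul]
    omega

/-- Test a letter. -/
def testGuard (g : ν × (Option Letter → Bool)) : Pr J ν :=
  .seq (.peek (.right g.1)) (.load fun r f => (f.1 && g.2 r, f.2))

theorem runs_testGuard (w : List Letter) (ρ : ν → ℕ) (D : Finset (J × ℕ × ℕ))
    (g : ν × (Option Letter → Bool)) (f : Bool × Bool) :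
    Runs (testGuard g) f (st w ρ D) (f.1 && g.2 w[ρ g.1]?, f.2) (st w ρ D) 2 := by
  intro r
  have := Run.seq (Run.peek (t := 0) (a := ⟨r, f, st w ρ D⟩) (k := .right g.1))
    (Run.load (t := 0) (f := fun r f => (f.1 && g.2 r, f.2)))
  simp only [st, List.head?_drop] at this
  exact ⟨_, this⟩

/-- Try a rule. -/
def tryRule (r : Rule J ν) : Pr J ν :=
  .seq (.load fun _ f => (true, f.2)) (.seq (seqs (r.guards.map testGuard))
    (.seq (seqs (r.body.map testAtom)) (addAtom r.head)))

/-- The first flag collects the conjunction of guards and body atoms. If it is true, the head is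
derivable by one more rule application; if not, the instance is vacuously closed. -/
theorem runs_tryRule {R : List (Rule J ν)} {r : Rule J ν} (hr : r ∈ R) {w : List Letter}
    {ρ : ν → ℕ} (hρ : ∀ x, ρ x ≤ w.length) (D : Finset (J × ℕ × ℕ)) (o c : Bool) :
    ∃ o' c' D', Runs (tryRule r) (o, c) (st w ρ D) (o', c') (st w ρ D') (ruleTime r w.length) ∧
      Tried R w {(r, ρ)} c D c' D' := by
  have h := (runs_load (fun f => (true, f.2)) (o, c) (st w ρ D)).seq
    ((runs_tests testGuard (fun g => g.2 w[ρ g.1]?) (runs_testGuard w ρ D) r.guards _).seq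
      ((runs_tests testAtom (fun a => decide (a.eval ρ ∈ D)) (runs_testAtom hρ D) r.body _).seq
        (runs_addAtom hρ D r.head _)))
  refine ⟨_, _, _, h, ?_⟩
  simp only [Bool.true_and]
  set b := (r.guards.all fun g => g.2 w[ρ g.1]?) && r.body.all fun a => decide (a.eval ρ ∈ D)
    with hb
  have hb' : b = true ↔ Applicable w D r ρ := by
    rw [hb]; simp only [Bool.and_eq_true, List.all_eq_true, decide_eq_true_iff]; rfl
  by_cases hA : Applicable w D r ρ
  · rw [hb'.2 hA]
    simp only [if_true, Bool.true_and]
    refine ⟨by simp, ?_, ?_, ?_⟩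
    · intro hD a ha
      rcases Finset.mem_insert.1 ha with rfl | ha
      · exact .intro r hr ρ hρ hA.1 fun a ha => hD _ (hA.2 a ha)
      · exact hD a ha
    · intro hc
      simp only [Bool.or_eq_false_iff, Bool.not_eq_false', decide_eq_true_iff] at hc
      refine ⟨hc.1, by simp [hc.2], ?_⟩
      rintro _ rfl -
      exact hc.2
    · intro hc hc'
      subst hc
      simp only [Bool.false_or, Bool.not_eq_true', decide_eq_false_iff_not] at hc'
      exact Finset.ssubset_insert hc'
  · have : b = false := by rw [← Bool.not_eq_true, hb']; exact hA
    rw [this]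
    simp only [Bool.false_and, Bool.or_false, Bool.false_eq_true, if_false]
    refine (Tried.refl R w c D).trans (B := {(r, ρ)}) ⟨by simp, id, ?_, by simp_all⟩ |>.mono (by simp)
    intro hc
    refine ⟨hc, rfl, ?_⟩
    rintro _ rfl h
    exact absurd h hA

theorem runs_tryRules {R : List (Rule J ν)} {w : List Letter} {ρ : ν → ℕ}
    (hρ : ∀ x, ρ x ≤ w.length) : ∀ (l : List (Rule J ν)), (∀ r ∈ l, r ∈ R) →
    ∀ (D : Finset (J × ℕ × ℕ)) (o c : Bool),
    ∃ o' c' D', Runs (seqs (l.map tryRule)) (o, c) (st w ρ D) (o', c') (st w ρ D')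
      (rulesTime l w.length) ∧ Tried R w {p | p.1 ∈ l ∧ p.2 = ρ} c D c' D'
  | [], _, D, o, c => ⟨o, c, D, runs_skip _ _, (Tried.refl R w c D).mono (by simp)⟩
  | r :: l, hl, D, o, c => by
    obtain ⟨o₁, c₁, D₁, h₁, h₁'⟩ := runs_tryRule (hl r (by simp)) hρ D o c
    obtain ⟨o₂, c₂, D₂, h₂, h₂'⟩ := runs_tryRules hρ l (fun r hr => hl r (by simp [hr])) D₁ o₁ c₁
    refine ⟨o₂, c₂, D₂, (h₁.seq h₂).mono ?_, (h₁'.trans h₂').mono ?_⟩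
    · simp [rulesTime]; omega
    · rintro ⟨r', ρ'⟩ ⟨h, rfl⟩
      rcases List.mem_cons.1 h with rfl | h
      · exact .inl rfl
      · exact .inr ⟨h, rfl⟩

/-- `P` tries all rules for all values of the variables in `vs`. -/
def TriesAll (R : List (Rule J ν)) (w : List Letter) (P : Pr J ν) (vs : List ν) (T : ℕ) : Prop :=
  ∀ ρ : ν → ℕ, (∀ x, ρ x ≤ w.length) → ∀ (D : Finset (J × ℕ × ℕ)) (o c : Bool),
    ∃ ρ' o' c' D', (∀ x, ρ' x ≤ w.length) ∧ (∀ x ∉ vs, ρ' x = ρ x) ∧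
      Runs P (o, c) (st w ρ D) (o', c') (st w ρ' D') T ∧
      Tried R w {p | p.1 ∈ R ∧ (∀ x, p.2 x ≤ w.length) ∧ ∀ x ∉ vs, p.2 x = ρ x} c D c' D'

/-- Run `P` for all values of `x`. -/
def forVar (x : ν) (P : Pr J ν) : Pr J ν :=
  .seq (move (.left x) (.right x)) (.seq P (.whilePop (.right x) (.seq (pushReg (.left x)) P)))

theorem st_reset (w : List Letter) (ρ : ν → ℕ) (D : Finset (J × ℕ × ℕ)) (x : ν) :
    update (update (st w ρ D) (.left x) []) (.right x)
      ((st w ρ D (.left x)).reverse ++ st w ρ D (.right x)) = st w (update ρ x 0) D := by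
  funext k
  by_cases h : k = .right x
  · subst h; simp [st]
  · rw [Function.update_of_ne h]
    by_cases h' : k = .left x
    · subst h'; simp [st]
    · rw [Function.update_of_ne h']
      cases k with
      | left y => have : y ≠ x := fun e => h' (by rw [e]); simp [st, this]
      | right y => have : y ≠ x := fun e => h (by rw [e]); simp [st, this]
      | _ => rfl

theorem st_advance {w : List Letter} {ρ : ν → ℕ} (D : Finset (J × ℕ × ℕ)) {x : ν}
    (hx : ρ x < w.length) :
    update (update (st w ρ D) (.right x) (w.drop (ρ x + 1))) (.left x)
      (w[ρ x] :: st w ρ D (.left x)) = st w (update ρ x (ρ x + 1)) D := by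
  funext k
  by_cases h : k = .left x
  · subst h
    simp only [st, Function.update_self, List.take_succ_eq_append_getElem hx, List.reverse_append,
      List.reverse_singleton, List.singleton_append]
  · rw [Function.update_of_ne h]
    by_cases h' : k = .right x
    · subst h'; simp [st]
    · rw [Function.update_of_ne h']
      cases k with
      | left y => have : y ≠ x := fun e => h (by rw [e]); simp [st, this]
      | right y => have : y ≠ x := fun e => h' (by rw [e]); simp [st, this]
      | _ => rfl

/-- Induction on the number `m` of letters to the right of `x`. The inner program may leave the
variables in `vs` anywhere, so valuations are controlled only outside `x :: vs`. -/
theorem runs_forVar_aux {R : List (Rule J ν)} {w : List Letter} {P : Pr J ν} {vs : List ν} {T : ℕ}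
    {x : ν} (hx : x ∉ vs) (hP : TriesAll R w P vs T) : ∀ (m : ℕ) (ρ : ν → ℕ),
    ρ x + m = w.length → (∀ y, ρ y ≤ w.length) → ∀ (D : Finset (J × ℕ × ℕ)) (o c : Bool),
    ∃ ρ' o' c' D', (∀ x, ρ' x ≤ w.length) ∧ (∀ y ∉ x :: vs, ρ' y = ρ y) ∧
      Runs (.whilePop (.right x) (.seq (pushReg (.left x)) P)) (o, c) (st w ρ D) (o', c')
        (st w ρ' D') (m * (T + 2) + 1) ∧
      Tried R w {p | p.1 ∈ R ∧ (∀ y, p.2 y ≤ w.length) ∧ (∀ y ∉ x :: vs, p.2 y = ρ y) ∧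
        ρ x < p.2 x} c D c' D'
  | 0, ρ, hm, hρ, D, o, c => by
    refine ⟨ρ, o, c, D, hρ, fun _ _ => rfl, fun r => ⟨none, ?_⟩, (Tried.refl R w c D).mono ?_⟩
    · exact (Run.whileNil (a := ⟨r, (o, c), st w ρ D⟩) (t := 0) (by
        simp [st]; omega)).mono (by omega)
    · rintro p ⟨-, h, -, h'⟩
      have := h x
      omega
  | m + 1, ρ, hm, hρ, D, o, c => by
    have hxl : ρ x < w.length := by omega
    obtain ⟨ρ₁, o₁, c₁, D₁, hρ₁, hρ₁', h₁, h₁'⟩ := hP (update ρ x (ρ x + 1)) (by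
      intro y
      by_cases h : y = x
      · subst h; simpa using hxl
      · simpa [h] using hρ y) D o c
    have hρx : ρ₁ x = ρ x + 1 := by rw [hρ₁' x hx]; simp
    obtain ⟨ρ₂, o₂, c₂, D₂, hρ₂, hρ₂', h₂, h₂'⟩ := runs_forVar_aux hx hP m ρ₁ (by omega) hρ₁ D₁ o₁ c₁
    have hag : ∀ y ∉ x :: vs, ρ₁ y = ρ y := by
      intro y hy
      simp only [List.mem_cons, not_or] at hy
      rw [hρ₁' y hy.2, Function.update_of_ne hy.1]
    refine ⟨ρ₂, o₂, c₂, D₂, hρ₂, fun y hy => (hρ₂' y hy).trans (hag y hy), fun r => ?_,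
      (h₁'.trans h₂').mono ?_⟩
    · obtain ⟨r₁, h₁⟩ := h₁ (some w[ρ x])
      obtain ⟨r₂, h₂⟩ := h₂ r₁
      refine ⟨r₂, (Run.whileCons (a := ⟨r, (o, c), st w ρ D⟩) (k := .right x) (x := w[ρ x])
        (l := w.drop (ρ x + 1)) (by simp [st]) (Run.seq (Run.push (t := 0)) ?_) h₂).mono
        (t := (0 + 1) + T + (m * (T + 2) + 1) + 1) (by rw [Nat.add_mul]; omega)⟩
      have := st_advance D hxl
      simpa [this] using h₁
    · rintro ⟨r, ρ'⟩ ⟨hr, hle, ha, hlt⟩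
      -- The next value of `x` is handled by this round, all greater ones by the remaining rounds.
      by_cases h : ρ' x = ρ x + 1
      · refine .inl ⟨hr, hle, fun y hy => ?_⟩
        by_cases hyx : y = x
        · subst hyx; simpa using h
        · rw [Function.update_of_ne hyx]; exact ha y (by simp [hyx, hy])
      · refine .inr ⟨hr, hle, fun y hy => (ha y hy).trans (hag y hy).symm, ?_⟩
        simp only at hlt ⊢
        omega

/-- The value `0` is tried before the loop and one value after each letter is passed, so all
`w.length + 1` values occur, the end of the word included. -/
theorem TriesAll.forVar {R : List (Rule J ν)} {w : List Letter} {P : Pr J ν} {vs : List ν} {T : ℕ}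
    {x : ν} (hx : x ∉ vs) (hP : TriesAll R w P vs T) :
    TriesAll R w (forVar x P) (x :: vs)
      ((3 * w.length + 1) + (T + (w.length * (T + 2) + 1))) := by
  intro ρ hρ D o c
  have h₀ := runs_move (k := Stk.left x) (k' := Stk.right x) (by simp) (o, c) (st w ρ D)
  rw [st_reset] at h₀
  obtain ⟨ρ₁, o₁, c₁, D₁, hρ₁, hρ₁', h₁, h₁'⟩ := hP (update ρ x 0) (by
    intro y
    by_cases h : y = x
    · subst h; simp
    · simpa [h] using hρ y) D o c
  have hρx : ρ₁ x = 0 := by rw [hρ₁' x hx]; simp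
  obtain ⟨ρ₂, o₂, c₂, D₂, hρ₂, hρ₂', h₂, h₂'⟩ :=
    runs_forVar_aux hx hP w.length ρ₁ (by omega) hρ₁ D₁ o₁ c₁
  have hag : ∀ y ∉ x :: vs, ρ₁ y = ρ y := by
    intro y hy
    simp only [List.mem_cons, not_or] at hy
    rw [hρ₁' y hy.2, Function.update_of_ne hy.1]
  refine ⟨ρ₂, o₂, c₂, D₂, hρ₂, fun y hy => (hρ₂' y hy).trans (hag y hy),
    (h₀.seq (h₁.seq h₂)).mono ?_, (h₁'.trans h₂').mono ?_⟩
  · have : (st w ρ D (.left x)).length ≤ w.length := by simp [st]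
    omega
  · rintro ⟨r, ρ'⟩ ⟨hr, hle, ha⟩
    by_cases h : ρ' x = 0
    · refine .inl ⟨hr, hle, fun y hy => ?_⟩
      by_cases hyx : y = x
      · subst hyx; simpa using h
      · rw [Function.update_of_ne hyx]; exact ha y (by simp [hyx, hy])
    · refine .inr ⟨hr, hle, fun y hy => (ha y hy).trans (hag y hy).symm, ?_⟩
      simp only
      omega

/-- Try all rules for all values of the variables in a list. -/
def tryAll (R : List (Rule J ν)) : List ν → Pr J ν
  | [] => seqs (R.map tryRule)
  | x :: vs => forVar x (tryAll R vs)

theorem triesAll_tryAll (R : List (Rule J ν)) (w : List Letter) : ∀ vs : List ν, vs.Nodup →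
    TriesAll R w (tryAll R vs) vs (tryAllTime R vs w.length)
  | [], _ => fun ρ hρ D o c => by
    obtain ⟨o', c', D', h, h'⟩ := runs_tryRules hρ R (fun _ h => h) D o c
    refine ⟨ρ, o', c', D', hρ, fun _ _ => rfl, h, h'.mono ?_⟩
    rintro p ⟨hp, -, h⟩
    exact ⟨hp, funext fun x => h x (by simp)⟩
  | x :: vs, h => (triesAll_tryAll R w vs (List.nodup_cons.1 h).2).forVar (List.nodup_cons.1 h).1

theorem st_push_token (w : List Letter) (ρ : ν → ℕ) (D : Finset (J × ℕ × ℕ)) :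
    update (update (st w ρ D) .token [default]) .token [] = st w ρ D := by
  rw [Function.update_idem]
  exact Function.update_eq_self (f := st w ρ D) .token

/-- Add facts as long as there is a token. -/
def saturateLoop (R : List (Rule J ν)) (vs : List ν) : Pr J ν :=
  .whilePop .token (.seq (.seq (.load fun _ f => (f.1, false)) (tryAll R vs))
    (.ite (fun f => f.2) (.push .token fun _ _ => default) skip))

/-- The token is renewed exactly when a round added a fact. Such a round enlarges `D` strictly, and
sets of derivable facts have fewer than `B` elements, so `B - D.card` decreases. A round without
additions shows that `D` is closed under all rule instances, hence contains every derivable fact. -/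
theorem runs_saturateLoop {R : List (Rule J ν)} {w : List Letter} {vs : List ν} (hvs : vs.Nodup)
    (hvs' : ∀ x, x ∈ vs) {B : ℕ} (hB : ∀ D : Finset (J × ℕ × ℕ), (∀ a ∈ D, Der R w a) → D.card < B) :
    ∀ (m : ℕ) (ρ : ν → ℕ), (∀ x, ρ x ≤ w.length) → ∀ (D : Finset (J × ℕ × ℕ)) (f : Bool × Bool),
    (∀ a ∈ D, Der R w a) → B - D.card ≤ m →
    ∃ ρ' f' D', (∀ a, a ∈ D' ↔ Der R w a) ∧
      Runs (saturateLoop R vs) f (update (st w ρ D) .token [default]) f' (st w ρ' D')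
        (m * (tryAllTime R vs w.length + 4) + 1)
  | 0, _, _, D, _, hD, hm => by have := hB D hD; omega
  | m + 1, ρ, hρ, D, f, hD, hm => by
    obtain ⟨ρ₁, o₁, c₁, D₁, hρ₁, -, h₁, h₁'⟩ := triesAll_tryAll R w vs hvs ρ hρ D f.1 false
    have h₂ := (runs_load (fun f => (f.1, false)) f (st w ρ D)).seq h₁
    rw [← st_push_token] at h₂
    cases c₁ with
    | false =>
      obtain ⟨-, rfl, hcl⟩ := h₁'.closed rfl
      refine ⟨ρ₁, (o₁, false), D₁, fun a => ⟨hD a, fun ha => ?_⟩,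
        (runs_whileCons (Function.update_self ..) (h₂.seq (runs_iteFalse rfl (runs_skip _ _)))
          (runs_whileNil rfl)).mono ?_⟩
      · induction ha with
        | intro r hr ρ' hρ' hg _ ih =>
          exact hcl (r, ρ') ⟨hr, hρ', fun x hx => absurd (hvs' x) hx⟩ ⟨hg, ih⟩
      · rw [Nat.add_mul]; omega
    | true =>
      have := Finset.card_lt_card (h₁'.grows rfl rfl)
      obtain ⟨ρ', f', D', h, h'⟩ := runs_saturateLoop hvs hvs' hB m ρ₁ hρ₁ D₁ (o₁, true)
        (h₁'.sound hD) (by omega)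
      refine ⟨ρ', f', D', h,
        (runs_whileCons (Function.update_self ..) (h₂.seq (runs_iteTrue rfl (runs_push _ _ _ _))) h').mono ?_⟩
      rw [Nat.add_mul]; omega

/-! ### Initialization, answer, and running time -/

/-- The stacks `S` with `m` negative entries added to every table. -/
def addEntries (m : ℕ) (S : Stk J ν → List Letter) : Stk J ν → List Letter
  | .table j => List.replicate m (.bit false) ++ S (.table j)
  | k => S k

theorem runs_pushTables (f : Bool × Bool) : ∀ (js : List J), js.Nodup →
    ∀ S : Stk J ν → List Letter,
    Runs (seqs (js.map fun j => .push (.table j) fun _ _ => .bit false)) f S f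
      (fun k => if k ∈ js.map Stk.table then .bit false :: S k else S k) (js.length + 1)
  | [], _, S => (runs_skip f S).congr (by simp) (by simp)
  | j :: js, h, S => by
    have h' := List.nodup_cons.1 h
    have := (runs_push (.table j) (.bit false) f S).seq (runs_pushTables f js h'.2 _)
    refine this.congr ?_ (by rw [List.length_cons]; omega)
    funext k
    by_cases hk : k = .table j
    · subst hk; simp [h'.1]
    · simp only [List.map_cons, List.mem_cons, hk, false_or, ne_eq, not_false_eq_true,
        Function.update_of_ne]

/-- Add one entry to every table for every letter on `row`. -/
def addRow (js : List J) : Pr J ν :=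
  forEach .row .savedRow (seqs (js.map fun j => .push (.table j) fun _ _ => .bit false))

theorem runs_addRow {js : List J} (hjs : js.Nodup) (hjs' : ∀ j, j ∈ js) (f : Bool × Bool)
    (S : Stk J ν → List Letter) (hS : S .savedRow = []) (m : ℕ) :
    Runs (addRow js) f (addEntries m S) f (addEntries (m + (S .row).length) S)
      ((S .row).length * (js.length + 1 + 5) + 2) := by
  refine runs_forEach (by simp) (fun i => addEntries (m + i) S) (S .row) ?_ ?_
  · intro i _
    exact ⟨rfl, hS⟩
  · intro i _ A B
    refine (runs_pushTables f js hjs _).congr ?_ le_rfl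
    funext k
    cases k with
    | table j =>
      simp [hjs', addEntries, ← Nat.add_assoc, List.replicate_succ]
    | _ => simp [addEntries, update]

/-- Each letter on `saved` adds one row of `M` entries to every table; with `M` letters there, this
allocates the empty tables. -/
theorem runs_addRows {js : List J} (hjs : js.Nodup) (hjs' : ∀ j, j ∈ js) (f : Bool × Bool)
    {M : ℕ} : ∀ (l : List Letter) (S : Stk J ν → List Letter), S .savedRow = [] →
    (S .row).length = M → S .saved = l → ∀ m,
    Runs (.whilePop .saved (addRow js)) f (addEntries m S) f
      (addEntries (m + l.length * M) (update S .saved []))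
      (l.length * (M * (js.length + 1 + 5) + 3) + 1)
  | [], S, _, _, h, m => by
    refine (runs_whileNil (by simpa [addEntries] using h)).congr ?_ (by simp)
    rw [← h, Function.update_eq_self, h, List.length_nil, Nat.zero_mul, Nat.add_zero]
  | x :: l, S, h₁, h₂, h, m => by
    have e : update (addEntries m S) .saved l = addEntries m (update S .saved l) := by
      funext k
      cases k <;> simp [addEntries, update]
    have h₃ := runs_addRow hjs hjs' f (update S .saved l) (by simpa using h₁) m
    have h₄ := runs_addRows hjs hjs' f l (update S .saved l) (by simpa using h₁)
      (by simpa using h₂) (by simp) (m + M)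
    simp only [ne_eq, reduceCtorEq, not_false_eq_true, Function.update_of_ne, h₂,
      Function.update_idem] at h₃ h₄
    rw [← e] at h₃
    refine (runs_whileCons (by simpa [addEntries] using h) h₃ h₄).congr ?_ ?_
    · congr 1
      simp only [List.length_cons]
      ring
    · simp only [List.length_cons, Nat.add_mul]
      omega

/-- Set up the stacks. -/
def setUp (js : List J) (vs : List ν) : Pr J ν :=
  .seq (move .input .walked) (.seq (moveAll .walked (.row :: .saved :: vs.map .right))
    (.seq (.push .row fun _ _ => .bit true) (.seq (.push .row fun _ _ => .bit true)
      (.seq (.push .saved fun _ _ => .bit true) (.seq (.push .saved fun _ _ => .bit true)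
        (.whilePop .saved (addRow js)))))))

/-- The input is reversed onto `walked` and from there distributed in its original order. Two
additional letters bring `row` and `saved` to the length `n + 2`, the side of the tables. -/
theorem runs_setUp {js : List J} {vs : List ν} (hjs : js.Nodup) (hjs' : ∀ j, j ∈ js)
    (hvs : vs.Nodup) (hvs' : ∀ x, x ∈ vs) (w : List Letter) (f : Bool × Bool) :
    Runs (setUp js vs) f (update (fun _ => []) .input w) f (st w (fun _ => 0) ∅)
      (setUpTime js.length vs.length w.length) := by
  have hnd : (Stk.row :: Stk.saved :: vs.map (Stk.right : ν → Stk J ν)).Nodup := by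
    simp [List.nodup_map_iff (f := (Stk.right : ν → Stk J ν)) (fun _ _ h => Stk.right.inj h), hvs]
  let S₁ : Stk J ν → List Letter := update (fun _ => []) .walked w.reverse
  let S₂ (l : List Letter) (l' : List Letter) : Stk J ν → List Letter := fun k => match k with
    | .row => l
    | .saved => l'
    | .right _ => w
    | _ => []
  have h₁ : Runs (move .input .walked) f (update (fun _ => []) .input w) f S₁ (3 * w.length + 1) := by
    refine (runs_move (by simp) f _).congr ?_ (by simp)
    funext k
    cases k <;> simp [S₁, update]
  have h₂ : Runs (moveAll .walked (.row :: .saved :: vs.map .right)) f S₁ f (S₂ w w)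
      (w.length * (vs.length + 4) + 1) := by
    refine (runs_moveAll _ _ (by simp) hnd f _ _ rfl).congr ?_ (by simp [S₁])
    funext k
    cases k <;> simp [S₁, S₂, hvs']
  have h₃ : ∀ l l' x, Runs (.push .row fun _ _ => x) f (S₂ l l') f (S₂ (x :: l) l') 1 := by
    intro l l' x
    refine (runs_push Stk.row x f _).congr ?_ le_rfl
    funext k
    cases k <;> simp [S₂, update]
  have h₄ : ∀ l l' x, Runs (.push .saved fun _ _ => x) f (S₂ l l') f (S₂ l (x :: l')) 1 := by
    intro l l' x
    refine (runs_push Stk.saved x f _).congr ?_ le_rfl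
    funext k
    cases k <;> simp [S₂, update]
  have h₅ := runs_addRows (ν := ν) hjs hjs' f (M := w.length + 2) (.bit true :: .bit true :: w)
      (S₂ (.bit true :: .bit true :: w) (.bit true :: .bit true :: w)) rfl rfl rfl 0
  have e : addEntries 0 (S₂ (.bit true :: .bit true :: w) (.bit true :: .bit true :: w)) =
      S₂ (.bit true :: .bit true :: w) (.bit true :: .bit true :: w) := by
    funext k
    cases k <;> simp [addEntries]
  rw [e] at h₅
  refine (h₁.seq (h₂.seq ((h₃ _ _ _).seq ((h₃ _ _ _).seq ((h₄ _ _ _).seq ((h₄ _ _ _).seq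
    h₅)))))).congr ?_ ?_
  · funext k
    cases k <;> simp [addEntries, S₂, st, update, tab]
  · simp only [setUpTime, List.length_cons, Nat.add_assoc, Nat.reduceAdd]
    omega

/-- Find out whether the relation `g` is empty. -/
def readAnswer (g : J) : Pr J ν :=
  .seq (.load fun _ f => (true, f.2)) (.whilePop (.table g)
    (.load fun r f => (f.1 && !decide (r = some (.bit true)), f.2)))

theorem runs_readAnswer_aux (g : J) : ∀ (l : List Letter) (S : Stk J ν → List Letter)
    (f : Bool × Bool), S (.table g) = l → ∃ S',
    Runs (.whilePop (.table g) (.load fun r f => (f.1 && !decide (r = some (.bit true)), f.2)))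
      f S (f.1 && l.all fun x => !decide (x = .bit true), f.2) S' (2 * l.length + 1)
  | [], S, f, h => ⟨S, by simpa using runs_whileNil h⟩
  | x :: l, S, f, h => by
    obtain ⟨S', h'⟩ := runs_readAnswer_aux g l (update S (.table g) l)
      (f.1 && !decide (x = .bit true), f.2) (by simp)
    refine ⟨S', fun r => ?_⟩
    obtain ⟨r', h'⟩ := h' (some x)
    refine ⟨r', ?_⟩
    have := Run.whileCons (a := ⟨r, f, S⟩) h (Run.load (t := 0)
      (f := fun r (f : Bool × Bool) => (f.1 && !decide (r = some (.bit true)), f.2)))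
      (by simpa using h')
    simp only [List.all_cons, ← Bool.and_assoc]
    exact this.mono (by simp; omega)

theorem runs_readAnswer (g : J) {w : List Letter} (ρ : ν → ℕ) {D : Finset (J × ℕ × ℕ)}
    (hD : ∀ a ∈ D, a.2.1 < w.length + 2 ∧ a.2.2 < w.length + 2) (f : Bool × Bool) :
    ∃ f' S', Runs (readAnswer g) f (st w ρ D) f' S'
      (1 + (2 * ((w.length + 2) * (w.length + 2)) + 1)) ∧
      (f'.1 = true ↔ ∀ x y, (g, x, y) ∉ D) := by
  obtain ⟨S', h⟩ := runs_readAnswer_aux g _ (st w ρ D) (true, f.2) rfl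
  refine ⟨_, S', ((runs_load (fun f => (true, f.2)) f _).seq h).mono (by simp [st, length_tab]), ?_⟩
  simp only [Bool.true_and, st, List.all_eq_true, Bool.not_eq_true', decide_eq_false_iff_not]
  constructor
  · intro h x y hxy
    obtain ⟨hx, hy⟩ := hD _ hxy
    refine h _ (List.mem_of_getElem? (getElem_tab D g hx hy)) ?_
    simp [hxy]
  · intro h l hl
    simp only [tab, List.mem_map] at hl
    obtain ⟨p, -, rfl⟩ := hl
    simp [h]

/-- It is decidable in polynomial time whether a fact of the form `g(x, y)` is derivable. -/
theorem decidableInPolyTime [Fintype ν] [Fintype J] {α : Type} {e : α → List Letter}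
    {p : α → Prop} (R : List (Rule J ν)) (g : J)
    (h : ∀ a, p a ↔ ∀ x y, ¬ Der R (e a) (g, x, y)) : DecidableInPolyTime e p := by
  classical
  let js : List J := Finset.univ.toList
  let vs : List ν := Finset.univ.toList
  -- One more than the number of entries in all tables, so that sets of facts have fewer than `B n`
  -- elements.
  let B : ℕ → ℕ := fun n => Fintype.card J * ((n + 2) * (n + 2)) + 1
  let T : ℕ → ℕ := fun n => setUpTime js.length vs.length n + (1 + ((B n * (tryAllTime R vs n + 4) + 1) +
    (1 + (2 * ((n + 2) * (n + 2)) + 1))))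
  have h2 : PolyBounded fun n => n + 2 := PolyBounded.id.add (.const 2)
  have hT : PolyBounded T := (polyBounded_setUpTime js.length vs.length).add ((PolyBounded.const 1).add
    ((((((PolyBounded.const _).mul (h2.mul h2)).add (.const 1)).mul
      ((polyBounded_tryAllTime R vs).add (.const 4))).add (.const 1)).add
      ((PolyBounded.const 1).add (((PolyBounded.const 2).mul (h2.mul h2)).add (.const 1)))))
  refine decidableInPolyTime_of_run (.seq (setUp js vs) (.seq (.push .token fun _ _ => default)
    (.seq (saturateLoop R vs) (readAnswer g)))) Stk.input (true, false) (fun f => f.1) T hT ?_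
  intro a
  have hjs : js.Nodup := Finset.nodup_toList _
  have hvs : vs.Nodup := Finset.nodup_toList _
  have hjs' : ∀ j, j ∈ js := by simp [js]
  have hvs' : ∀ x, x ∈ vs := by simp [vs]
  have hB : ∀ D : Finset (J × ℕ × ℕ), (∀ b ∈ D, Der R (e a) b) → D.card < B (e a).length := by
    intro D hD
    have hsub : D ⊆ Finset.univ ×ˢ
        (Finset.range ((e a).length + 2) ×ˢ Finset.range ((e a).length + 2)) := by
      intro b hb
      simpa using (hD b hb).lt
    have := Finset.card_le_card hsub
    simp only [Finset.card_product, Finset.card_univ, Finset.card_range] at this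
    exact Nat.lt_succ_of_le this
  obtain ⟨ρ, f, D, hD, h₁⟩ := runs_saturateLoop hvs hvs' hB (B (e a).length) (fun _ => 0) (by simp)
    ∅ (true, false) (by simp) (by simp)
  obtain ⟨f', S', h₂, hf'⟩ := runs_readAnswer g ρ (w := e a) (D := D)
    (fun b hb => ((hD b).1 hb).lt) f
  obtain ⟨r, hr⟩ := ((runs_setUp hjs hjs' hvs hvs' (e a) (true, false)).seq
    ((runs_push .token default _ _).seq (h₁.seq h₂))) none
  refine ⟨_, hr, ?_⟩
  simp only [hf', h, hD]

end Datalog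

namespace OccRen

open FirstOrder

/-! ### Occurrences of variables -/

/-- The occurrences of variables in a term at depth `d`, with their depths. -/
def Term.occs : ℕ → Term → List (ℕ × ℕ)
  | d, .var w => [(w, d)]
  | d, .func _ ts => (List.ofFn fun i => occs (d + 1) (ts i)).flatten

/-- The occurrences of variables in a literal; the depths are increased by one. -/
def Literal.occs (l : Literal) : List (ℕ × ℕ) := (List.ofFn fun i => Term.occs 1 (l.args i)).flatten

theorem mem_flatten_ofFn {α : Type*} {n : ℕ} {f : Fin n → List α} {x : α} :
    x ∈ (List.ofFn f).flatten ↔ ∃ i, x ∈ f i := by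
  simp [List.mem_flatten, List.mem_ofFn]

theorem countP_flatten_ofFn {α : Type*} {n : ℕ} (f : Fin n → List α) (p : α → Bool) :
    (List.ofFn f).flatten.countP p = ∑ i, (f i).countP p := by
  rw [List.countP_flatten, List.map_ofFn, List.sum_ofFn]
  rfl

/-- The list of occurrences with depths is the link between the recursive definitions and the
written word: numbers of occurrences and extremal depths are all read off from it. -/
theorem Term.occ_eq (v : ℕ) (t : Term) (d : ℕ) :
    Term.occ v t = (Term.occs d t).countP fun p => p.1 = v := by
  induction t generalizing d with
  | var w => by_cases h : w = v <;> simp [Term.occ, Term.occs, h]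
  | func f ts ih =>
    rw [Term.occ, Term.occs, countP_flatten_ofFn]
    exact Finset.sum_congr rfl fun i _ => ih i (d + 1)

theorem Term.mem_varFinset_iff {v : ℕ} {t : Term} (d : ℕ) :
    v ∈ t.varFinset ↔ ∃ e, (v, e) ∈ Term.occs d t := by
  induction t generalizing d with
  | var w => simp [Language.Term.varFinset, Term.occs]
  | func f ts ih =>
    simp only [Language.Term.varFinset, Term.occs, mem_flatten_ofFn, Finset.mem_biUnion,
      Finset.mem_univ, true_and]
    rw [exists_comm]
    exact exists_congr fun i => ih i (d + 1)

theorem isGreatest_sup {ι : Type*} [Fintype ι] {p : ι → Prop} [DecidablePred p] {g : ι → ℕ}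
    (h : ∃ i, p i) : IsGreatest {d | ∃ i, p i ∧ d = g i} ((Finset.univ.filter p).sup g) := by
  obtain ⟨i, hi⟩ := h
  constructor
  · obtain ⟨j, hj, hj'⟩ := Finset.exists_mem_eq_sup (Finset.univ.filter p)
      ⟨i, by simpa using hi⟩ g
    exact ⟨j, by simpa using hj, hj'⟩
  · rintro _ ⟨j, hj, rfl⟩
    exact Finset.le_sup (f := g) (by simpa using hj)

theorem isLeast_sInf {ι : Type*} {p : ι → Prop} {g : ι → ℕ}
    (h : ∃ i, p i) : IsLeast {d | ∃ i, p i ∧ d = g i} (sInf {d | ∃ i, p i ∧ d = g i}) := by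
  obtain ⟨i, hi⟩ := h
  exact ⟨Nat.sInf_mem (s := {d | ∃ i, p i ∧ d = g i}) ⟨g i, i, hi, rfl⟩, fun _ h => Nat.sInf_le h⟩

theorem Term.isGreatest_tmax {v : ℕ} {t : Term} (h : v ∈ t.varFinset) (d : ℕ) :
    IsGreatest {e | (v, e) ∈ Term.occs d t} (d + Term.tmax v t) := by
  induction t generalizing d with
  | var w =>
    obtain rfl : v = w := by simpa [Language.Term.varFinset] using h
    simp [Term.occs, Term.tmax, IsGreatest, upperBounds]
  | func f ts ih =>
    have h' : ∃ i, v ∈ (ts i).varFinset := by simpa [Language.Term.varFinset] using h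
    obtain ⟨⟨i, hi, hi'⟩, hu⟩ := isGreatest_sup (g := fun i => Term.tmax v (ts i)) h'
    rw [Term.tmax]
    constructor
    · rw [Set.mem_ofPred_eq, Term.occs, mem_flatten_ofFn]
      refine ⟨i, ?_⟩
      rw [hi', ← Nat.add_assoc]
      exact (ih i hi (d + 1)).1
    · intro e he
      rw [Set.mem_ofPred_eq, Term.occs, mem_flatten_ofFn] at he
      obtain ⟨j, hj⟩ := he
      have hj' : v ∈ (ts j).varFinset := (Term.mem_varFinset_iff (d + 1)).2 ⟨e, hj⟩
      have h₁ := (ih j hj' (d + 1)).2 hj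
      have h₂ := hu ⟨j, hj', rfl⟩
      omega

theorem Term.isLeast_tmin {v : ℕ} {t : Term} (h : v ∈ t.varFinset) (d : ℕ) :
    IsLeast {e | (v, e) ∈ Term.occs d t} (d + Term.tmin v t) := by
  induction t generalizing d with
  | var w =>
    obtain rfl : v = w := by simpa [Language.Term.varFinset] using h
    simp [Term.occs, Term.tmin, IsLeast, lowerBounds]
  | func f ts ih =>
    have h' : ∃ i, v ∈ (ts i).varFinset := by simpa [Language.Term.varFinset] using h
    obtain ⟨⟨i, hi, hi'⟩, hu⟩ := isLeast_sInf (g := fun i => Term.tmin v (ts i)) h'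
    rw [Term.tmin]
    constructor
    · rw [Set.mem_ofPred_eq, Term.occs, mem_flatten_ofFn]
      refine ⟨i, ?_⟩
      rw [hi', ← Nat.add_assoc]
      exact (ih i hi (d + 1)).1
    · intro e he
      rw [Set.mem_ofPred_eq, Term.occs, mem_flatten_ofFn] at he
      obtain ⟨j, hj⟩ := he
      have hj' : v ∈ (ts j).varFinset := (Term.mem_varFinset_iff (d + 1)).2 ⟨e, hj⟩
      have h₁ := (ih j hj' (d + 1)).2 hj
      have h₂ := hu ⟨j, hj', rfl⟩
      omega

theorem Literal.occ_eq (v : ℕ) (l : Literal) : l.occ v = l.occs.countP fun p => p.1 = v := by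
  rw [Literal.occ, Literal.occs, countP_flatten_ofFn]
  exact Finset.sum_congr rfl fun i _ => Term.occ_eq v _ 1

theorem Literal.mem_vars_iff {v : ℕ} {l : Literal} : v ∈ l.vars ↔ ∃ e, (v, e) ∈ l.occs := by
  simp only [Literal.vars, Literal.occs, mem_flatten_ofFn, Finset.mem_biUnion, Finset.mem_univ,
    true_and]
  rw [exists_comm]
  exact exists_congr fun i => Term.mem_varFinset_iff 1

theorem Literal.occ_pos_iff {v : ℕ} {l : Literal} : 0 < l.occ v ↔ v ∈ l.vars := by
  rw [Literal.occ_eq, List.countP_pos_iff, Literal.mem_vars_iff]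
  constructor
  · rintro ⟨⟨u, e⟩, h, h'⟩
    obtain rfl : u = v := by simpa using h'
    exact ⟨e, h⟩
  · rintro ⟨e, h⟩
    exact ⟨_, h, by simp⟩

/-- The summand `1` appears because depths in `Literal.occs` also count the parentheses of the
predicate symbol. It cancels in comparisons of depths. -/
theorem Literal.isGreatest_tmax {v : ℕ} {l : Literal} (h : v ∈ l.vars) :
    IsGreatest {e | (v, e) ∈ l.occs} (1 + l.tmax v) := by
  have h' : ∃ i, v ∈ (l.args i).varFinset := by simpa [Literal.vars] using h
  obtain ⟨⟨i, hi, hi'⟩, hu⟩ := isGreatest_sup (g := fun i => Term.tmax v (l.args i)) h'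
  rw [Literal.tmax]
  constructor
  · rw [Set.mem_ofPred_eq, Literal.occs, mem_flatten_ofFn]
    exact ⟨i, hi' ▸ (Term.isGreatest_tmax hi 1).1⟩
  · intro e he
    rw [Set.mem_ofPred_eq, Literal.occs, mem_flatten_ofFn] at he
    obtain ⟨j, hj⟩ := he
    have hj' : v ∈ (l.args j).varFinset := (Term.mem_varFinset_iff 1).2 ⟨e, hj⟩
    have h₁ := (Term.isGreatest_tmax hj' 1).2 hj
    have h₂ := hu ⟨j, hj', rfl⟩
    omega

theorem Literal.isLeast_tmin {v : ℕ} {l : Literal} (h : v ∈ l.vars) :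
    IsLeast {e | (v, e) ∈ l.occs} (1 + l.tmin v) := by
  have h' : ∃ i, v ∈ (l.args i).varFinset := by simpa [Literal.vars] using h
  obtain ⟨⟨i, hi, hi'⟩, hu⟩ := isLeast_sInf (g := fun i => Term.tmin v (l.args i)) h'
  rw [Literal.tmin]
  constructor
  · rw [Set.mem_ofPred_eq, Literal.occs, mem_flatten_ofFn]
    exact ⟨i, hi' ▸ (Term.isLeast_tmin hi 1).1⟩
  · intro e he
    rw [Set.mem_ofPred_eq, Literal.occs, mem_flatten_ofFn] at he
    obtain ⟨j, hj⟩ := he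
    have hj' : v ∈ (l.args j).varFinset := (Term.mem_varFinset_iff 1).2 ⟨e, hj⟩
    have h₁ := (Term.isLeast_tmin hj' 1).2 hj
    have h₂ := hu ⟨j, hj', rfl⟩
    omega

/-- A literal contains a variable at a greater depth than another literal iff this is witnessed by
occurrences. -/
theorem exists_tmin_lt_tmax_iff {l k : Literal} :
    (∃ v ∈ l.vars ∩ k.vars, k.tmin v < l.tmax v) ↔
      ∃ v d e, (v, d) ∈ l.occs ∧ (v, e) ∈ k.occs ∧ e < d := by
  constructor
  · rintro ⟨v, hv, hlt⟩
    rw [Finset.mem_inter] at hv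
    exact ⟨v, _, _, (Literal.isGreatest_tmax hv.1).1, (Literal.isLeast_tmin hv.2).1, by omega⟩
  · rintro ⟨v, d, e, hd, he, hlt⟩
    have h₁ : v ∈ l.vars := Literal.mem_vars_iff.2 ⟨d, hd⟩
    have h₂ : v ∈ k.vars := Literal.mem_vars_iff.2 ⟨e, he⟩
    refine ⟨v, by simp [h₁, h₂], ?_⟩
    have := (Literal.isGreatest_tmax h₁).2 hd
    have := (Literal.isLeast_tmin h₂).2 he
    omega

theorem exists_one_lt_occ_iff {l : Literal} :
    (∃ v, 1 < l.occ v) ↔ ¬ (l.occs.map Prod.fst).Nodup := by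
  simp only [Literal.occ_eq, List.nodup_iff_count_le_one, not_forall, not_le]
  refine exists_congr fun v => ?_
  rw [List.count, List.countP_map]
  rfl

/-! ### Renamability as satisfiability -/

theorem PropLit.dual_dual (a : PropLit) : a.dual.dual = a := by simp [PropLit.dual]

theorem PropLit.dual_holds {M : Set PredSym} {a : PropLit} : a.dual.Holds M ↔ ¬ a.Holds M := by
  obtain ⟨s, p⟩ := a
  cases s <;> simp [PropLit.dual, PropLit.Holds]

/-- The dictionary between renamings and interpretations: true skeletons are those of the literals
that become negative. -/
theorem Literal.rename_sign {ρ : Set PredSym} {l : Literal} :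
    (l.rename ρ).sign = true ↔ ¬ (skel l).Holds ρ := by
  obtain ⟨s, p, a⟩ := l
  by_cases h : p ∈ ρ <;> cases s <;> simp [Literal.rename, skel, PropLit.Holds, h, Literal.dual]

theorem Literal.rename_eq (ρ : Set PredSym) (l : Literal) :
    ∃ s, l.rename ρ = { l with sign := s } := by
  unfold Literal.rename
  split
  · exact ⟨_, rfl⟩
  · exact ⟨l.sign, rfl⟩

theorem Literal.rename_vars (ρ : Set PredSym) (l : Literal) : (l.rename ρ).vars = l.vars := by
  obtain ⟨s, h⟩ := l.rename_eq ρ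
  rw [h]; rfl

theorem Literal.rename_occ (ρ : Set PredSym) (l : Literal) (v : ℕ) :
    (l.rename ρ).occ v = l.occ v := by
  obtain ⟨s, h⟩ := l.rename_eq ρ
  rw [h]; rfl

theorem Literal.rename_tmax (ρ : Set PredSym) (l : Literal) (v : ℕ) :
    (l.rename ρ).tmax v = l.tmax v := by
  obtain ⟨s, h⟩ := l.rename_eq ρ
  rw [h]; rfl

theorem Literal.rename_tmin (ρ : Set PredSym) (l : Literal) (v : ℕ) :
    (l.rename ρ).tmin v = l.tmin v := by
  obtain ⟨s, h⟩ := l.rename_eq ρ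
  rw [h]; rfl

theorem Literal.rename_rename (ρ : Set PredSym) (l : Literal) : (l.rename ρ).rename ρ = l := by
  by_cases h : l.pred ∈ ρ
  · have h₁ : l.rename ρ = l.dual := if_pos h
    rw [h₁, Literal.rename, if_pos (show l.dual.pred ∈ ρ from h)]
    simp [Literal.dual]
  · have h₁ : l.rename ρ = l := if_neg h
    rw [h₁, h₁]

theorem Literal.rename_injective (ρ : Set PredSym) : Function.Injective (Literal.rename ρ) :=
  (show Function.Involutive (Literal.rename ρ) from Literal.rename_rename ρ).injective

theorem mem_posPart_rename {ρ : Set PredSym} {C : Clause} {k : Literal} :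
    k ∈ Clause.posPart (Clause.rename ρ C) ↔ ∃ l ∈ C, ¬ (skel l).Holds ρ ∧ l.rename ρ = k := by
  simp only [Clause.posPart, Clause.rename, Finset.mem_filter, Finset.mem_image]
  constructor
  · rintro ⟨⟨l, hl, rfl⟩, h⟩
    exact ⟨l, hl, Literal.rename_sign.1 h, rfl⟩
  · rintro ⟨l, hl, h, rfl⟩
    exact ⟨⟨l, hl, rfl⟩, Literal.rename_sign.2 h⟩

theorem mem_negPart_rename {ρ : Set PredSym} {C : Clause} {k : Literal} :
    k ∈ Clause.negPart (Clause.rename ρ C) ↔ ∃ l ∈ C, (skel l).Holds ρ ∧ l.rename ρ = k := by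
  simp only [Clause.negPart, Clause.rename, Finset.mem_filter, Finset.mem_image]
  constructor
  · rintro ⟨⟨l, hl, rfl⟩, h⟩
    refine ⟨l, hl, ?_, rfl⟩
    by_contra h'
    rw [Literal.rename_sign.2 h'] at h
    exact absurd h (by simp)
  · rintro ⟨l, hl, h, rfl⟩
    refine ⟨⟨l, hl, rfl⟩, ?_⟩
    rw [← Bool.not_eq_true, Literal.rename_sign]
    simpa using h

/-- The set `ρ` is the same on both sides; as a renaming it violates a condition of OCC1N on some
clause exactly if as an interpretation it falsifies one of the clauses of `ren`. -/
theorem renamableToOCC1N_iff (S : ClauseSet) :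
    RenamableToOCC1N S ↔ PropSatisfiable (ren S) := by
  classical
  -- Renaming is an involution on literals, so different literals stay different and no occurrence
  -- is lost in the image.
  have hocc : ∀ (ρ : Set PredSym) (C : Clause) (v : ℕ),
      Clause.occ v (Clause.posPart (Clause.rename ρ C)) =
        ∑ l ∈ C with ¬ (skel l).Holds ρ, l.occ v := by
    intro ρ C v
    have : Clause.posPart (Clause.rename ρ C) =
        (C.filter fun l => ¬ (skel l).Holds ρ).image (Literal.rename ρ) := by
      ext k
      rw [mem_posPart_rename]
      simp [and_assoc]
    rw [this, Clause.occ, Finset.sum_image (Literal.rename_injective ρ).injOn]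
    exact Finset.sum_congr rfl fun l _ => Literal.rename_occ ρ l v
  refine exists_congr fun ρ => ?_
  constructor
  · intro h c hc
    simp only [ren, Set.mem_iUnion, Set.mem_union] at hc
    obtain ⟨C, hC, hc⟩ := hc
    obtain ⟨h₁, h₂⟩ := h (Clause.rename ρ C) (Finset.mem_image_of_mem _ hC)
    have hmem : ∀ l ∈ C, ¬ (skel l).Holds ρ → ∀ v ∈ l.vars,
        v ∈ Clause.vars (Clause.posPart (Clause.rename ρ C)) := by
      intro l hl hh v hv
      refine Finset.mem_biUnion.2 ⟨l.rename ρ, mem_posPart_rename.2 ⟨l, hl, hh, rfl⟩, ?_⟩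
      rwa [Literal.rename_vars]
    rcases hc with (⟨l, hl, ⟨v, hv⟩, rfl⟩ | ⟨l, hl, k, hk, hlk, ⟨v, hv⟩, rfl⟩) |
      ⟨l, hl, k, hk, ⟨v, hv, hlt⟩, rfl⟩
    · refine ⟨skel l, by simp, ?_⟩
      by_contra hh
      have := h₁ v (hmem l hl hh v (Literal.occ_pos_iff.1 (by omega)))
      rw [hocc] at this
      have := Finset.single_le_sum (f := fun l => Literal.occ v l)
        (s := C.filter fun l => ¬ (skel l).Holds ρ) (fun _ _ => Nat.zero_le _)
        (Finset.mem_filter.2 ⟨hl, hh⟩)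
      omega
    · by_contra hcon
      have hl' : ¬ (skel l).Holds ρ := fun h => hcon ⟨_, by simp, h⟩
      have hk' : ¬ (skel k).Holds ρ := fun h => hcon ⟨_, by simp, h⟩
      rw [Finset.mem_inter] at hv
      have := h₁ v (hmem l hl hl' v hv.1)
      rw [hocc] at this
      -- Two different positive literals with the variable `v` already account for two occurrences.
      have hsub : ({l, k} : Finset Literal) ⊆ C.filter fun l => ¬ (skel l).Holds ρ := by
        intro x hx
        rcases Finset.mem_insert.1 hx with rfl | hx
        · exact Finset.mem_filter.2 ⟨hl, hl'⟩
        · rw [Finset.mem_singleton] at hx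
          subst hx
          exact Finset.mem_filter.2 ⟨hk, hk'⟩
      have h₃ := Finset.sum_le_sum_of_subset (f := fun l => Literal.occ v l) hsub
      rw [Finset.sum_pair hlk] at h₃
      have := Literal.occ_pos_iff.2 hv.1
      have := Literal.occ_pos_iff.2 hv.2
      omega
    · by_contra hcon
      have hl' : ¬ (skel l).Holds ρ := fun h => hcon ⟨_, by simp, h⟩
      have hk' : (skel k).Holds ρ := by
        by_contra h
        exact hcon ⟨(skel k).dual, by simp, PropLit.dual_holds.2 h⟩
      rw [Finset.mem_inter] at hv
      have hkm : k.rename ρ ∈ Clause.negPart (Clause.rename ρ C) :=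
        mem_negPart_rename.2 ⟨k, hk, hk', rfl⟩
      have hlm : l.rename ρ ∈ Clause.posPart (Clause.rename ρ C) :=
        mem_posPart_rename.2 ⟨l, hl, hl', rfl⟩
      have h₃ := h₂ v (Finset.mem_inter.2 ⟨Finset.mem_biUnion.2 ⟨_, hkm, by
        rw [Literal.rename_vars]; exact hv.2⟩, hmem l hl hl' v hv.1⟩)
      have h₄ : l.tmax v ≤ Clause.tmax v (Clause.posPart (Clause.rename ρ C)) := by
        rw [← Literal.rename_tmax ρ]
        exact Finset.le_sup (f := Literal.tmax v)
          (Finset.mem_filter.2 ⟨hlm, by rw [Literal.rename_vars]; exact hv.1⟩)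
      have h₅ : Clause.tmin v (Clause.negPart (Clause.rename ρ C)) ≤ k.tmin v := by
        rw [← Literal.rename_tmin ρ]
        exact Nat.sInf_le ⟨_, hkm, by rw [Literal.rename_vars]; exact hv.2, rfl⟩
      omega
  · intro h C' hC'
    obtain ⟨C, hC, rfl⟩ := Finset.mem_image.1 hC'
    have hr : ∀ c, c ∈ ren₁ C ∪ ren₂ C ∪ ren₃ C → ∃ l ∈ c, l.Holds ρ := fun c hc =>
      h c (by simp only [ren, Set.mem_iUnion]; exact ⟨C, hC, hc⟩)
    constructor
    · intro v hv
      obtain ⟨_, hk, hv⟩ := Finset.mem_biUnion.1 hv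
      obtain ⟨l, hl, hl', rfl⟩ := mem_posPart_rename.1 hk
      rw [Literal.rename_vars] at hv
      rw [hocc]
      have h₁ : l.occ v = 1 := by
        refine le_antisymm ?_ (Literal.occ_pos_iff.2 hv)
        by_contra hcon
        obtain ⟨a, ha, ha'⟩ := hr _ (.inl (.inl ⟨l, hl, ⟨v, not_le.1 hcon⟩, rfl⟩))
        rw [Finset.mem_singleton] at ha
        exact hl' (ha ▸ ha')
      rw [← h₁]
      refine Finset.sum_eq_single_of_mem l (Finset.mem_filter.2 ⟨hl, hl'⟩) ?_
      intro k hk hkl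
      rw [Finset.mem_filter] at hk
      by_contra hcon
      have hvk := Literal.occ_pos_iff.1 (Nat.pos_of_ne_zero hcon)
      obtain ⟨a, ha, ha'⟩ := hr _ (.inl (.inr ⟨l, hl, k, hk.1, hkl.symm, ⟨v, by simp [hv, hvk]⟩, rfl⟩))
      rcases Finset.mem_insert.1 ha with rfl | ha
      · exact hl' ha'
      · rw [Finset.mem_singleton] at ha
        exact hk.2 (ha ▸ ha')
    · intro v hv
      rw [Finset.mem_inter] at hv
      obtain ⟨_, hk₀, hv₀⟩ := Finset.mem_biUnion.1 hv.1
      refine Finset.sup_le fun l' hl' => ?_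
      -- Nonemptiness is essential: the infimum of the empty set would be `0`. It is provided by the
      -- assumption that `v` occurs in the negative part.
      refine le_csInf ⟨_, _, hk₀, hv₀, rfl⟩ ?_
      rintro _ ⟨k', hk', hvk, rfl⟩
      obtain ⟨hl', hvl⟩ := Finset.mem_filter.1 hl'
      obtain ⟨l, hl, hln, rfl⟩ := mem_posPart_rename.1 hl'
      obtain ⟨k, hk, hkn, rfl⟩ := mem_negPart_rename.1 hk'
      rw [Literal.rename_vars] at hvl hvk
      rw [Literal.rename_tmax, Literal.rename_tmin]
      by_contra hcon
      obtain ⟨a, ha, ha'⟩ := hr _ (.inr ⟨l, hl, k, hk, ⟨v, by simp [hvl, hvk], not_le.1 hcon⟩, rfl⟩)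
      rcases Finset.mem_insert.1 ha with rfl | ha
      · exact hln ha'
      · rw [Finset.mem_singleton] at ha
        subst ha
        exact PropLit.dual_holds.1 ha' hkn

/-! ### The length of `ren` -/

theorem card_le_two_of_mem_ren {S : ClauseSet} {c : Finset PropLit} (h : c ∈ ren S) :
    c.card ≤ 2 := by
  simp only [ren, Set.mem_iUnion, Set.mem_union] at h
  obtain ⟨C, -, (⟨l, -, -, rfl⟩ | ⟨l, -, k, -, -, -, rfl⟩) | ⟨l, -, k, -, -, rfl⟩⟩ := h
  · simp
  · exact Finset.card_le_two
  · exact Finset.card_le_two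

open Classical in
/-- The clauses of `ren` for two literals. -/
noncomputable def renPair (l k : Literal) : List (List PropLit) :=
  (if ∃ v, 1 < l.occ v then [ [skel l] ] else []) ++
  (if l ≠ k ∧ (l.vars ∩ k.vars).Nonempty then [ [skel l, skel k] ] else []) ++
  (if ∃ v ∈ l.vars ∩ k.vars, k.tmin v < l.tmax v then [ [skel l, (skel k).dual] ] else [])

/-- A list of the clauses of `ren`. -/
noncomputable def renList (S : List (List Literal)) : List (List PropLit) :=
  S.flatMap fun C => C.flatMap fun l => C.flatMap fun k => renPair l k

theorem mem_renPair {l k : Literal} {c : List PropLit} : c ∈ renPair l k ↔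
    ((∃ v, 1 < l.occ v) ∧ c = [skel l]) ∨
    ((l ≠ k ∧ (l.vars ∩ k.vars).Nonempty) ∧ c = [skel l, skel k]) ∨
    ((∃ v ∈ l.vars ∩ k.vars, k.tmin v < l.tmax v) ∧ c = [skel l, (skel k).dual]) := by
  have h : ∀ (p : Prop) [Decidable p] (d : List PropLit),
      c ∈ (if p then [d] else []) ↔ p ∧ c = d := by
    intro p _ d
    by_cases hp : p <;> simp [hp]
  rw [renPair, List.mem_append, List.mem_append, h, h, h, or_assoc]

theorem mem_clauseSetOf {S : List (List Literal)} {C : Clause} :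
    C ∈ clauseSetOf S ↔ ∃ C' ∈ S, C'.toFinset = C := by
  simp [clauseSetOf]

theorem mem_ren_iff {S : List (List Literal)} {c : Finset PropLit} :
    c ∈ ren (clauseSetOf S) ↔ ∃ d ∈ renList S, c = d.toFinset := by
  simp only [ren, Set.mem_iUnion, Set.mem_union, renList, List.mem_flatMap, mem_renPair]
  constructor
  · rintro ⟨C, hC, hc⟩
    obtain ⟨C', hC', rfl⟩ := mem_clauseSetOf.1 hC
    obtain (⟨l, hl, h, rfl⟩ | ⟨l, hl, k, hk, h₁, h₂, rfl⟩) | ⟨l, hl, k, hk, h, rfl⟩ := hc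
    · exact ⟨[skel l], ⟨C', hC', l, List.mem_toFinset.1 hl, l, List.mem_toFinset.1 hl,
        .inl ⟨h, rfl⟩⟩, by simp⟩
    · exact ⟨[skel l, skel k], ⟨C', hC', l, List.mem_toFinset.1 hl, k, List.mem_toFinset.1 hk,
        .inr (.inl ⟨⟨h₁, h₂⟩, rfl⟩)⟩, by simp⟩
    · exact ⟨[skel l, (skel k).dual], ⟨C', hC', l, List.mem_toFinset.1 hl, k,
        List.mem_toFinset.1 hk, .inr (.inr ⟨h, rfl⟩)⟩, by simp⟩
  · rintro ⟨d, ⟨C, hC, l, hl, k, hk, h⟩, rfl⟩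
    have hl := List.mem_toFinset.2 hl
    have hk := List.mem_toFinset.2 hk
    refine ⟨C.toFinset, mem_clauseSetOf.2 ⟨C, hC, rfl⟩, ?_⟩
    rcases h with ⟨h, rfl⟩ | ⟨⟨h₁, h₂⟩, rfl⟩ | ⟨h, rfl⟩
    · exact .inl (.inl ⟨l, hl, h, by simp⟩)
    · exact .inl (.inr ⟨l, hl, k, hk, h₁, h₂, by simp⟩)
    · exact .inr ⟨l, hl, k, hk, h, by simp⟩

theorem length_flatMap_le {α β : Type*} {l : List α} {f : α → List β} {m n : ℕ}
    (hl : l.length ≤ m) (h : ∀ a ∈ l, (f a).length ≤ n) : (l.flatMap f).length ≤ m * n := by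
  rw [List.length_flatMap]
  calc (l.map fun a => (f a).length).sum ≤ (l.map fun a => (f a).length).length • n :=
        List.sum_le_card_nsmul _ _ (by simpa using h)
    _ ≤ m * n := by simpa using Nat.mul_le_mul_right n hl

theorem length_le_length_flatMap {α β : Type*} {l : List α} {f : α → List β}
    (h : ∀ a ∈ l, 1 ≤ (f a).length) : l.length ≤ (l.flatMap f).length := by
  rw [List.length_flatMap]
  simpa using List.card_nsmul_le_sum (l.map fun a => (f a).length) 1 (by simpa using h)

theorem length_le_of_mem_flatMap {α β : Type*} {l : List α} {f : α → List β} {a : α} (h : a ∈ l) :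
    (f a).length ≤ (l.flatMap f).length :=
  (List.sublist_flatten_of_mem (List.mem_map_of_mem h)).length_le

theorem exists_poly_length_ren : ∃ p : Polynomial ℕ, ∀ S : List (List Literal),
    (∀ c ∈ ren (clauseSetOf S), c.card ≤ 2) ∧
    ∃ T : KromClauses, kromSetOf T = ren (clauseSetOf S) ∧
      (encodeKrom T).length ≤ p.eval (encodeClauses S).length := by
  -- At most `n` clauses, `n` choices each for two literals, three clauses per pair, and for each of
  -- these two braces and two literals of length at most `n`.
  refine ⟨.X * (.X * (.X * (3 * (2 + 2 * .X)))), fun S => ⟨fun _ h => card_le_two_of_mem_ren h,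
    ⟨renList S, ?_⟩, ?_, ?_⟩⟩
  · simp only [renList, List.mem_flatMap, mem_renPair]
    rintro d ⟨C, hC, l, hl, k, hk, ⟨-, rfl⟩ | ⟨-, rfl⟩ | ⟨-, rfl⟩⟩ <;> simp
  · ext c
    exact mem_ren_iff.symm
  set n := (encodeClauses S).length with hn
  have hC : ∀ C ∈ S, (C.flatMap encodeLiteral).length + 2 ≤ n := by
    intro C hC
    have := length_le_of_mem_flatMap
      (f := fun C => Letter.lbrace :: C.flatMap encodeLiteral ++ [Letter.rbrace]) hC
    simp only [List.length_append, List.length_cons, List.length_nil] at this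
    exact this
  have hS : S.length ≤ n := length_le_length_flatMap (by simp)
  have hlen : ∀ C ∈ S, C.length ≤ n := by
    intro C h
    have : C.length ≤ (C.flatMap encodeLiteral).length :=
      length_le_length_flatMap (by simp [encodeLiteral])
    have := hC C h
    omega
  have hlit : ∀ C ∈ S, ∀ l ∈ C, (encodePropLit (skel l)).length ≤ n := by
    intro C h l hl
    have h₁ := hC C h
    have h₂ := length_le_of_mem_flatMap (f := encodeLiteral) hl
    have h₃ : (encodePropLit (skel l)).length ≤ (encodeLiteral l).length := by
      simp [encodePropLit, encodeLiteral, skel]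
    omega
  have hdual : ∀ a : PropLit, (encodePropLit a.dual).length = (encodePropLit a).length := by
    intro a
    simp [encodePropLit, PropLit.dual]
  simp only [Polynomial.eval_mul, Polynomial.eval_X, Polynomial.eval_add, Polynomial.eval_ofNat]
  change ((renList S).flatMap fun C =>
    Letter.lbrace :: C.flatMap encodePropLit ++ [Letter.rbrace]).length ≤ _
  rw [renList, List.flatMap_assoc]
  refine length_flatMap_le hS fun C hCS => ?_
  rw [List.flatMap_assoc]
  refine length_flatMap_le (hlen C hCS) fun l hl => ?_
  rw [List.flatMap_assoc]
  refine length_flatMap_le (hlen C hCS) fun k hk => ?_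
  refine length_flatMap_le ?_ fun c hc => ?_
  · rw [renPair]
    simp only [List.length_append]
    split_ifs <;> simp
  · have h₁ := hlit C hCS l hl
    have h₂ := hlit C hCS k hk
    rcases mem_renPair.1 hc with ⟨-, rfl⟩ | ⟨-, rfl⟩ | ⟨-, rfl⟩
    · simp; omega
    · simp; omega
    · simp [hdual]; omega

/-! ### Satisfiability of Krom clauses -/

/-- A set of binary clauses that is closed under resolution and contains no contradictory units is
satisfiable. -/
theorem exists_model {R : PropLit → PropLit → Prop} (symm : ∀ a b, R a b → R b a)
    (res : ∀ a b c, R a b → R b.dual c → R a c) (cons : ∀ a, R a a → ¬ R a.dual a.dual) :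
    ∃ M : Set PredSym, ∀ a b, R a b → a.Holds M ∨ b.Holds M := by
  have hne : ∀ a : PropLit, a.dual ≠ a := fun a h => by
    have := congrArg PropLit.sign h
    simp [PropLit.dual] at this
  -- The clause `R a.dual b` is the implication from `a` to `b`. The members are the partial
  -- assignments, as sets of literals, that are consistent and closed under implication.
  let 𝒜 : Set (Set PropLit) := {A | (∀ a ∈ A, a.dual ∉ A) ∧ ∀ a ∈ A, ∀ b, R a.dual b → b ∈ A}
  obtain ⟨A, hA⟩ := zorn_subset 𝒜 (by
    intro c hc hchain
    refine ⟨⋃₀ c, ⟨?_, ?_⟩, fun s hs => Set.subset_sUnion_of_mem hs⟩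
    · rintro a ⟨s, hs, has⟩ ⟨t, ht, hat⟩
      rcases hchain.total hs ht with h | h
      · exact (hc ht).1 a (h has) hat
      · exact (hc hs).1 a has (h hat)
    · rintro a ⟨s, hs, has⟩ b hb
      exact ⟨s, hs, (hc hs).2 a has b hb⟩)
  -- By maximality, `A` cannot be extended by `y` and its consequences. Every possible clash
  -- involving the new literals, unless already excluded, resolves to the unit clause `y.dual`.
  have hext : ∀ y, y ∉ A → y.dual ∉ A → R y.dual y.dual := by
    intro y hy hy'
    by_contra hR
    have hsub : A ⊆ A ∪ ({y} ∪ {b | R y.dual b}) := Set.subset_union_left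
    refine hy (hA.le_of_ge (y := A ∪ ({y} ∪ {b | R y.dual b})) ⟨?_, ?_⟩ hsub (.inr (.inl rfl)))
    -- Contraposition: if `A` contained the dual of a consequence of `y`, it would contain `y.dual`.
    · have hno : ∀ b, R y.dual b → b.dual ∉ A := fun b hb h =>
        hy' (hA.prop.2 _ h _ (by rw [PropLit.dual_dual]; exact symm _ _ hb))
      rintro a (ha | rfl | ha) (ha' | ha' | ha')
      · exact hA.prop.1 a ha ha'
      · rw [Set.mem_singleton_iff] at ha'
        exact hy' (by rw [← ha', PropLit.dual_dual]; exact ha)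
      · exact hno _ ha' (by rw [PropLit.dual_dual]; exact ha)
      · exact hy' ha'
      · exact hne _ ha'
      · exact hR ha'
      · exact hno _ ha ha'
      · rw [Set.mem_singleton_iff] at ha'
        rw [Set.mem_ofPred_eq, ← PropLit.dual_dual a, ha'] at ha
        exact hR ha
      · exact hR (res _ _ _ ha (symm _ _ ha'))
    · rintro a (ha | rfl | ha) b hb
      · exact .inl (hA.prop.2 a ha b hb)
      · exact .inr (.inr hb)
      · exact .inr (.inr (res _ _ _ ha hb))
  have htot : ∀ y, y ∉ A → y.dual ∈ A := by
    intro y hy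
    by_contra hy'
    refine cons _ (hext y hy hy') (hext y.dual hy' ?_)
    rwa [PropLit.dual_dual]
  have hM : ∀ a : PropLit, a ∈ A → a.Holds {p | (⟨true, p⟩ : PropLit) ∈ A} := by
    rintro ⟨s, p⟩ ha
    cases s with
    | true => simpa [PropLit.Holds] using ha
    | false =>
      have := hA.prop.1 _ ha
      simpa [PropLit.Holds, PropLit.dual] using this
  refine ⟨{p | (⟨true, p⟩ : PropLit) ∈ A}, fun a b hab => ?_⟩
  by_cases ha : a ∈ A
  · exact .inl (hM a ha)
  · refine .inr (hM b (hA.prop.2 _ (htot a ha) b ?_))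
    rwa [PropLit.dual_dual]

end OccRen

namespace OccRen

open FirstOrder

/-! ### Reading words -/

namespace Letter

/-- The letters that occur in symbols. -/
def isSym : Letter → Bool
  | bit _ | colon => true
  | _ => false

/-- The signs of literals. -/
def isSign : Letter → Bool
  | pos | neg => true
  | _ => false

/-- The letters other than braces. -/
def noBrace : Letter → Bool
  | lbrace | rbrace => false
  | _ => true

/-- The letters that occur within literals, after the sign. -/
def inner (a : Letter) : Bool := a.noBrace && !a.isSign

theorem inner_of_isSym {a : Letter} (h : a.isSym = true) : a.inner = true := by
  cases a <;> simp_all [isSym, Letter.inner, noBrace, isSign]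

theorem noBrace_of_inner {a : Letter} (h : a.inner = true) : a.noBrace = true := by
  cases a <;> simp_all [Letter.inner, Letter.noBrace, isSign]

theorem noBrace_of_isSign {a : Letter} (h : a.isSign = true) : a.noBrace = true := by
  cases a <;> simp_all [Letter.noBrace, isSign]

theorem not_inner_of_isSign {a : Letter} (h : a.isSign = true) : a.inner = false := by
  cases a <;> simp_all [Letter.inner, Letter.noBrace, isSign]

theorem isSign_iff {a : Letter} : a.isSign = true ↔ ∃ b, a = encodeSign b := by
  cases a <;> simp [isSign, encodeSign]

end Letter

theorem encodeSign_injective : Function.Injective encodeSign := by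
  intro a b h
  cases a <;> cases b <;> simp_all [encodeSign]

/-- `l` does not begin with a letter that satisfies `p`. -/
def Stops (p : Letter → Bool) (l : List Letter) : Prop := ∀ a, l.head? = some a → p a = false

theorem stops_cons {p : Letter → Bool} {a : Letter} {l : List Letter} (h : p a = false) :
    Stops p (a :: l) := by
  intro b hb
  simp only [List.head?_cons, Option.some.injEq] at hb
  rwa [← hb]

theorem Stops.takeWhile {p : Letter → Bool} {l : List Letter} (h : Stops p l) :
    l.takeWhile p = [] := by
  cases l with
  | nil => rfl
  | cons a l => rw [List.takeWhile_cons, h a rfl]; rfl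

theorem Stops.dropWhile {p : Letter → Bool} {l : List Letter} (h : Stops p l) :
    l.dropWhile p = l := by
  cases l with
  | nil => rfl
  | cons a l => rw [List.dropWhile_cons, h a rfl]; rfl

theorem takeWhile_append_of_stops {p : Letter → Bool} (x : List Letter) {l : List Letter}
    (h : Stops p l) : (x ++ l).takeWhile p = x.takeWhile p := by
  induction x with
  | nil => simpa using h.takeWhile
  | cons a x ih => by_cases ha : p a = true <;> simp [ha, ih]

theorem takeWhile_append_of_all {p : Letter → Bool} {x : List Letter} (hx : ∀ a ∈ x, p a = true)
    {l : List Letter} (h : Stops p l) : (x ++ l).takeWhile p = x := by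
  rw [takeWhile_append_of_stops x h, List.takeWhile_eq_self_iff]
  exact hx

theorem dropWhile_append_of_all {p : Letter → Bool} {x : List Letter} (hx : ∀ a ∈ x, p a = true)
    {l : List Letter} (h : Stops p l) : (x ++ l).dropWhile p = l := by
  induction x with
  | nil => simpa using h.dropWhile
  | cons a x ih => simpa [hx a (by simp)] using ih fun b hb => hx b (by simp [hb])

/-- A word has at most one decomposition into letters that satisfy `p` and a rest that does not
begin with such a letter. -/
theorem append_inj_of_stops {p : Letter → Bool} {x x' l l' : List Letter}
    (hx : ∀ a ∈ x, p a = true) (hx' : ∀ a ∈ x', p a = true) (h : Stops p l) (h' : Stops p l')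
    (e : x ++ l = x' ++ l') : x = x' ∧ l = l' :=
  ⟨by rw [← takeWhile_append_of_all hx h, e, takeWhile_append_of_all hx' h'],
    by rw [← dropWhile_append_of_all hx h, e, dropWhile_append_of_all hx' h']⟩

/-! ### Injectivity of the encodings -/

theorem encodeIndex_injective : Function.Injective encodeIndex := by
  intro m n h
  have := List.map_injective_iff.2 (fun a b h => Letter.bit.inj h) h
  rw [← Computability.decode_encodeNat m, this, Computability.decode_encodeNat]

theorem isSym_of_mem_encodeIndex {n : ℕ} {a : Letter} (h : a ∈ encodeIndex n) :
    a.isSym = true := by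
  obtain ⟨b, -, rfl⟩ := List.mem_map.1 h
  rfl

theorem isSym_of_mem_encodeSymbol {n i : ℕ} {a : Letter} (h : a ∈ encodeSymbol n i) :
    a.isSym = true := by
  rw [encodeSymbol, List.mem_append, List.mem_cons] at h
  rcases h with h | rfl | h
  · exact isSym_of_mem_encodeIndex h
  · rfl
  · exact isSym_of_mem_encodeIndex h

theorem encodeSymbol_inj {n i n' i' : ℕ} (h : encodeSymbol n i = encodeSymbol n' i') :
    n = n' ∧ i = i' := by
  have hb : ∀ m, ∀ a ∈ encodeIndex m, (decide (a ≠ Letter.colon)) = true := by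
    intro m a ha
    obtain ⟨b, -, rfl⟩ := List.mem_map.1 ha
    simp
  obtain ⟨h₁, h₂⟩ := append_inj_of_stops (hb n) (hb n') (stops_cons (by simp))
    (stops_cons (by simp)) h
  exact ⟨encodeIndex_injective h₁, encodeIndex_injective (List.cons.inj h₂).2⟩

/-- The comma after every argument, including the last, ensures that a numeral at the end of an
argument is not continued. -/
theorem encodeArgs_inj {n : ℕ} {ts ts' : Fin n → Term} {r r' : List Letter}
    (ih : ∀ i t' r r', Stops Letter.isSym r → Stops Letter.isSym r' →
      encodeTerm (ts i) ++ r = encodeTerm t' ++ r' → ts i = t' ∧ r = r')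
    (h : (List.ofFn fun i => encodeTerm (ts i) ++ [Letter.comma]).flatten ++ r =
      (List.ofFn fun i => encodeTerm (ts' i) ++ [Letter.comma]).flatten ++ r') :
    ts = ts' ∧ r = r' := by
  induction n with
  | zero => exact ⟨Subsingleton.elim _ _, by simpa using h⟩
  | succ n ih' =>
    simp only [List.ofFn_succ, List.flatten_cons, List.append_assoc, List.singleton_append] at h
    obtain ⟨h₁, h₂⟩ := ih 0 _ _ _ (stops_cons rfl) (stops_cons rfl) h
    obtain ⟨h₃, h₄⟩ := ih' (ts := fun i => ts i.succ) (ts' := fun i => ts' i.succ)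
      (fun i => ih i.succ) (List.cons.inj h₂).2
    refine ⟨funext fun i => ?_, h₄⟩
    refine Fin.cases h₁ (fun i => congrFun h₃ i) i

/-- Terms are compared as prefixes of longer words to make the induction work. A variable ends with
a numeral that has no end mark; therefore the rest must not begin with a letter that could prolong
it. -/
theorem encodeTerm_inj (t : Term) : ∀ (t' : Term) (r r' : List Letter), Stops Letter.isSym r →
    Stops Letter.isSym r' → encodeTerm t ++ r = encodeTerm t' ++ r' → t = t' ∧ r = r' := by
  induction t with
  | var v =>
    intro t' r r' hr hr' h
    cases t' with
    | var v' =>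
      simp only [encodeTerm, List.cons_append, List.cons.injEq, true_and] at h
      obtain ⟨h₁, h₂⟩ := append_inj_of_stops (fun _ => isSym_of_mem_encodeIndex)
        (fun _ => isSym_of_mem_encodeIndex) hr hr' h
      exact ⟨by rw [encodeIndex_injective h₁], h₂⟩
    | func f' ts' => simp [encodeTerm] at h
  | @func n f ts ih =>
    intro t' r r' hr hr' h
    cases t' with
    | var v' => simp [encodeTerm] at h
    | @func n' f' ts' =>
      simp only [encodeTerm, List.cons_append, List.append_assoc, List.cons.injEq, true_and] at h
      obtain ⟨h₁, h₂⟩ := append_inj_of_stops (fun _ => isSym_of_mem_encodeSymbol)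
        (fun _ => isSym_of_mem_encodeSymbol) (stops_cons rfl) (stops_cons rfl) h
      obtain ⟨rfl, rfl⟩ := encodeSymbol_inj h₁
      obtain ⟨rfl, h₃⟩ := encodeArgs_inj ih (List.cons.inj h₂).2
      exact ⟨rfl, by simpa using h₃⟩

/-- The encoding of a literal without its sign. -/
def encodeBody (l : Literal) : List Letter :=
  encodeSymbol l.pred.1 l.pred.2 ++ Letter.lpar ::
    ((List.ofFn fun i => encodeTerm (l.args i) ++ [Letter.comma]).flatten ++ [Letter.rpar])

theorem encodeLiteral_eq (l : Literal) : encodeLiteral l = encodeSign l.sign :: encodeBody l := by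
  simp [encodeLiteral, encodeBody]

theorem encodeBody_inj {l k : Literal} (hs : l.sign = k.sign) (h : encodeBody l = encodeBody k) :
    l = k := by
  obtain ⟨s, ⟨n, p⟩, a⟩ := l
  obtain ⟨s', ⟨n', p'⟩, a'⟩ := k
  obtain rfl : s = s' := hs
  obtain ⟨h₁, h₂⟩ := append_inj_of_stops (p := Letter.isSym) (fun _ => isSym_of_mem_encodeSymbol)
    (fun _ => isSym_of_mem_encodeSymbol) (stops_cons rfl) (stops_cons rfl) h
  obtain ⟨h₃, h₄⟩ := encodeSymbol_inj h₁
  simp only at h₃ h₄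
  subst h₃ h₄
  obtain ⟨rfl, -⟩ := encodeArgs_inj (fun i => encodeTerm_inj _) (List.cons.inj h₂).2
  rfl

theorem inner_of_mem_encodeTerm {a : Letter} (t : Term) : a ∈ encodeTerm t → a.inner = true := by
  induction t with
  | var v =>
    intro h
    rw [encodeTerm, List.mem_cons] at h
    rcases h with rfl | h
    · rfl
    · exact Letter.inner_of_isSym (isSym_of_mem_encodeIndex h)
  | func f ts ih =>
    intro h
    simp only [encodeTerm, List.cons_append, List.append_assoc, List.mem_cons, List.mem_append,
      mem_flatten_ofFn, List.not_mem_nil, or_false] at h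
    rcases h with rfl | h | rfl | ⟨i, h | rfl⟩ | rfl
    · rfl
    · exact Letter.inner_of_isSym (isSym_of_mem_encodeSymbol h)
    · rfl
    · exact ih i h
    · rfl
    · rfl

theorem inner_of_mem_encodeBody {a : Letter} {l : Literal} (h : a ∈ encodeBody l) :
    a.inner = true := by
  simp only [encodeBody, List.mem_cons, List.mem_append,
      mem_flatten_ofFn, List.not_mem_nil, or_false] at h
  rcases h with h | rfl | ⟨i, h | rfl⟩ | rfl
  · exact Letter.inner_of_isSym (isSym_of_mem_encodeSymbol h)
  · rfl
  · exact inner_of_mem_encodeTerm _ h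
  · rfl
  · rfl

/-! ### Occurrences of variables in words -/

/-- The change of the nesting depth by a letter. -/
def depthStep : Option ℕ → Letter → Option ℕ
  | some d, .lpar => some (d + 1)
  | some 0, .rpar => none
  | some (d + 1), .rpar => some d
  | o, _ => o

/-- The names of the variables that occur in a word, with the depths of the occurrences. -/
def scan : Option ℕ → List Letter → List (List Letter × Option ℕ)
  | _, [] => []
  | o, a :: y =>
    (if a = .variable then [(y.takeWhile Letter.isSym, o)] else []) ++ scan (depthStep o a) y

theorem mem_scan {s : List Letter} {e : Option ℕ} : ∀ {o : Option ℕ} {y : List Letter},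
    (s, e) ∈ scan o y ↔ ∃ x z, y = x ++ .variable :: z ∧ x.foldl depthStep o = e ∧
      s = z.takeWhile Letter.isSym
  | o, [] => by simp [scan]
  | o, a :: y => by
    rw [scan, List.mem_append, mem_scan]
    constructor
    · rintro (h | ⟨x, z, rfl, h₁, h₂⟩)
      · split_ifs at h with ha
        · simp only [List.mem_singleton, Prod.mk.injEq] at h
          exact ⟨[], y, by simp [ha], by simp [h.2], h.1⟩
        · simp at h
      · exact ⟨a :: x, z, rfl, h₁, h₂⟩
    · rintro ⟨x, z, h, h₁, h₂⟩
      cases x with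
      | nil =>
        simp only [List.nil_append, List.cons.injEq] at h
        obtain ⟨rfl, rfl⟩ := h
        left
        simp_all
      | cons b x =>
        simp only [List.cons_append, List.cons.injEq] at h
        obtain ⟨rfl, rfl⟩ := h
        exact .inr ⟨x, z, rfl, h₁, h₂⟩

theorem mem_map_fst_scan {s : List Letter} {o : Option ℕ} {y : List Letter} :
    s ∈ (scan o y).map Prod.fst ↔ ∃ x z, y = x ++ .variable :: z ∧ s = z.takeWhile Letter.isSym := by
  constructor
  · intro h
    obtain ⟨⟨s, e⟩, hs, rfl⟩ := List.mem_map.1 h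
    obtain ⟨x, z, h₁, -, h₂⟩ := mem_scan.1 hs
    exact ⟨x, z, h₁, h₂⟩
  · rintro ⟨x, z, h, h'⟩
    exact List.mem_map.2 ⟨(s, _), mem_scan.2 ⟨x, z, h, rfl, h'⟩, rfl⟩

/-- Turns a repeated variable into two positions of the word with equal names behind them, the form
that rules can test. -/
theorem not_nodup_scan_iff : ∀ {o : Option ℕ} {y : List Letter},
    ¬ ((scan o y).map Prod.fst).Nodup ↔ ∃ x z x' z', y = x ++ .variable :: z ∧
      z = x' ++ .variable :: z' ∧ z.takeWhile Letter.isSym = z'.takeWhile Letter.isSym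
  | o, [] => by simp [scan]
  | o, a :: y => by
    have ih := not_nodup_scan_iff (o := depthStep o a) (y := y)
    have h₀ : ¬ ((scan o (a :: y)).map Prod.fst).Nodup ↔
        (a = .variable ∧ y.takeWhile Letter.isSym ∈ (scan (depthStep o a) y).map Prod.fst) ∨
        ¬ ((scan (depthStep o a) y).map Prod.fst).Nodup := by
      rw [scan]
      by_cases ha : a = .variable
      · rw [if_pos ha, List.singleton_append, List.map_cons, List.nodup_cons]
        tauto
      · rw [if_neg ha, List.nil_append]
        tauto
    rw [h₀, ih, mem_map_fst_scan]
    constructor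
    · rintro (⟨rfl, x', z', h, h'⟩ | ⟨x, z, x', z', rfl, h, h'⟩)
      · exact ⟨[], y, x', z', rfl, h, h'⟩
      · exact ⟨a :: x, z, x', z', rfl, h, h'⟩
    · rintro ⟨x, z, x', z', h, h₁, h₂⟩
      cases x with
      | nil =>
        simp only [List.nil_append, List.cons.injEq] at h
        obtain ⟨rfl, rfl⟩ := h
        exact .inl ⟨rfl, x', z', h₁, h₂⟩
      | cons b x =>
        simp only [List.cons_append, List.cons.injEq] at h
        obtain ⟨rfl, rfl⟩ := h
        exact .inr ⟨x, z, x', z', rfl, h₁, h₂⟩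

theorem depthStep_of_isSym {a : Letter} (h : a.isSym = true) (o : Option ℕ) :
    depthStep o a = o := by
  cases o with
  | none => rfl
  | some d => cases a <;> simp_all [depthStep, Letter.isSym]

theorem scan_append_of_isSym {x : List Letter} (hx : ∀ a ∈ x, a.isSym = true) (o : Option ℕ)
    (y : List Letter) : scan o (x ++ y) = scan o y := by
  induction x with
  | nil => rfl
  | cons a x ih =>
    have ha := hx a (by simp)
    rw [List.cons_append, scan, depthStep_of_isSym ha, ih fun b hb => hx b (by simp [hb]), if_neg]
    · rfl
    · rintro rfl
      simp [Letter.isSym] at ha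

/-- The entry of `scan` for an occurrence of a variable. -/
def scanEntry (p : ℕ × ℕ) : List Letter × Option ℕ := (encodeIndex p.1, some p.2)

theorem scan_args {n d : ℕ} {ts : Fin n → Term} (ih : ∀ i r, Stops Letter.isSym r →
      scan (some d) (encodeTerm (ts i) ++ r) =
        (Term.occs d (ts i)).map scanEntry ++ scan (some d) r) (r : List Letter) :
    scan (some d) ((List.ofFn fun i => encodeTerm (ts i) ++ [Letter.comma]).flatten ++ r) =
      (List.ofFn fun i => Term.occs d (ts i)).flatten.map scanEntry ++ scan (some d) r := by
  induction n with
  | zero => simp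
  | succ n ih' =>
    simp only [List.ofFn_succ, List.flatten_cons, List.append_assoc, List.map_append,
      List.cons_append, List.nil_append]
    rw [ih 0 (Letter.comma :: _) (stops_cons rfl)]
    congr 1
    rw [scan, if_neg (by simp), List.nil_append]
    exact ih' (ts := fun i => ts i.succ) fun i => ih i.succ

/-- The depth of an occurrence is the number of open parentheses, and a term closes all those it
opens; so the scan of the rest resumes at the depth `d`. -/
theorem scan_encodeTerm (t : Term) : ∀ (d : ℕ) (r : List Letter), Stops Letter.isSym r →
    scan (some d) (encodeTerm t ++ r) = (Term.occs d t).map scanEntry ++ scan (some d) r := by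
  induction t with
  | var v =>
    intro d r hr
    rw [encodeTerm, List.cons_append, scan, if_pos rfl,
      takeWhile_append_of_all (fun _ => isSym_of_mem_encodeIndex) hr]
    have : depthStep (some d) .variable = some d := rfl
    rw [this, scan_append_of_isSym fun _ => isSym_of_mem_encodeIndex]
    rfl
  | func f ts ih =>
    intro d r hr
    simp only [encodeTerm, List.cons_append, List.append_assoc, Term.occs]
    rw [scan, if_neg (by simp), List.nil_append]
    have : depthStep (some d) .function = some d := rfl
    rw [this, scan_append_of_isSym fun _ => isSym_of_mem_encodeSymbol, scan, if_neg (by simp),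
      List.nil_append]
    have : depthStep (some d) .lpar = some (d + 1) := rfl
    rw [this, scan_args fun i r hr => ih i (d + 1) r hr]
    congr 1

theorem scan_encodeBody (l : Literal) : scan (some 0) (encodeBody l) = l.occs.map scanEntry := by
  rw [encodeBody, scan_append_of_isSym fun _ => isSym_of_mem_encodeSymbol, scan, if_neg (by simp),
    List.nil_append]
  have : depthStep (some 0) .lpar = some 1 := rfl
  rw [this, scan_args fun i r hr => scan_encodeTerm _ 1 r hr]
  simp [scan, Literal.occs]

/-! ### Blocks -/

/-- Write down a list of lists, with braces. -/
def encodeBlocks {α : Type} (enc : α → List Letter) (S : List (List α)) : List Letter :=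
  S.flatMap fun C => Letter.lbrace :: C.flatMap enc ++ [Letter.rbrace]

/-- Locates the item of a list to which a given letter of the concatenation belongs. -/
theorem flatMap_eq_append_cons {α β : Type} {f : α → List β} {z : β} : ∀ {l : List α}
    {x y : List β}, l.flatMap f = x ++ z :: y → ∃ l₁ a l₂ x₁ y₁, l = l₁ ++ a :: l₂ ∧
      f a = x₁ ++ z :: y₁ ∧ x = l₁.flatMap f ++ x₁ ∧ y = y₁ ++ l₂.flatMap f
  | [], x, y, h => by simp at h
  | a :: l, x, y, h => by
    rw [List.flatMap_cons, List.append_eq_append_iff] at h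
    rcases h with ⟨x', rfl, h⟩ | ⟨y', h, h'⟩
    · obtain ⟨l₁, b, l₂, x₁, y₁, rfl, h₁, rfl, rfl⟩ := flatMap_eq_append_cons h
      exact ⟨a :: l₁, b, l₂, x₁, y₁, rfl, h₁, by simp, rfl⟩
    · cases y' with
      | nil =>
        obtain ⟨l₁, b, l₂, x₁, y₁, rfl, h₁, h₂, rfl⟩ :=
          flatMap_eq_append_cons (x := []) (by simpa using h'.symm)
        refine ⟨a :: l₁, b, l₂, x₁, y₁, rfl, h₁, ?_, rfl⟩
        rw [List.flatMap_cons, List.append_assoc, ← h₂, h]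
        simp
      | cons z' y' =>
        simp only [List.cons_append, List.cons.injEq] at h'
        obtain ⟨rfl, rfl⟩ := h'
        exact ⟨[], a, l, x, y', rfl, h, by simp, rfl⟩

/-- Encodings that consist of a sign and of inner letters. -/
structure SignedEncoding {α : Type} (enc : α → List Letter) (sgn : α → Bool)
    (body : α → List Letter) : Prop where
  eq : ∀ a, enc a = encodeSign (sgn a) :: body a
  inner : ∀ a, ∀ z ∈ body a, z.inner = true

variable {α : Type} {enc : α → List Letter} {sgn : α → Bool} {body : α → List Letter}

theorem SignedEncoding.eq_nil_of_isSign (he : SignedEncoding enc sgn body) {a : α} {z : Letter}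
    {x y : List Letter} (hz : z.isSign = true) (h : enc a = x ++ z :: y) :
    x = [] ∧ z = encodeSign (sgn a) ∧ y = body a := by
  rw [he.eq] at h
  cases x with
  | nil => simp_all
  | cons b x =>
    simp only [List.cons_append, List.cons.injEq] at h
    have := he.inner a z (by simp [h.2])
    rw [Letter.not_inner_of_isSign hz] at this
    exact absurd this (by simp)

theorem SignedEncoding.noBrace (he : SignedEncoding enc sgn body) {a : α} {z : Letter}
    (h : z ∈ enc a) : z.noBrace = true := by
  rw [he.eq, List.mem_cons] at h
  rcases h with rfl | h
  · exact Letter.noBrace_of_isSign (Letter.isSign_iff.2 ⟨_, rfl⟩)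
  · exact Letter.noBrace_of_inner (he.inner a z h)

/-- In a block, a sign begins an item. -/
theorem SignedEncoding.split (he : SignedEncoding enc sgn body) {C : List α} {x y r : List Letter}
    {z : Letter} (hx : ∀ a ∈ x, a.noBrace = true) (hz : z.isSign = true)
    (h : C.flatMap enc ++ Letter.rbrace :: r = x ++ z :: y) : ∃ C₁ l C₂, C = C₁ ++ l :: C₂ ∧
      x = C₁.flatMap enc ∧ z :: y = enc l ++ (C₂.flatMap enc ++ Letter.rbrace :: r) := by
  rw [List.append_eq_append_iff] at h
  rcases h with ⟨x', rfl, h⟩ | ⟨y', h, h'⟩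
  · cases x' with
    | nil =>
      simp only [List.nil_append, List.cons.injEq] at h
      rw [← h.1] at hz
      simp [Letter.isSign] at hz
    | cons b x' =>
      simp only [List.cons_append, List.cons.injEq] at h
      have := hx b (by simp)
      rw [← h.1] at this
      simp [Letter.noBrace] at this
  · cases y' with
    | nil =>
      simp only [List.nil_append, List.cons.injEq] at h'
      rw [h'.1] at hz
      simp [Letter.isSign] at hz
    | cons b y' =>
      simp only [List.cons_append, List.cons.injEq] at h'
      obtain ⟨rfl, rfl⟩ := h'
      obtain ⟨C₁, l, C₂, x₁, y₁, rfl, h₁, rfl, rfl⟩ := flatMap_eq_append_cons h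
      obtain ⟨rfl, rfl, rfl⟩ := he.eq_nil_of_isSign hz h₁
      exact ⟨C₁, l, C₂, rfl, by simp, by simp [he.eq]⟩

/-- `ItemAt enc S w i C₁ l C₂`: at the position `i`, the word `w` contains the item `l` of the block
`C₁ ++ l :: C₂`. -/
def ItemAt (enc : α → List Letter) (S : List (List α)) (w : List Letter) (i : ℕ)
    (C₁ : List α) (l : α) (C₂ : List α) : Prop :=
  (C₁ ++ l :: C₂) ∈ S ∧ ∃ r, w.drop i = enc l ++ (C₂.flatMap enc ++ Letter.rbrace :: r)

theorem drop_eq_cons_of_getElem? {w : List Letter} {i : ℕ} {a : Letter} (h : w[i]? = some a) :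
    w.drop i = a :: w.drop (i + 1) := by
  obtain ⟨hi, rfl⟩ := List.getElem?_eq_some_iff.1 h
  exact List.drop_eq_getElem_cons hi

theorem getElem?_of_drop_eq_cons {w y : List Letter} {i : ℕ} {a : Letter}
    (h : w.drop i = a :: y) : w[i]? = some a ∧ y = w.drop (i + 1) := by
  constructor
  · rw [← List.head?_drop, h]; rfl
  · rw [← List.tail_drop, h]; rfl

theorem drop_of_drop_eq_append {w x y : List Letter} {i : ℕ} (h : w.drop i = x ++ y) :
    w.drop (i + x.length) = y := by
  rw [← List.drop_drop, h, List.drop_left]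

theorem lt_length_of_drop_eq_cons {w y : List Letter} {i : ℕ} {a : Letter}
    (h : w.drop i = a :: y) : i < w.length := by
  by_contra hi
  rw [List.drop_eq_nil_of_le (by omega)] at h
  exact absurd h (by simp)

/-- Signs are neither braces nor inner letters, so the only place for a sign is the beginning of an
item. Guards can thus recognise items by one letter. -/
theorem SignedEncoding.exists_itemAt (he : SignedEncoding enc sgn body) {S : List (List α)} {i : ℕ}
    {z : Letter} (hz : z.isSign = true) (h : (encodeBlocks enc S)[i]? = some z) :
    ∃ C₁ l C₂, ItemAt enc S (encodeBlocks enc S) i C₁ l C₂ := by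
  have h₁ := drop_eq_cons_of_getElem? h
  have h₂ : encodeBlocks enc S = (encodeBlocks enc S).take i ++
      z :: (encodeBlocks enc S).drop (i + 1) := by rw [← h₁, List.take_append_drop]
  obtain ⟨S₁, C, S₂, x₁, y₁, hS, hC, -, h₃⟩ := flatMap_eq_append_cons h₂
  cases x₁ with
  | nil =>
    simp only [List.cons_append, List.nil_append, List.cons.injEq] at hC
    rw [← hC.1] at hz
    simp [Letter.isSign] at hz
  | cons b x =>
    simp only [List.cons_append, List.cons.injEq] at hC
    have hx : ∀ a ∈ x, a.noBrace = true := by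
      intro a ha
      have hlen : x.length < (C.flatMap enc ++ [Letter.rbrace]).length := by
        rw [hC.2]; simp
      -- The sign comes after `x` within the block, so `x` cannot reach past the closing brace.
      have hpre : x <+: C.flatMap enc := by
        refine List.prefix_of_prefix_length_le (l₃ := C.flatMap enc ++ [Letter.rbrace])
          (hC.2 ▸ List.prefix_append _ _) (List.prefix_append _ _) ?_
        simp at hlen
        simp
        omega
      obtain ⟨c, hc, hac⟩ := List.mem_flatMap.1 (hpre.subset ha)
      exact he.noBrace hac
    obtain ⟨C₁, l, C₂, rfl, -, h₄⟩ := he.split hx hz hC.2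
    refine ⟨C₁, l, C₂, by simp [hS], S₂.flatMap fun C =>
      Letter.lbrace :: C.flatMap enc ++ [Letter.rbrace], ?_⟩
    rw [h₁, h₃, ← List.cons_append, h₄]
    simp

/-- `w` has only letters that satisfy `p` from the position `i` up to the position `j`. -/
def Seg (p : Letter → Bool) (w : List Letter) (i j : ℕ) : Prop :=
  ∃ x, w.drop i = x ++ w.drop j ∧ i + x.length = j ∧ j ≤ w.length ∧ ∀ a ∈ x, p a = true

theorem Seg.of_append {p : Letter → Bool} {w x y : List Letter} {i : ℕ} (hi : i ≤ w.length)
    (h : w.drop i = x ++ y) (hx : ∀ a ∈ x, p a = true) : Seg p w i (i + x.length) := by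
  refine ⟨x, by rw [h, drop_of_drop_eq_append h], rfl, ?_, hx⟩
  have := congrArg List.length h
  simp at this
  omega

/-- An item in the same block, further to the right. -/
theorem SignedEncoding.itemAt_of_seg (he : SignedEncoding enc sgn body) {S : List (List α)}
    {w : List Letter} {i j : ℕ} {C₁ l C₂} (hi : ItemAt enc S w i C₁ l C₂)
    (h : Seg Letter.noBrace w i j) {z : Letter} (hz : z.isSign = true) (hj : w[j]? = some z) :
    ∃ C₁' l' C₂', ItemAt enc S w j C₁' l' C₂' ∧ C₁' ++ l' :: C₂' = C₁ ++ l :: C₂ := by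
  obtain ⟨hS, r, hr⟩ := hi
  obtain ⟨x, hx, -, -, hx'⟩ := h
  rw [drop_eq_cons_of_getElem? hj, hr] at hx
  obtain ⟨D₁, l', C₂', h₁, -, h₂⟩ := he.split (C := l :: C₂) hx' hz (by simpa using hx)
  have e : (C₁ ++ D₁) ++ l' :: C₂' = C₁ ++ l :: C₂ := by rw [h₁]; simp
  exact ⟨C₁ ++ D₁, l', C₂', ⟨e ▸ hS, r, by rw [drop_eq_cons_of_getElem? hj, h₂]⟩, e⟩

theorem exists_block {S : List (List α)} {C : List α} (hC : C ∈ S) : ∃ p r,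
    p < (encodeBlocks enc S).length ∧
    (encodeBlocks enc S).drop p = Letter.lbrace :: (C.flatMap enc ++ Letter.rbrace :: r) := by
  obtain ⟨S₁, S₂, rfl⟩ := List.append_of_mem hC
  refine ⟨(encodeBlocks enc S₁).length, encodeBlocks enc S₂, ?_, ?_⟩
  · simp [encodeBlocks]
  · simp [encodeBlocks]

theorem itemAt_of_block {S : List (List α)} {w r : List Letter} {p : ℕ} {C₁ C₂ : List α} {l : α}
    (hC : C₁ ++ l :: C₂ ∈ S)
    (h : w.drop p = Letter.lbrace :: ((C₁ ++ l :: C₂).flatMap enc ++ Letter.rbrace :: r)) :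
    ItemAt enc S w (p + 1 + (C₁.flatMap enc).length) C₁ l C₂ :=
  ⟨hC, r, drop_of_drop_eq_append (by rw [← (getElem?_of_drop_eq_cons h).2]; simp)⟩

end OccRen

/-! ### Invariants of derivations. -/

namespace Datalog

open OccRen

variable {J ν : Type}

/-- The rule preserves the property `P` of facts. -/
def Rule.Sound (w : List Letter) (P : J × ℕ × ℕ → Prop) (r : Rule J ν) : Prop :=
  ∀ ρ : ν → ℕ, (∀ x, ρ x ≤ w.length) → (∀ g ∈ r.guards, g.2 w[ρ g.1]? = true) →
    (∀ a ∈ r.body, P (a.eval ρ)) → P (r.head.eval ρ)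

theorem Der.of_sound {R : List (Rule J ν)} {w : List Letter} {P : J × ℕ × ℕ → Prop}
    (h : ∀ r ∈ R, r.Sound w P) {f : J × ℕ × ℕ} (hf : Der R w f) : P f := by
  induction hf with
  | intro r hr ρ hρ hg _ ih => exact h r hr ρ hρ hg ih

end Datalog

namespace OccRen

open FirstOrder Datalog

/-! ### Segments of words -/

theorem seg_iff {p : Letter → Bool} {w : List Letter} {i j : ℕ} : Seg p w i j ↔
    i ≤ j ∧ j ≤ w.length ∧ ∀ k, i ≤ k → k < j → ∃ a, w[k]? = some a ∧ p a = true := by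
  constructor
  · rintro ⟨x, hx, rfl, hj, h⟩
    refine ⟨by omega, hj, fun k hk hk' => ?_⟩
    have h₁ : w[k]? = x[k - i]? := by
      rw [← List.getElem?_append_left (l₁ := x) (l₂ := w.drop (i + x.length)) (by omega), ← hx,
        List.getElem?_drop]
      congr 1
      omega
    have h₂ : k - i < x.length := by omega
    exact ⟨x[k - i], by rw [h₁, List.getElem?_eq_getElem h₂], h _ (List.getElem_mem h₂)⟩
  · rintro ⟨hij, hj, h⟩
    refine ⟨(w.drop i).take (j - i), ?_, ?_, hj, ?_⟩
    · have : w.drop j = (w.drop i).drop (j - i) := by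
        rw [List.drop_drop]; congr 1; omega
      rw [this, List.take_append_drop]
    · simp; omega
    · intro a ha
      obtain ⟨k, hk, rfl⟩ := List.getElem_of_mem ha
      simp only [List.length_take, List.length_drop] at hk
      obtain ⟨a, ha, hp⟩ := h (i + k) (by omega) (by omega)
      rw [List.getElem?_eq_some_iff] at ha
      obtain ⟨_, rfl⟩ := ha
      simpa using hp

theorem Seg.mono {p : Letter → Bool} {w : List Letter} {i j i' j' : ℕ} (h : Seg p w i j)
    (hi : i ≤ i') (hij : i' ≤ j') (hj : j' ≤ j) : Seg p w i' j' := by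
  rw [seg_iff] at h ⊢
  exact ⟨hij, by omega, fun k hk hk' => h.2.2 k (by omega) (by omega)⟩

theorem Seg.refl {p : Letter → Bool} {w : List Letter} {i : ℕ} (h : i ≤ w.length) :
    Seg p w i i :=
  seg_iff.2 ⟨le_rfl, h, fun k hk hk' => by omega⟩

theorem Seg.succ {p : Letter → Bool} {w : List Letter} {i j : ℕ} {a : Letter} (h : Seg p w i j)
    (ha : w[j]? = some a) (hp : p a = true) : Seg p w i (j + 1) := by
  rw [seg_iff] at h ⊢
  have : j < w.length := (List.getElem?_eq_some_iff.1 ha).1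
  refine ⟨by omega, this, fun k hk hk' => ?_⟩
  rcases (show k < j ∨ k = j by omega) with h' | rfl
  · exact h.2.2 k hk h'
  · exact ⟨a, ha, hp⟩

theorem Seg.induct {p : Letter → Bool} {w : List Letter} {P : ℕ → Prop} {i j : ℕ}
    (h : Seg p w i j) (h₀ : P i)
    (h₁ : ∀ k a, k < w.length → w[k]? = some a → p a = true → P k → P (k + 1)) : P j := by
  obtain ⟨hij, hj, h⟩ := seg_iff.1 h
  have : ∀ n, i + n ≤ j → P (i + n) := by
    intro n
    induction n with
    | zero => exact fun _ => h₀
    | succ n ih =>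
      intro hn
      obtain ⟨a, ha, hp⟩ := h (i + n) (by omega) (by omega)
      exact h₁ (i + n) a (by omega) ha hp (ih (by omega))
  have := this (j - i) (by omega)
  rwa [show i + (j - i) = j by omega] at this

/-- The sign before a segment of inner letters is determined by the end of the segment. -/
theorem eq_of_seg {w : List Letter} {i i' u : ℕ} {z z' : Letter} (hz : w[i]? = some z)
    (hz' : w[i']? = some z') (h₁ : z.isSign = true) (h₁' : z'.isSign = true)
    (h : Seg Letter.inner w (i + 1) u) (h' : Seg Letter.inner w (i' + 1) u) : i = i' := by
  rw [seg_iff] at h h'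
  rcases lt_trichotomy i i' with hlt | rfl | hlt
  · obtain ⟨a, ha, hp⟩ := h.2.2 i' (by omega) (by omega)
    rw [hz', Option.some.injEq] at ha
    rw [← ha, Letter.not_inner_of_isSign h₁'] at hp
    exact absurd hp (by simp)
  · rfl
  · obtain ⟨a, ha, hp⟩ := h'.2.2 i (by omega) (by omega)
    rw [hz, Option.some.injEq] at ha
    rw [← ha, Letter.not_inner_of_isSign h₁] at hp
    exact absurd hp (by simp)

theorem takeWhile_drop {p : Letter → Bool} {w : List Letter} {i : ℕ} {a : Letter}
    (h : w[i]? = some a) (ha : p a = true) :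
    (w.drop i).takeWhile p = a :: (w.drop (i + 1)).takeWhile p := by
  rw [drop_eq_cons_of_getElem? h, List.takeWhile_cons, if_pos ha]

theorem takeWhile_drop_eq_nil {p : Letter → Bool} {w : List Letter} {i : ℕ}
    (h : w[i]?.any p = false) : (w.drop i).takeWhile p = [] := by
  refine Stops.takeWhile fun a ha => ?_
  rw [List.head?_drop] at ha
  rw [ha] at h
  exact h

/-- The nesting depth at the position `u` within a literal is `d`. -/
def DepthAt (w : List Letter) (u d : ℕ) : Prop :=
  ∃ i z x, w[i]? = some z ∧ z.isSign = true ∧ w.drop (i + 1) = x ++ w.drop u ∧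
    i + 1 + x.length = u ∧ u ≤ w.length ∧ (∀ a ∈ x, a.inner = true) ∧
    x.foldl depthStep (some 0) = some d

theorem DepthAt.succ {w : List Letter} {u d e : ℕ} {a : Letter} (h : DepthAt w u d)
    (ha : w[u]? = some a) (hi : a.inner = true) (he : depthStep (some d) a = some e) :
    DepthAt w (u + 1) e := by
  obtain ⟨i, z, x, hz, hs, hx, hu, -, hx', hd⟩ := h
  refine ⟨i, z, x ++ [a], hz, hs, by rw [hx, drop_eq_cons_of_getElem? ha]; simp,
    by simp; omega, (List.getElem?_eq_some_iff.1 ha).1, ?_, by simp [hd, he]⟩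
  intro b hb
  rcases List.mem_append.1 hb with hb | hb
  · exact hx' b hb
  · rw [List.mem_singleton] at hb
    rwa [hb]

theorem le_of_depthStep {a : Letter} {d e : ℕ} (h : depthStep (some d) a = some e) :
    e ≤ d + 1 := by
  cases a <;> simp only [depthStep, Option.some.injEq] at h <;> try omega
  cases d <;> simp at h
  omega

theorem depthStep_none (a : Letter) : depthStep none a = none := by
  cases a <;> rfl

/-- Rule variables range over positions only; this bound allows depths to be stored as positions. -/
theorem DepthAt.le {w : List Letter} {u d : ℕ} (h : DepthAt w u d) : d ≤ u := by
  obtain ⟨i, z, x, -, -, -, hu, -, -, hd⟩ := h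
  suffices ∀ x : List Letter, ∀ d, x.foldl depthStep (some 0) = some d → d ≤ x.length by
    have := this x d hd
    omega
  intro x
  induction x using List.reverseRecOn with
  | nil => simp
  | append_singleton x a ih =>
    intro d hd
    rw [List.foldl_append, List.foldl_cons, List.foldl_nil] at hd
    cases h : x.foldl depthStep (some 0) with
    | none => rw [h, depthStep_none] at hd; simp at hd
    | some e =>
      have := ih e h
      rw [h] at hd
      have := le_of_depthStep hd
      simp
      omega

theorem DepthAt.induct {w : List Letter} {P : ℕ → ℕ → Prop}
    (h₀ : ∀ i z, w[i]? = some z → z.isSign = true → P (i + 1) 0)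
    (h₁ : ∀ u a d e, w[u]? = some a → a.inner = true → depthStep (some d) a = some e → d ≤ u →
      P u d → P (u + 1) e) {u d : ℕ} (h : DepthAt w u d) : P u d := by
  obtain ⟨i, z, x, hz, hs, hx, hu, hu', hx', hd⟩ := h
  induction x using List.reverseRecOn generalizing u d with
  | nil =>
    simp only [List.foldl_nil, Option.some.injEq, List.length_nil] at hd hu
    subst hd
    exact hu ▸ h₀ i z hz hs
  | append_singleton x a ih =>
    rw [List.foldl_append, List.foldl_cons, List.foldl_nil] at hd
    simp only [List.length_append, List.length_singleton] at hu
    obtain rfl : u = (i + 1 + x.length) + 1 := by omega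
    have h₂ : w.drop (i + 1 + x.length) = a :: w.drop (i + 1 + x.length + 1) := by
      refine drop_of_drop_eq_append ?_
      rw [hx]; simp
    have hx₁ : ∀ b ∈ x, b.inner = true := fun b hb => hx' b (by simp [hb])
    cases h : x.foldl depthStep (some 0) with
    | none => rw [h, depthStep_none] at hd; simp at hd
    | some e =>
      rw [h] at hd
      have hx₂ : w.drop (i + 1) = x ++ w.drop (i + 1 + x.length) := by rw [hx, h₂]; simp
      exact h₁ _ a e d (getElem?_of_drop_eq_cons h₂).1 (hx' a (by simp)) hd
        (DepthAt.le ⟨i, z, x, hz, hs, hx₂, rfl, by omega, hx₁, h⟩)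
        (ih hx₂ rfl (by omega) hx₁ h)

/-! ### Propositional literals in words -/

/-- The literal `a` or its dual. -/
def PropLit.pol (a : PropLit) (s : Bool) : PropLit := if s then a else a.dual

/-- The word `w` contains the propositional literal `a` at the position `i`. -/
def LitAt (w : List Letter) (i : ℕ) (a : PropLit) : Prop :=
  ∃ r, w.drop i = encodePropLit a ++ r ∧ Stops Letter.isSym r

theorem LitAt.getElem? {w : List Letter} {i : ℕ} {a : PropLit} (h : LitAt w i a) :
    w[i]? = some (encodeSign a.sign) := by
  obtain ⟨r, h, -⟩ := h
  exact (getElem?_of_drop_eq_cons h).1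

theorem LitAt.lt {w : List Letter} {i : ℕ} {a : PropLit} (h : LitAt w i a) : i < w.length :=
  (List.getElem?_eq_some_iff.1 h.getElem?).1

theorem LitAt.takeWhile {w : List Letter} {i : ℕ} {a : PropLit} (h : LitAt w i a) :
    (w.drop (i + 1)).takeWhile Letter.isSym = encodeSymbol a.pvar.1 a.pvar.2 := by
  obtain ⟨r, h, hr⟩ := h
  rw [← (getElem?_of_drop_eq_cons h).2]
  exact takeWhile_append_of_all (fun _ => isSym_of_mem_encodeSymbol) hr

theorem LitAt.pvar_eq {w : List Letter} {i j : ℕ} {a b : PropLit} (ha : LitAt w i a)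
    (hb : LitAt w j b) (h : (w.drop (i + 1)).takeWhile Letter.isSym =
      (w.drop (j + 1)).takeWhile Letter.isSym) : a.pvar = b.pvar := by
  rw [ha.takeWhile, hb.takeWhile] at h
  obtain ⟨h₁, h₂⟩ := encodeSymbol_inj h
  exact Sigma.ext h₁ (heq_of_eq h₂)

/-- The polarity of a literal with the sign `c` that is equivalent to a literal with the sign `b`
and the polarity `t`. -/
def adjust (b c t : Bool) : Bool := if b = c then t else !t

theorem PropLit.pol_adjust {a b : PropLit} (h : a.pvar = b.pvar) (t : Bool) :
    b.pol (adjust a.sign b.sign t) = a.pol t := by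
  obtain ⟨s, p⟩ := a
  obtain ⟨s', p'⟩ := b
  obtain rfl : p = p' := h
  cases s <;> cases s' <;> cases t <;> rfl

theorem PropLit.pvar_pol (a : PropLit) (s : Bool) : (a.pol s).pvar = a.pvar := by
  cases s <;> rfl

theorem PropLit.pol_injective (a : PropLit) : Function.Injective a.pol := by
  obtain ⟨s, p⟩ := a
  intro t t'
  cases s <;> cases t <;> cases t' <;> simp [PropLit.pol, PropLit.dual]

theorem PropLit.pol_not (a : PropLit) (s : Bool) : a.pol (!s) = (a.pol s).dual := by
  cases s <;> simp [PropLit.pol, PropLit.dual_dual]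

/-! ### The rules -/

/-- The relations between positions of words. -/
inductive Rel
  | eqs
  | neq
  | noBrace
  | inner
  | depth
  | lt
  | cl (s t : Bool)
  | goal
  deriving DecidableEq, Fintype

/-- The term `x`. -/
def vr (x : Fin 6) : Tm (Fin 6) := ⟨some x, false⟩

/-- The term `x + 1`. -/
def sc (x : Fin 6) : Tm (Fin 6) := ⟨some x, true⟩

/-- The term `0`. -/
def zr : Tm (Fin 6) := ⟨none, false⟩

@[simp] theorem vr_eval (ρ : Fin 6 → ℕ) (x : Fin 6) : (vr x).eval ρ = ρ x := rfl

@[simp] theorem sc_eval (ρ : Fin 6 → ℕ) (x : Fin 6) : (sc x).eval ρ = ρ x + 1 := rfl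

@[simp] theorem zr_eval (ρ : Fin 6 → ℕ) : zr.eval ρ = 0 := rfl

/-- The names of the rules that do not depend on the problem. -/
inductive Common
  | eqsNil
  | eqsCons (a : Letter)
  | neqLeft (a : Letter)
  | neqRight (a : Letter)
  | neqCons (a : Letter)
  | noBraceNil
  | noBraceCons
  | innerNil
  | innerCons
  | depthNil
  | depthOpen
  | depthClose
  | depthCons
  | ltNil
  | ltCons
  | symm (s t : Bool)
  | res (s t u : Bool)
  | subst (s t b c : Bool)
  | goal
  deriving Fintype

/-- The test for the letter `a`. -/
def eqLetter (a : Letter) (o : Option Letter) : Bool := decide (o = some a)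

/-- The rules that do not depend on the problem. -/
def Common.rule : Common → Rule Rel (Fin 6)
  | eqsNil => ⟨[(0, fun o => !o.any Letter.isSym), (1, fun o => !o.any Letter.isSym)], [],
      ⟨.eqs, vr 0, vr 1⟩⟩
  | eqsCons a => ⟨[(0, eqLetter a), (1, eqLetter a)], [⟨.eqs, sc 0, sc 1⟩], ⟨.eqs, vr 0, vr 1⟩⟩
  | neqLeft a => ⟨[(0, fun o => eqLetter a o && a.inner), (1, fun o => !eqLetter a o)], [],
      ⟨.neq, vr 0, vr 1⟩⟩
  | neqRight a => ⟨[(0, fun o => !eqLetter a o), (1, fun o => eqLetter a o && a.inner)], [],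
      ⟨.neq, vr 0, vr 1⟩⟩
  | neqCons a => ⟨[(0, fun o => eqLetter a o && a.inner), (1, eqLetter a)],
      [⟨.neq, sc 0, sc 1⟩], ⟨.neq, vr 0, vr 1⟩⟩
  | noBraceNil => ⟨[], [], ⟨.noBrace, vr 0, vr 0⟩⟩
  | noBraceCons => ⟨[(1, fun o => o.any Letter.noBrace)], [⟨.noBrace, vr 0, vr 1⟩],
      ⟨.noBrace, vr 0, sc 1⟩⟩
  | innerNil => ⟨[], [], ⟨.inner, vr 0, vr 0⟩⟩
  | innerCons => ⟨[(1, fun o => o.any Letter.inner)], [⟨.inner, vr 0, vr 1⟩],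
      ⟨.inner, vr 0, sc 1⟩⟩
  | depthNil => ⟨[(0, fun o => o.any Letter.isSign)], [], ⟨.depth, sc 0, zr⟩⟩
  | depthOpen => ⟨[(0, eqLetter .lpar)], [⟨.depth, vr 0, vr 1⟩], ⟨.depth, sc 0, sc 1⟩⟩
  | depthClose => ⟨[(0, eqLetter .rpar)], [⟨.depth, vr 0, sc 1⟩], ⟨.depth, sc 0, vr 1⟩⟩
  | depthCons => ⟨[(0, fun o => o.any fun a => a.inner && a != .lpar && a != .rpar)],
      [⟨.depth, vr 0, vr 1⟩], ⟨.depth, sc 0, vr 1⟩⟩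
  | ltNil => ⟨[], [], ⟨.lt, vr 0, sc 0⟩⟩
  | ltCons => ⟨[], [⟨.lt, vr 0, vr 1⟩], ⟨.lt, vr 0, sc 1⟩⟩
  | symm s t => ⟨[], [⟨.cl s t, vr 0, vr 1⟩], ⟨.cl t s, vr 1, vr 0⟩⟩
  | res s t u => ⟨[], [⟨.cl s t, vr 0, vr 1⟩, ⟨.cl (!t) u, vr 1, vr 2⟩], ⟨.cl s u, vr 0, vr 2⟩⟩
  | subst s t b c => ⟨[(1, eqLetter (encodeSign b)), (2, eqLetter (encodeSign c))],
      [⟨.cl s t, vr 0, vr 1⟩, ⟨.eqs, sc 1, sc 2⟩], ⟨.cl s (adjust b c t), vr 0, vr 2⟩⟩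
  | goal => ⟨[], [⟨.cl true true, vr 0, vr 0⟩, ⟨.cl false false, vr 0, vr 0⟩],
      ⟨.goal, vr 0, vr 0⟩⟩

/-- The list of the rules that do not depend on the problem. -/
noncomputable def commonRules : List (Rule Rel (Fin 6)) :=
  (Finset.univ : Finset Common).toList.map Common.rule

theorem Common.rule_mem (c : Common) : c.rule ∈ commonRules :=
  List.mem_map_of_mem (by simp)

/-- The intended meaning of the relations, for a set `T` of propositional clauses. -/
def Spec (w : List Letter) (T : Set (Finset PropLit)) : Rel × ℕ × ℕ → Prop
  | (.eqs, i, j) => (w.drop i).takeWhile Letter.isSym = (w.drop j).takeWhile Letter.isSym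
  | (.neq, i, j) => (w.drop i).takeWhile Letter.inner ≠ (w.drop j).takeWhile Letter.inner
  | (.noBrace, i, j) => Seg Letter.noBrace w i j
  | (.inner, i, j) => Seg Letter.inner w i j
  | (.depth, u, d) => DepthAt w u d
  | (.lt, i, j) => i < j
  | (.cl s t, i, j) => ∃ a b, LitAt w i a ∧ LitAt w j b ∧ ∀ M : Set PredSym,
      (∀ C ∈ T, ∃ l ∈ C, l.Holds M) → (a.pol s).Holds M ∨ (b.pol t).Holds M
  | (.goal, _, _) => ¬ PropSatisfiable T

theorem LitAt.unique {w : List Letter} {i : ℕ} {a b : PropLit} (ha : LitAt w i a)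
    (hb : LitAt w i b) : a = b := by
  have h₁ := ha.pvar_eq hb rfl
  have h₂ := ha.getElem?
  rw [hb.getElem?, Option.some.injEq] at h₂
  have h₃ := encodeSign_injective h₂
  obtain ⟨s, p⟩ := a
  obtain ⟨s', p'⟩ := b
  simp_all

/-- Clause facts mean entailment by `T`, which `symm`, `res` and `subst` preserve. The hypothesis
`hw` is needed for `subst`, where a sign at the new position must be known to begin a literal. -/
theorem Common.sound {w : List Letter} {T : Set (Finset PropLit)}
    (hw : ∀ i z, w[i]? = some z → z.isSign = true → ∃ a, LitAt w i a) (c : Common) :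
    c.rule.Sound w (Spec w T) := by
  intro ρ hρ
  cases c <;> simp only [Common.rule, List.forall_mem_cons, List.not_mem_nil, false_imp_iff,
    implies_true, and_true, true_imp_iff, Atom.eval, vr_eval, sc_eval, zr_eval, eqLetter,
    decide_eq_true_eq, Bool.not_eq_true', Bool.and_eq_true, decide_eq_false_iff_not,
    Option.any_eq_true, and_imp, Spec]
  case eqsNil => 
    intro h h'
    rw [takeWhile_drop_eq_nil h, takeWhile_drop_eq_nil h']
  case eqsCons a =>
    intro h h' e
    rw [drop_eq_cons_of_getElem? h, drop_eq_cons_of_getElem? h', List.takeWhile_cons,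
      List.takeWhile_cons, e]
  case neqLeft a =>
    intro h ha h' e
    rw [takeWhile_drop h ha] at e
    refine h' ?_
    rw [← List.head?_drop]
    cases hd : w.drop (ρ 1) with
    | nil => rw [hd] at e; simp at e
    | cons b y =>
      rw [hd, List.takeWhile_cons] at e
      split_ifs at e
      rw [(List.cons.inj e).1]
      rfl
  case neqRight a =>
    intro h' h ha e
    rw [takeWhile_drop h ha] at e
    refine h' ?_
    rw [← List.head?_drop]
    cases hd : w.drop (ρ 0) with
    | nil => rw [hd] at e; simp at e
    | cons b y =>
      rw [hd, List.takeWhile_cons] at e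
      split_ifs at e
      rw [(List.cons.inj e).1]
      rfl
  case neqCons a =>
    intro h ha h' hn e
    rw [takeWhile_drop h ha, takeWhile_drop h' ha] at e
    exact hn (List.cons.inj e).2
  case noBraceNil => exact Seg.refl (hρ 0)
  case innerNil => exact Seg.refl (hρ 0)
  case noBraceCons =>
    rintro ⟨a, ha, hp⟩ h
    exact h.succ ha hp
  case innerCons =>
    rintro ⟨a, ha, hp⟩ h
    exact h.succ ha hp
  case depthNil =>
    rintro ⟨a, ha, hp⟩
    exact ⟨ρ 0, a, [], ha, hp, rfl, rfl, (List.getElem?_eq_some_iff.1 ha).1, by simp, rfl⟩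
  case depthOpen => exact fun ha h => h.succ ha rfl rfl
  case depthClose => exact fun ha h => h.succ ha rfl rfl
  case depthCons =>
    rintro ⟨a, ha, hp⟩ h
    simp only [bne_iff_ne, ne_eq] at hp
    refine h.succ ha hp.1.1 ?_
    cases a <;> simp_all [depthStep]
  case ltNil => omega
  case ltCons => omega
  case symm s t =>
    rintro ⟨a, b, ha, hb, h⟩
    exact ⟨b, a, hb, ha, fun M hM => (h M hM).symm⟩
  case res s t u =>
    rintro ⟨a, b, ha, hb, h⟩ ⟨b', c, hb', hc, h'⟩
    obtain rfl := hb.unique hb'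
    refine ⟨a, c, ha, hc, fun M hM => ?_⟩
    have h₁ := h M hM
    have h₂ := h' M hM
    rw [PropLit.pol_not, PropLit.dual_holds] at h₂
    tauto
  case subst s t b c =>
    rintro hj hk ⟨a, b', ha, hb', h⟩ e
    obtain ⟨c', hc'⟩ := hw _ _ hk (Letter.isSign_iff.2 ⟨_, rfl⟩)
    refine ⟨a, c', ha, hc', fun M hM => ?_⟩
    rw [hb'.getElem?, Option.some.injEq] at hj
    rw [hc'.getElem?, Option.some.injEq] at hk
    rw [← encodeSign_injective hj, ← encodeSign_injective hk,
      PropLit.pol_adjust (hb'.pvar_eq hc' e)]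
    exact h M hM
  case goal =>
    rintro ⟨a, b, ha, hb, h⟩ ⟨a', b', ha', hb', h'⟩ ⟨M, hM⟩
    obtain rfl := ha.unique hb
    obtain rfl := ha.unique ha'
    obtain rfl := ha.unique hb'
    have h₁ := h M hM
    have h₂ := h' M hM
    simp only [PropLit.pol, if_true, Bool.false_eq_true, if_false, PropLit.dual_holds] at h₁ h₂
    tauto

/-! ### Completeness of the rules -/

/-- An assignment of positions to the variables of rules. -/
def asg (a b c d e f : ℕ) : Fin 6 → ℕ := ![a, b, c, d, e, f]

theorem asg_le {n a b c d e f : ℕ} (ha : a ≤ n) (hb : b ≤ n) (hc : c ≤ n) (hd : d ≤ n)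
    (he : e ≤ n) (hf : f ≤ n) (x : Fin 6) : asg a b c d e f x ≤ n := by
  fin_cases x <;> assumption

section Complete

variable {R : List (Rule Rel (Fin 6))} {w : List Letter}

/-- These rules mention only the variables `0`, `1` and `2`; the other three get the dummy value
`0`. -/
theorem Common.der (hR : ∀ c : Common, c.rule ∈ R)
    (c : Common) {i j k : ℕ} (hi : i ≤ w.length) (hj : j ≤ w.length)
    (hk : k ≤ w.length)
    (hg : ∀ g ∈ c.rule.guards, g.2 w[asg i j k 0 0 0 g.1]? = true)
    (hb : ∀ a ∈ c.rule.body, Der R w (a.eval (asg i j k 0 0 0))) :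
    Der R w (c.rule.head.eval (asg i j k 0 0 0)) :=
  .intro _ (hR c) _ (asg_le hi hj hk (Nat.zero_le _) (Nat.zero_le _) (Nat.zero_le _)) hg hb

theorem der_noBrace (hR : ∀ c : Common, c.rule ∈ R)
    {i j : ℕ} (h : Seg Letter.noBrace w i j) : Der R w (.noBrace, i, j) := by
  have hi : i ≤ w.length := by
    have := seg_iff.1 h
    omega
  refine h.induct (P := fun j => Der R w (.noBrace, i, j)) ?_ ?_
  · exact Common.der hR .noBraceNil hi hi hi (by simp [Common.rule]) (by simp [Common.rule])
  · intro k a hk ha hp ih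
    refine Common.der hR .noBraceCons hi hk.le hi ?_ ?_
    · simp [Common.rule, asg, ha, hp]
    · simpa [Common.rule, asg, Atom.eval] using ih

theorem der_inner (hR : ∀ c : Common, c.rule ∈ R)
    {i j : ℕ} (h : Seg Letter.inner w i j) : Der R w (.inner, i, j) := by
  have hi : i ≤ w.length := by
    have := seg_iff.1 h
    omega
  refine h.induct (P := fun j => Der R w (.inner, i, j)) ?_ ?_
  · exact Common.der hR .innerNil hi hi hi (by simp [Common.rule]) (by simp [Common.rule])
  · intro k a hk ha hp ih
    refine Common.der hR .innerCons hi hk.le hi ?_ ?_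
    · simp [Common.rule, asg, ha, hp]
    · simpa [Common.rule, asg, Atom.eval] using ih

theorem der_eqs (hR : ∀ c : Common, c.rule ∈ R)
    {i j : ℕ} (hi : i ≤ w.length) (hj : j ≤ w.length)
    (h : (w.drop i).takeWhile Letter.isSym = (w.drop j).takeWhile Letter.isSym) :
    Der R w (.eqs, i, j) := by
  induction hn : (w.drop i).takeWhile Letter.isSym generalizing i j with
  | nil =>
    have h₁ : ∀ k, (w.drop k).takeWhile Letter.isSym = [] → w[k]?.any Letter.isSym = false := by
      intro k hk
      cases ha : w[k]? with
      | none => rfl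
      | some a =>
        by_contra hp
        simp only [Option.any_some, Bool.not_eq_false] at hp
        rw [takeWhile_drop ha hp] at hk
        simp at hk
    refine Common.der hR .eqsNil hi hj hi ?_ (by simp [Common.rule])
    simp [Common.rule, asg, h₁ i hn, h₁ j (h ▸ hn)]
  | cons a y ih =>
    have h₁ : ∀ k, (w.drop k).takeWhile Letter.isSym = a :: y →
        w[k]? = some a ∧ (w.drop (k + 1)).takeWhile Letter.isSym = y ∧ k < w.length := by
      intro k hk
      cases hd : w.drop k with
      | nil => rw [hd] at hk; simp at hk
      | cons b z =>
        obtain ⟨h₁, h₂⟩ := getElem?_of_drop_eq_cons hd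
        rw [hd, List.takeWhile_cons] at hk
        split_ifs at hk
        obtain ⟨rfl, h₃⟩ := List.cons.inj hk
        exact ⟨h₁, h₂ ▸ h₃, lt_length_of_drop_eq_cons hd⟩
    obtain ⟨hi₁, hi₂, hi₃⟩ := h₁ i hn
    obtain ⟨hj₁, hj₂, hj₃⟩ := h₁ j (h ▸ hn)
    refine Common.der hR (.eqsCons a) hi hj hi ?_ ?_
    · simp [Common.rule, asg, eqLetter, hi₁, hj₁]
    · simpa [Common.rule, asg, Atom.eval] using ih hi₃ hj₃ (hi₂.trans hj₂.symm) hi₂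

/-- Two different maximal runs of inner letters agree for a while, after which one has an inner
letter that the other does not have at the same place, be it that the letters differ or that the
other run has ended. The distance to the end of the word decreases. -/
theorem der_neq (hR : ∀ c : Common, c.rule ∈ R)
    {i j : ℕ} (hi : i ≤ w.length) (hj : j ≤ w.length)
    (h : (w.drop i).takeWhile Letter.inner ≠ (w.drop j).takeWhile Letter.inner) :
    Der R w (.neq, i, j) := by
  induction hn : w.length - i using Nat.strong_induction_on generalizing i j with
  | _ n ih =>
    have left : ∀ a, w[i]? = some a → a.inner = true → w[j]? ≠ some a →
        Der R w (.neq, i, j) := by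
      intro a h₁ h₂ h₃
      refine Common.der hR (.neqLeft a) hi hj hi ?_ (by simp [Common.rule])
      simp [Common.rule, asg, eqLetter, h₁, h₂, h₃]
    have right : ∀ a, w[i]? ≠ some a → a.inner = true → w[j]? = some a →
        Der R w (.neq, i, j) := by
      intro a h₁ h₂ h₃
      refine Common.der hR (.neqRight a) hi hj hi ?_ (by simp [Common.rule])
      simp [Common.rule, asg, eqLetter, h₁, h₂, h₃]
    by_cases h₁ : w[i]?.any Letter.inner = true
    · obtain ⟨a, ha, ha'⟩ := (Option.any_eq_true _ _).1 h₁
      by_cases hb : w[j]? = some a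
      · have hi' := (List.getElem?_eq_some_iff.1 ha).1
        refine Common.der hR (.neqCons a) hi hj hi ?_ ?_
        · simp [Common.rule, asg, eqLetter, ha, ha', hb]
        · rw [takeWhile_drop ha ha', takeWhile_drop hb ha'] at h
          have := ih _ (by omega) hi' (List.getElem?_eq_some_iff.1 hb).1
            (fun e => h (by rw [e])) rfl
          simpa [Common.rule, asg, Atom.eval] using this
      · exact left a ha ha' hb
    · rw [Bool.not_eq_true] at h₁
      by_cases h₂ : w[j]?.any Letter.inner = true
      · obtain ⟨b, hb, hb'⟩ := (Option.any_eq_true _ _).1 h₂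
        refine right b (fun ha => ?_) hb' hb
        rw [ha] at h₁
        simp [hb'] at h₁
      · rw [Bool.not_eq_true] at h₂
        exact absurd (by rw [takeWhile_drop_eq_nil h₁, takeWhile_drop_eq_nil h₂]) h

theorem der_depth (hR : ∀ c : Common, c.rule ∈ R)
    {u d : ℕ} (h : DepthAt w u d) : Der R w (.depth, u, d) := by
  refine h.induct (P := fun u d => Der R w (.depth, u, d)) ?_ ?_
  · intro i z hi hz
    have := (List.getElem?_eq_some_iff.1 hi).1.le
    refine Common.der hR .depthNil this this this ?_ (by simp [Common.rule])
    simp [Common.rule, asg, hi, hz]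
  · intro u a d e hu ha he hd ih
    have hu' := (List.getElem?_eq_some_iff.1 hu).1.le
    have hd' := hd.trans hu'
    by_cases h₁ : a = .lpar
    · subst h₁
      obtain rfl : d + 1 = e := Option.some.inj he
      refine Common.der hR .depthOpen hu' hd' hu' ?_ ?_
      · simp [Common.rule, asg, eqLetter, hu]
      · simpa [Common.rule, asg, Atom.eval] using ih
    by_cases h₂ : a = .rpar
    · subst h₂
      cases d with
      | zero => simp [depthStep] at he
      | succ d =>
        obtain rfl : d = e := Option.some.inj he
        refine Common.der hR .depthClose hu' (d.le_succ.trans hd') hu' ?_ ?_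
        · simp [Common.rule, asg, eqLetter, hu]
        · simpa [Common.rule, asg, Atom.eval] using ih
    obtain rfl : d = e := by cases a <;> simp_all [depthStep]
    refine Common.der hR .depthCons hu' hd' hu' ?_ ?_
    · simp [Common.rule, asg, hu, ha, h₁, h₂]
    · simpa [Common.rule, asg, Atom.eval] using ih

theorem der_lt (hR : ∀ c : Common, c.rule ∈ R)
    {i j : ℕ} (h : i < j) (hj : j ≤ w.length) : Der R w (.lt, i, j) := by
  have hi : i ≤ w.length := by omega
  induction j, h using Nat.le_induction with
  | base => exact Common.der hR .ltNil hi hi hi (by simp [Common.rule]) (by simp [Common.rule])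
  | succ j h ih =>
    refine Common.der hR .ltCons hi (j.le_succ.trans hj) hi (by simp [Common.rule]) ?_
    simpa [Common.rule, asg, Atom.eval] using ih (by omega)

theorem der_symm (hR : ∀ c : Common, c.rule ∈ R)
    {i j : ℕ} {s t : Bool} (hi : i ≤ w.length) (hj : j ≤ w.length)
    (h : Der R w (.cl s t, i, j)) : Der R w (.cl t s, j, i) := by
  refine Common.der hR (.symm s t) hi hj hi (by simp [Common.rule]) ?_
  simpa [Common.rule, asg, Atom.eval] using h

theorem der_subst (hR : ∀ c : Common, c.rule ∈ R)
    {i j k : ℕ} {s t t' : Bool} {b c : PropLit} (hi : i ≤ w.length)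
    (h : Der R w (.cl s t, i, j)) (hj : LitAt w j b) (hk : LitAt w k c)
    (e : b.pol t = c.pol t') : Der R w (.cl s t', i, k) := by
  have hv : b.pvar = c.pvar := by rw [← b.pvar_pol t, e, PropLit.pvar_pol]
  obtain rfl : adjust b.sign c.sign t = t' :=
    c.pol_injective (by rw [PropLit.pol_adjust hv, e])
  refine Common.der hR (.subst s t b.sign c.sign) hi hj.lt.le hk.lt.le ?_ ?_
  · simp [Common.rule, asg, eqLetter, hj.getElem?, hk.getElem?]
  · have := der_eqs hR (w := w) (i := j + 1) (j := k + 1) hj.lt hk.lt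
      (by rw [hj.takeWhile, hk.takeWhile, hv])
    simpa [Common.rule, asg, Atom.eval] using ⟨h, this⟩

/-- If the goal is not derivable, then the represented clauses have a model. -/
theorem propSatisfiable_of_not_der (hR : ∀ c : Common, c.rule ∈ R)
    {T : Set (Finset PropLit)}
    (hT : ∀ C ∈ T, (∃ i, Der R w (.goal, i, i)) ∨ ∃ a b i j s t, LitAt w i a ∧ LitAt w j b ∧
      a.pol s ∈ C ∧ b.pol t ∈ C ∧ Der R w (.cl s t, i, j))
    (h : ∀ i j, ¬ Der R w (.goal, i, j)) : PropSatisfiable T := by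
  -- The relation forgets where the literals are written: a clause counts as derived if it is
  -- derived for some occurrences.
  refine (exists_model (R := fun a b => ∃ a' b' i j s t, LitAt w i a' ∧ LitAt w j b' ∧
      a'.pol s = a ∧ b'.pol t = b ∧ Der R w (.cl s t, i, j)) ?_ ?_ ?_).elim fun M hM => ?_
  · rintro _ _ ⟨a, b, i, j, s, t, ha, hb, rfl, rfl, hd⟩
    exact ⟨b, a, j, i, t, s, hb, ha, rfl, rfl, der_symm hR ha.lt.le hb.lt.le hd⟩
  · rintro _ _ _ ⟨a, b, i, j, s, t, ha, hb, rfl, rfl, hd⟩ ⟨b', c, k, l, s', t', hb', hc, e, rfl, hd'⟩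
    -- The rule `res` resolves only upon one common position, so the first clause is moved to the
    -- occurrence used by the second.
    have h₁ : Der R w (.cl s (!s'), i, k) := der_subst hR ha.lt.le hd hb hb'
      (by rw [PropLit.pol_not, e, PropLit.dual_dual])
    refine ⟨a, c, i, l, s, t', ha, hc, rfl, rfl, ?_⟩
    refine Common.der hR (.res s (!s') t') ha.lt.le hb'.lt.le hc.lt.le (by simp [Common.rule]) ?_
    simpa [Common.rule, asg, Atom.eval] using ⟨h₁, hd'⟩
  · rintro _ ⟨a, b, i, j, s, t, ha, hb, rfl, e, hd⟩ ⟨a', b', k, l, s', t', ha', hb', e₁, e₂, hd'⟩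
    -- Both units may involve several positions; they are transported to `i`, where `goal` can
    -- combine them.
    have h₁ : Der R w (.cl s s, i, i) := der_subst hR ha.lt.le hd hb ha e
    have h₂ : Der R w (.cl s' (!s), k, i) := der_subst hR ha'.lt.le hd' hb' ha
      (by rw [PropLit.pol_not, e₂])
    have h₃ : Der R w (.cl (!s) (!s), i, i) :=
      der_subst hR ha.lt.le (der_symm hR ha'.lt.le ha.lt.le h₂) ha' ha (by rw [PropLit.pol_not, e₁])
    refine h i i (Common.der hR .goal ha.lt.le ha.lt.le ha.lt.le (by simp [Common.rule]) ?_)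
    cases s
    · simpa [Common.rule, asg, Atom.eval] using ⟨h₃, h₁⟩
    · simpa [Common.rule, asg, Atom.eval] using ⟨h₁, h₃⟩
  · refine ⟨M, fun C hC => ?_⟩
    rcases hT C hC with ⟨i, hi⟩ | ⟨a, b, i, j, s, t, ha, hb, ha', hb', hd⟩
    · exact absurd hi (h i i)
    · rcases hM _ _ ⟨a, b, i, j, s, t, ha, hb, rfl, rfl, hd⟩ with h' | h'
      · exact ⟨_, ha', h'⟩
      · exact ⟨_, hb', h'⟩

end Complete

/-- Satisfiability is decidable in polynomial time if the clauses can be read off by rules. -/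
theorem decidableInPolyTime_of_rules {α : Type} {e : α → List Letter}
    {T : α → Set (Finset PropLit)} (base : List (Rule Rel (Fin 6)))
    (hw : ∀ a i z, (e a)[i]? = some z → z.isSign = true → ∃ l, LitAt (e a) i l)
    (hs : ∀ a, ∀ r ∈ base, r.Sound (e a) (Spec (e a) (T a)))
    (hc : ∀ R : List (Rule Rel (Fin 6)), (∀ c : Common, c.rule ∈ R) → (∀ r ∈ base, r ∈ R) →
      ∀ a, ∀ C ∈ T a, (∃ i, Der R (e a) (.goal, i, i)) ∨ ∃ l k i j s t, LitAt (e a) i l ∧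
        LitAt (e a) j k ∧ l.pol s ∈ C ∧ k.pol t ∈ C ∧ Der R (e a) (.cl s t, i, j)) :
    DecidableInPolyTime e fun a => PropSatisfiable (T a) := by
  refine Datalog.decidableInPolyTime (commonRules ++ base) .goal fun a => ⟨fun h x y hd => ?_,
    fun h => ?_⟩
  · refine Der.of_sound (P := Spec (e a) (T a)) (fun r hr => ?_) hd h
    rcases List.mem_append.1 hr with hr | hr
    · obtain ⟨c, -, rfl⟩ := List.mem_map.1 hr
      exact c.sound (hw a)
    · exact hs a r hr
  · have hR : ∀ c : Common, c.rule ∈ commonRules ++ base :=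
      fun c => List.mem_append_left _ c.rule_mem
    exact propSatisfiable_of_not_der hR
      (hc _ hR (fun r hr => List.mem_append_right _ hr) a) h

end OccRen

namespace OccRen

open FirstOrder Datalog

/-! ### Krom clauses -/

theorem Stops.mono {p q : Letter → Bool} (h : ∀ a, p a = true → q a = true) {l : List Letter}
    (hl : Stops q l) : Stops p l := by
  intro a ha
  have h₁ := hl a ha
  have h₂ := h a
  cases hp : p a
  · rfl
  · rw [h₂ hp] at h₁
    exact h₁

section Blocks

variable {α : Type} {enc : α → List Letter} {sgn : α → Bool} {body : α → List Letter}

theorem SignedEncoding.stops (he : SignedEncoding enc sgn body) (C : List α) (r : List Letter) :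
    Stops Letter.inner (C.flatMap enc ++ Letter.rbrace :: r) := by
  cases C with
  | nil => exact stops_cons rfl
  | cons c C =>
    rw [List.flatMap_cons, he.eq, List.cons_append, List.cons_append]
    exact stops_cons (Letter.not_inner_of_isSign (Letter.isSign_iff.2 ⟨_, rfl⟩))

/-- If only inner letters precede the end of a block, then the block ends. -/
theorem SignedEncoding.eq_nil_of_stops (he : SignedEncoding enc sgn body) {C : List α}
    {x y r s : List Letter} (hx : ∀ a ∈ x, a.inner = true) (hy : ∀ a ∈ y, a.inner = true)
    (h : x ++ (C.flatMap enc ++ Letter.rbrace :: r) = y ++ Letter.rbrace :: s) : C = [] := by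
  have h₁ := (append_inj_of_stops hx hy (he.stops C r) (stops_cons rfl) h).2
  cases C with
  | nil => rfl
  | cons c C =>
    rw [List.flatMap_cons, he.eq, List.cons_append, List.cons_append] at h₁
    have h₂ := (List.cons.inj h₁).1
    exact absurd h₂ (by cases sgn c <;> simp [encodeSign])

theorem SignedEncoding.exists_block_of_lbrace (he : SignedEncoding enc sgn body)
    {S : List (List α)} {p : ℕ} (h : (encodeBlocks enc S)[p]? = some Letter.lbrace) :
    ∃ C ∈ S, ∃ r, (encodeBlocks enc S).drop (p + 1) = C.flatMap enc ++ Letter.rbrace :: r := by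
  have h₁ : encodeBlocks enc S = (encodeBlocks enc S).take p ++
      Letter.lbrace :: (encodeBlocks enc S).drop (p + 1) := by
    rw [← drop_eq_cons_of_getElem? h, List.take_append_drop]
  obtain ⟨S₁, C, S₂, x, y, hS, hC, -, h₂⟩ := flatMap_eq_append_cons h₁
  refine ⟨C, by simp [hS], S₂.flatMap fun C => Letter.lbrace :: C.flatMap enc ++ [Letter.rbrace],
    ?_⟩
  rw [h₂]
  cases x with
  | nil =>
    simp only [List.nil_append, List.cons_append, List.cons.injEq, true_and] at hC
    rw [← hC]
    simp
  | cons b x =>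
    simp only [List.cons_append, List.cons.injEq] at hC
    have h₃ : Letter.lbrace ∈ C.flatMap enc ++ [Letter.rbrace] := by simp [hC.2]
    rw [List.mem_append, List.mem_flatMap] at h₃
    rcases h₃ with ⟨c, -, hc⟩ | h₃
    · exact absurd (he.noBrace hc) (by simp [Letter.noBrace])
    · simp at h₃

end Blocks

theorem signedEncoding_encodePropLit : SignedEncoding encodePropLit PropLit.sign
    fun l => encodeSymbol l.pvar.1 l.pvar.2 where
  eq _ := rfl
  inner _ _ h := Letter.inner_of_isSym (isSym_of_mem_encodeSymbol h)

theorem litAt_of_drop {w r : List Letter} {i : ℕ} {l : PropLit} (C : List PropLit)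
    (h : w.drop i = encodePropLit l ++ (C.flatMap encodePropLit ++ Letter.rbrace :: r)) :
    LitAt w i l :=
  ⟨_, h, (signedEncoding_encodePropLit.stops C r).mono fun _ => Letter.inner_of_isSym⟩

/-- The names of the rules that read Krom clauses. -/
inductive KromRule
  | clause
  | empty

/-- The rules that read Krom clauses. -/
def KromRule.rule : KromRule → Rule Rel (Fin 6)
  | clause => ⟨[(0, eqLetter .lbrace), (1, fun o => o.any Letter.isSign), (2, eqLetter .rbrace)],
      [⟨.noBrace, sc 0, vr 1⟩, ⟨.inner, sc 1, vr 2⟩], ⟨.cl true true, sc 0, vr 1⟩⟩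
  | empty => ⟨[(0, eqLetter .lbrace), (1, eqLetter .rbrace)], [⟨.inner, sc 0, vr 1⟩],
      ⟨.goal, vr 0, vr 0⟩⟩

/-- The rule `clause` links the first and the last literal of a block. With at most two literals
these are all of them; for a unit clause the two positions coincide. -/
theorem KromRule.sound (T : KromClauses) (k : KromRule) :
    k.rule.Sound (encodeKrom T) (Spec (encodeKrom T) (kromSetOf T)) := by
  have he := signedEncoding_encodePropLit
  intro ρ hρ
  cases k <;> simp only [KromRule.rule, List.forall_mem_cons, List.not_mem_nil, false_imp_iff,
    implies_true, and_true, Atom.eval, vr_eval, sc_eval, eqLetter, decide_eq_true_eq,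
    Option.any_eq_true, and_imp, Spec]
  case clause =>
    rintro hp ⟨z, hj, hz⟩ hq ⟨x, hx, hx', -, hxb⟩ ⟨y, hy, -, -, hyb⟩
    obtain ⟨C, hC, r, hr⟩ := he.exists_block_of_lbrace (S := T.1) hp
    change (encodeKrom T).drop _ = _ at hr
    have hj' := drop_eq_cons_of_getElem? hj
    rw [hr, hj'] at hx
    obtain ⟨C₁, l, C₂, rfl, rfl, h₁⟩ := he.split hxb hz hx
    rw [← hj'] at h₁
    -- Only inner letters separate this literal from the closing brace, so no further sign, hence no
    -- further literal, follows.
    obtain rfl : C₂ = [] := by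
      refine he.eq_nil_of_stops (he.inner l) hyb (r := r) (s := (encodeKrom T).drop (ρ 2 + 1)) ?_
      rw [← drop_eq_cons_of_getElem? hq, ← hy]
      exact (getElem?_of_drop_eq_cons h₁).2
    have hl := litAt_of_drop [] h₁
    have hlen := T.2 _ hC
    have hmem : (C₁ ++ [l]).toFinset ∈ kromSetOf T := ⟨_, hC, rfl⟩
    match C₁ with
    | [] =>
      refine ⟨l, l, ?_, hl, fun M hM => ?_⟩
      · rw [← hx'] at hl
        exact hl
      · obtain ⟨k, hk, hk'⟩ := hM _ hmem
        simp only [List.nil_append, List.toFinset_cons, List.toFinset_nil, insert_empty_eq,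
          Finset.mem_singleton] at hk
        exact .inl (hk ▸ hk')
    | [k] =>
      refine ⟨k, l, litAt_of_drop [l] (r := r) (by simpa using hr), hl, fun M hM => ?_⟩
      obtain ⟨k', hk, hk'⟩ := hM _ hmem
      simp only [List.cons_append, List.nil_append, List.toFinset_cons, List.toFinset_nil,
        insert_empty_eq, Finset.mem_insert, Finset.mem_singleton] at hk
      rcases hk with rfl | rfl
      · exact .inl hk'
      · exact .inr hk'
    | _ :: _ :: _ => simp at hlen
  case empty =>
    rintro hp hq ⟨y, hy, -, -, hyb⟩ ⟨M, hM⟩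
    obtain ⟨C, hC, r, hr⟩ := he.exists_block_of_lbrace (S := T.1) hp
    change (encodeKrom T).drop _ = _ at hr
    obtain rfl : C = [] := by
      refine he.eq_nil_of_stops (x := []) (by simp) hyb (r := r)
        (s := (encodeKrom T).drop (ρ 1 + 1)) ?_
      rw [← drop_eq_cons_of_getElem? hq, ← hy, hr]
      rfl
    obtain ⟨l, hl, -⟩ := hM _ ⟨[], hC, rfl⟩
    simp at hl

theorem decidableInPolyTime_krom :
    DecidableInPolyTime encodeKrom fun T : KromClauses => PropSatisfiable (kromSetOf T) := by
  have he := signedEncoding_encodePropLit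
  refine decidableInPolyTime_of_rules [KromRule.rule .clause, KromRule.rule .empty] ?_ ?_ ?_
  · intro T i z hi hz
    obtain ⟨C₁, l, C₂, -, r, hr⟩ := he.exists_itemAt hz hi
    exact ⟨l, litAt_of_drop C₂ hr⟩
  · simpa using fun T hT => ⟨KromRule.sound ⟨T, hT⟩ .clause, KromRule.sound ⟨T, hT⟩ .empty⟩
  · rintro R hR hb T _ ⟨C, hC, rfl⟩
    obtain ⟨p, r, hp, hpr⟩ := exists_block (enc := encodePropLit) hC
    change p < (encodeKrom T).length at hp
    change (encodeKrom T).drop p = _ at hpr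
    obtain ⟨hp₁, hp₂⟩ := getElem?_of_drop_eq_cons hpr
    rcases List.eq_nil_or_concat C with rfl | ⟨C₁, l, rfl⟩
    · have hq := (getElem?_of_drop_eq_cons hp₂.symm).1
      have hlt := (List.getElem?_eq_some_iff.1 hq).1
      refine .inl ⟨p, Der.intro (R := R) (KromRule.rule .empty) (hb _ (by simp))
        (asg p (p + 1) 0 0 0 0)
        (asg_le hp.le hlt.le (by simp) (by simp) (by simp) (by simp)) ?_ ?_⟩
      · simp [KromRule.rule, asg, eqLetter, hp₁, hq]
      · simpa [KromRule.rule, asg, Atom.eval] using der_inner hR (Seg.refl hlt.le)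
    · right
      rw [List.concat_eq_append] at *
      set j := p + 1 + (C₁.flatMap encodePropLit).length with hj
      have h₁ : (encodeKrom T).drop j = encodePropLit l ++ Letter.rbrace :: r :=
        drop_of_drop_eq_append (by rw [← hp₂]; simp)
      have hl := litAt_of_drop [] h₁
      obtain ⟨k, D, hD⟩ : ∃ k D, C₁ ++ [l] = k :: D := by
        cases C₁ with
        | nil => exact ⟨l, [], rfl⟩
        | cons k D => exact ⟨k, D ++ [l], rfl⟩
      have hk : LitAt (encodeKrom T) (p + 1) k := by
        refine litAt_of_drop D (r := r) ?_
        rw [← hp₂, hD]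
        simp
      refine ⟨k, l, p + 1, j, true, true, hk, hl, by simp [hD, PropLit.pol],
        by simp [PropLit.pol], ?_⟩
      have h₂ : (encodeKrom T).drop (j + 1) = encodeSymbol l.pvar.1 l.pvar.2 ++
          Letter.rbrace :: r := (getElem?_of_drop_eq_cons h₁).2.symm
      have h₃ := drop_of_drop_eq_append h₂
      have hs₁ : Seg Letter.noBrace (encodeKrom T) (p + 1) j := by
        refine Seg.of_append hp (y := encodePropLit l ++ Letter.rbrace :: r) ?_ ?_
        · rw [← hp₂]; simp
        · intro a ha
          obtain ⟨c, -, hc⟩ := List.mem_flatMap.1 ha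
          exact he.noBrace hc
      have hs₂ := Seg.of_append hl.lt h₂ (he.inner l)
      refine Der.intro (R := R) (KromRule.rule .clause) (hb _ (by simp)) (asg p j _ 0 0 0)
        (asg_le hp.le hl.lt.le (lt_length_of_drop_eq_cons h₃).le (by simp) (by simp) (by simp))
        ?_ ?_
      · simp [KromRule.rule, asg, eqLetter, hp₁, hl.getElem?, (getElem?_of_drop_eq_cons h₃).1,
          Letter.isSign_iff.2 ⟨l.sign, rfl⟩]
      · simpa [KromRule.rule, asg, Atom.eval] using ⟨der_noBrace hR hs₁, der_inner hR hs₂⟩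

end OccRen

namespace OccRen

open FirstOrder Datalog

/-! ### First-order literals in words -/

/-- The word `w` contains the literal `l` at the position `i`. -/
def LiteralAt (w : List Letter) (i : ℕ) (l : Literal) : Prop :=
  ∃ r, w.drop i = encodeLiteral l ++ r ∧ Stops Letter.inner r

theorem signedEncoding_encodeLiteral : SignedEncoding encodeLiteral Literal.sign encodeBody where
  eq := encodeLiteral_eq
  inner _ _ h := inner_of_mem_encodeBody h

theorem ItemAt.literalAt {S : List (List Literal)} {w : List Letter} {i : ℕ} {C₁ C₂ : List Literal}
    {l : Literal} (h : ItemAt encodeLiteral S w i C₁ l C₂) : LiteralAt w i l := by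
  obtain ⟨-, r, hr⟩ := h
  exact ⟨_, hr, signedEncoding_encodeLiteral.stops C₂ r⟩

theorem LiteralAt.litAt {w : List Letter} {i : ℕ} {l : Literal} (h : LiteralAt w i l) :
    LitAt w i (skel l) := by
  obtain ⟨r, hr, -⟩ := h
  refine ⟨Letter.lpar :: ((List.ofFn fun i => encodeTerm (l.args i) ++ [Letter.comma]).flatten ++
    Letter.rpar :: r), ?_, stops_cons rfl⟩
  rw [hr]
  simp [encodeLiteral, encodePropLit, skel]

theorem LiteralAt.drop_succ {w : List Letter} {i : ℕ} {l : Literal} (h : LiteralAt w i l) :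
    ∃ r, w.drop (i + 1) = encodeBody l ++ r ∧ Stops Letter.inner r := by
  obtain ⟨r, hr, hs⟩ := h
  rw [encodeLiteral_eq, List.cons_append] at hr
  exact ⟨r, (getElem?_of_drop_eq_cons hr).2.symm, hs⟩

theorem LiteralAt.isSign {w : List Letter} {i : ℕ} {l : Literal} (h : LiteralAt w i l) :
    w[i]?.any Letter.isSign = true := by
  rw [h.litAt.getElem?]
  exact Letter.isSign_iff.2 ⟨_, rfl⟩

theorem LiteralAt.takeWhile {w : List Letter} {i : ℕ} {l : Literal} (h : LiteralAt w i l) :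
    (w.drop (i + 1)).takeWhile Letter.inner = encodeBody l := by
  obtain ⟨r, hr, hs⟩ := h.drop_succ
  rw [hr, takeWhile_append_of_all (fun _ => inner_of_mem_encodeBody) hs]

/-- A segment of inner letters that begins in a maximal segment of inner letters stays in it. -/
theorem exists_split_of_seg {w y r : List Letter} {i u : ℕ} {a : Letter} (h : w.drop i = y ++ r)
    (hy : ∀ b ∈ y, b.inner = true) (hr : Stops Letter.inner r) (hs : Seg Letter.inner w i u)
    (ha : w[u]? = some a) (ha' : a.inner = true) : ∃ x z, y = x ++ a :: z ∧
      w.drop (u + 1) = z ++ r ∧ w.drop i = x ++ w.drop u ∧ i + x.length = u := by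
  obtain ⟨x, hx, hu, -, hx'⟩ := hs
  have h₁ : y = x ++ a :: (w.drop (u + 1)).takeWhile Letter.inner := by
    rw [← takeWhile_append_of_all hy hr, ← h, hx, List.takeWhile_append_of_pos hx',
      takeWhile_drop ha ha']
  refine ⟨x, _, h₁, ?_, hx, hu⟩
  rw [h₁, hx, drop_eq_cons_of_getElem? ha] at h
  simpa using h

theorem takeWhile_isSym_append {z r : List Letter} (hr : Stops Letter.inner r) :
    (z ++ r).takeWhile Letter.isSym = z.takeWhile Letter.isSym :=
  takeWhile_append_of_stops z (hr.mono fun _ => Letter.inner_of_isSym)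

/-- A derived depth at `u` is measured from some sign. Since only inner letters lie in between, it
is the sign of `l` itself, so the depth is the one in `l`. -/
theorem LiteralAt.mem_occs {w : List Letter} {i u : ℕ} {l : Literal} (h : LiteralAt w i l)
    (hs : Seg Letter.inner w (i + 1) u) (hu : w[u]? = some Letter.variable) :
    ∃ v e, (v, e) ∈ l.occs ∧ (w.drop (u + 1)).takeWhile Letter.isSym = encodeIndex v ∧
      ∀ d, DepthAt w u d → d = e := by
  obtain ⟨r, hr, hs'⟩ := h.drop_succ
  obtain ⟨x, z, hxz, hz, hx, -⟩ :=
    exists_split_of_seg hr (fun _ => inner_of_mem_encodeBody) hs' hs hu rfl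
  have hm : (z.takeWhile Letter.isSym, x.foldl depthStep (some 0)) ∈ l.occs.map scanEntry := by
    rw [← scan_encodeBody, mem_scan]
    exact ⟨x, z, hxz, rfl, rfl⟩
  obtain ⟨⟨v, e⟩, hv, hv'⟩ := List.mem_map.1 hm
  simp only [scanEntry, Prod.mk.injEq] at hv'
  refine ⟨v, e, hv, by rw [hz, takeWhile_isSym_append hs', hv'.1], ?_⟩
  rintro d ⟨i', z', x', hi', hz', hx', hu', hle, hin, hd⟩
  obtain rfl : i = i' := eq_of_seg h.litAt.getElem? hi' (Letter.isSign_iff.2 ⟨_, rfl⟩) hz' hs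
    ⟨x', hx', hu', hle, hin⟩
  rw [hx, List.append_cancel_right_eq] at hx'
  rw [hx', hd, Option.some.injEq] at hv'
  exact hv'.2.symm

theorem LiteralAt.exists_position {w : List Letter} {i v e : ℕ} {l : Literal}
    (h : LiteralAt w i l) (hv : (v, e) ∈ l.occs) : ∃ u, Seg Letter.inner w (i + 1) u ∧
      w[u]? = some Letter.variable ∧ (w.drop (u + 1)).takeWhile Letter.isSym = encodeIndex v ∧
      DepthAt w u e := by
  obtain ⟨r, hr, hs⟩ := h.drop_succ
  have hm := List.mem_map_of_mem (f := scanEntry) hv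
  rw [← scan_encodeBody, scanEntry, mem_scan] at hm
  obtain ⟨x, z, hxz, hd, hz⟩ := hm
  rw [hxz, List.append_assoc] at hr
  have hx : ∀ a ∈ x, a.inner = true := fun a ha =>
    inner_of_mem_encodeBody (l := l) (by simp [hxz, ha])
  have h₁ := drop_of_drop_eq_append hr
  obtain ⟨h₂, h₃⟩ := getElem?_of_drop_eq_cons h₁
  refine ⟨_, Seg.of_append h.litAt.lt hr hx, h₂, ?_, i, _, x, h.litAt.getElem?,
    Letter.isSign_iff.2 ⟨_, rfl⟩, by rw [h₁, hr], rfl, (List.getElem?_eq_some_iff.1 h₂).1.le, hx,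
    hd⟩
  rw [← h₃, hz]
  exact takeWhile_isSym_append hs

theorem LiteralAt.exists_one_lt_occ_iff {w : List Letter} {i : ℕ} {l : Literal}
    (h : LiteralAt w i l) : (∃ v, 1 < l.occ v) ↔ ∃ u v, Seg Letter.inner w (i + 1) u ∧
      w[u]? = some Letter.variable ∧ Seg Letter.inner w (u + 1) v ∧
      w[v]? = some Letter.variable ∧ (w.drop (u + 1)).takeWhile Letter.isSym =
        (w.drop (v + 1)).takeWhile Letter.isSym := by
  obtain ⟨r, hr, hs⟩ := h.drop_succ
  have hscan : ((scan (some 0) (encodeBody l)).map Prod.fst).Nodup ↔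
      (l.occs.map Prod.fst).Nodup := by
    rw [scan_encodeBody, List.map_map, ← List.nodup_map_iff encodeIndex_injective, List.map_map]
    rfl
  rw [OccRen.exists_one_lt_occ_iff, ← hscan, not_nodup_scan_iff]
  have hin : ∀ a ∈ encodeBody l, a.inner = true := fun _ => inner_of_mem_encodeBody
  constructor
  · rintro ⟨x, z, x', z', h₁, h₂, h₃⟩
    rw [h₁] at hin hr
    rw [List.append_assoc] at hr
    have hu := drop_of_drop_eq_append hr
    obtain ⟨hu₁, hu₂⟩ := getElem?_of_drop_eq_cons hu
    have hu₃ : w.drop (i + 1 + x.length + 1) = z ++ r := hu₂.symm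
    rw [h₂, List.append_assoc] at hu₃
    have hv := drop_of_drop_eq_append hu₃
    obtain ⟨hv₁, hv₂⟩ := getElem?_of_drop_eq_cons hv
    refine ⟨_, _, Seg.of_append h.litAt.lt hr fun a ha => hin a (by simp [ha]), hu₁,
      Seg.of_append (List.getElem?_eq_some_iff.1 hu₁).1 hu₃ fun a ha => hin a (by simp [h₂, ha]),
      hv₁, ?_⟩
    rw [← hu₂, ← hv₂]
    exact (takeWhile_isSym_append hs).trans (h₃.trans (takeWhile_isSym_append hs).symm)
  · rintro ⟨u, v, h₁, h₂, h₃, h₄, h₅⟩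
    obtain ⟨x, z, hxz, hz, -, -⟩ := exists_split_of_seg hr hin hs h₁ h₂ rfl
    obtain ⟨x', z', hxz', hz', -, -⟩ := exists_split_of_seg hz
      (fun b hb => hin b (by simp [hxz, hb])) hs h₃ h₄ rfl
    rw [hz, hz', takeWhile_isSym_append hs, takeWhile_isSym_append hs] at h₅
    exact ⟨x, z, x', z', hxz, hxz', h₅⟩

/-- The positions `i` and `j` lie in the same clause. -/
def SameBlock (w : List Letter) (i j : ℕ) : Prop :=
  Seg Letter.noBrace w i j ∨ Seg Letter.noBrace w j i

theorem literalAt_of_sameBlock {S : List (List Literal)} {i j : ℕ}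
    (hi : (encodeClauses S)[i]?.any Letter.isSign = true)
    (hj : (encodeClauses S)[j]?.any Letter.isSign = true) (h : SameBlock (encodeClauses S) i j) :
    ∃ C ∈ S, ∃ l ∈ C, ∃ k ∈ C, LiteralAt (encodeClauses S) i l ∧
      LiteralAt (encodeClauses S) j k := by
  have he := signedEncoding_encodeLiteral
  obtain ⟨a, hi, ha⟩ := (Option.any_eq_true _ _).1 hi
  obtain ⟨b, hj, hb⟩ := (Option.any_eq_true _ _).1 hj
  rcases h with h | h
  · obtain ⟨C₁, l, C₂, h₁⟩ := he.exists_itemAt ha hi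
    obtain ⟨D₁, k, D₂, h₂, e⟩ := he.itemAt_of_seg h₁ h hb hj
    exact ⟨_, h₁.1, l, by simp, k, by simp [← e], h₁.literalAt, h₂.literalAt⟩
  · obtain ⟨C₁, k, C₂, h₁⟩ := he.exists_itemAt hb hj
    obtain ⟨D₁, l, D₂, h₂, e⟩ := he.itemAt_of_seg h₁ h ha hi
    exact ⟨_, h₁.1, l, by simp [← e], k, by simp, h₂.literalAt, h₁.literalAt⟩

/-- The literals may be written in either order; the `swap` argument of the reading rules accounts
for this. -/
theorem exists_sameBlock {S : List (List Literal)} {C : List Literal} (hC : C ∈ S) {l k : Literal}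
    (hl : l ∈ C) (hk : k ∈ C) : ∃ i j, SameBlock (encodeClauses S) i j ∧
      LiteralAt (encodeClauses S) i l ∧ LiteralAt (encodeClauses S) j k := by
  have he := signedEncoding_encodeLiteral
  obtain ⟨p, r, hp, hr⟩ := exists_block (enc := encodeLiteral) hC
  change p < (encodeClauses S).length at hp
  change (encodeClauses S).drop p = _ at hr
  have hseg := Seg.of_append (p := Letter.noBrace) hp (getElem?_of_drop_eq_cons hr).2.symm
    fun a ha => by
      obtain ⟨c, -, hc⟩ := List.mem_flatMap.1 ha
      exact he.noBrace hc
  have hpos : ∀ m ∈ C, ∃ i, LiteralAt (encodeClauses S) i m ∧ p + 1 ≤ i ∧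
      i ≤ p + 1 + (C.flatMap encodeLiteral).length := by
    intro m hm
    obtain ⟨C₁, C₂, rfl⟩ := List.append_of_mem hm
    refine ⟨_, (itemAt_of_block hC hr).literalAt, by omega, ?_⟩
    simp
  obtain ⟨i, hi, hi₁, hi₂⟩ := hpos l hl
  obtain ⟨j, hj, hj₁, hj₂⟩ := hpos k hk
  refine ⟨i, j, ?_, hi, hj⟩
  rcases le_total i j with h | h
  · exact .inl (hseg.mono hi₁ h hj₂)
  · exact .inr (hseg.mono hj₁ h hi₂)

/-! ### Reading the clauses of `ren` -/

/-- The names of the rules that read the clauses of `ren`. -/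
inductive RenRule
  | unit
  | sign (swap b : Bool)
  | body (swap : Bool)
  | depth (swap : Bool)
  deriving Fintype

/-- The atom that states that two positions lie in the same clause. -/
def sameBlockAtom (swap : Bool) : Atom Rel (Fin 6) :=
  if swap then ⟨.noBrace, vr 1, vr 0⟩ else ⟨.noBrace, vr 0, vr 1⟩

/-- The guards that test for two occurrences of variables. -/
def varGuards : List (Fin 6 × (Option Letter → Bool)) :=
  [(2, eqLetter .variable), (3, eqLetter .variable)]

/-- The atoms that state that two literals of the same clause share a variable. -/
def pairAtoms (swap : Bool) : List (Atom Rel (Fin 6)) :=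
  [sameBlockAtom swap, ⟨.inner, sc 0, vr 2⟩, ⟨.inner, sc 1, vr 3⟩, ⟨.eqs, sc 2, sc 3⟩]

/-- The rules that read the clauses of `ren`. -/
def RenRule.rule : RenRule → Rule Rel (Fin 6)
  | unit => ⟨(0, fun o => o.any Letter.isSign) :: varGuards,
      [⟨.inner, sc 0, vr 2⟩, ⟨.inner, sc 2, vr 3⟩, ⟨.eqs, sc 2, sc 3⟩],
      ⟨.cl true true, vr 0, vr 0⟩⟩
  | sign swap b => ⟨(0, eqLetter (encodeSign b)) :: (1, eqLetter (encodeSign !b)) :: varGuards,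
      pairAtoms swap, ⟨.cl true true, vr 0, vr 1⟩⟩
  | body swap => ⟨(0, fun o => o.any Letter.isSign) :: (1, fun o => o.any Letter.isSign) ::
      varGuards, ⟨.neq, sc 0, sc 1⟩ :: pairAtoms swap, ⟨.cl true true, vr 0, vr 1⟩⟩
  | depth swap => ⟨(0, fun o => o.any Letter.isSign) :: (1, fun o => o.any Letter.isSign) ::
      varGuards, ⟨.depth, vr 2, vr 4⟩ :: ⟨.depth, vr 3, vr 5⟩ :: ⟨.lt, vr 5, vr 4⟩ ::
      pairAtoms swap, ⟨.cl true false, vr 0, vr 1⟩⟩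

/-- The meaning of `pairAtoms` and `varGuards`. -/
theorem exists_common_var {S : List (List Literal)} {i j u v : ℕ}
    (hi : (encodeClauses S)[i]?.any Letter.isSign = true)
    (hj : (encodeClauses S)[j]?.any Letter.isSign = true) (h : SameBlock (encodeClauses S) i j)
    (hu : (encodeClauses S)[u]? = some .variable) (hv : (encodeClauses S)[v]? = some .variable)
    (hiu : Seg Letter.inner (encodeClauses S) (i + 1) u)
    (hjv : Seg Letter.inner (encodeClauses S) (j + 1) v)
    (huv : ((encodeClauses S).drop (u + 1)).takeWhile Letter.isSym =
      ((encodeClauses S).drop (v + 1)).takeWhile Letter.isSym) :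
    ∃ C ∈ clauseSetOf S, ∃ l ∈ C, ∃ k ∈ C, LiteralAt (encodeClauses S) i l ∧
      LiteralAt (encodeClauses S) j k ∧ ∃ x d e, (x, d) ∈ l.occs ∧ (x, e) ∈ k.occs ∧
        (∀ d', DepthAt (encodeClauses S) u d' → d' = d) ∧
        ∀ e', DepthAt (encodeClauses S) v e' → e' = e := by
  obtain ⟨C, hC, l, hl, k, hk, hl', hk'⟩ := literalAt_of_sameBlock hi hj h
  obtain ⟨x, d, hx, hx', hd⟩ := hl'.mem_occs hiu hu
  obtain ⟨y, e, hy, hy', hd'⟩ := hk'.mem_occs hjv hv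
  rw [hx', hy'] at huv
  obtain rfl := encodeIndex_injective huv
  exact ⟨_, mem_clauseSetOf.2 ⟨C, hC, rfl⟩, l, by simpa using hl, k, by simpa using hk, hl', hk',
    x, d, e, hx, hy, hd, hd'⟩

theorem mem_ren_of_unit {S : ClauseSet} {C : Clause} (hC : C ∈ S) {l : Literal} (hl : l ∈ C)
    (h : ∃ v, 1 < l.occ v) : {skel l} ∈ ren S :=
  Set.mem_biUnion hC (.inl (.inl ⟨l, hl, h, rfl⟩))

theorem mem_ren_of_common_var {S : ClauseSet} {C : Clause} (hC : C ∈ S) {l k : Literal}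
    (hl : l ∈ C) (hk : k ∈ C) (h : l ≠ k) {x d e : ℕ} (hd : (x, d) ∈ l.occs)
    (he : (x, e) ∈ k.occs) : {skel l, skel k} ∈ ren S :=
  Set.mem_biUnion hC (.inl (.inr ⟨l, hl, k, hk, h, ⟨x, Finset.mem_inter.2
    ⟨Literal.mem_vars_iff.2 ⟨d, hd⟩, Literal.mem_vars_iff.2 ⟨e, he⟩⟩⟩, rfl⟩))

theorem mem_ren_of_depth {S : ClauseSet} {C : Clause} (hC : C ∈ S) {l k : Literal}
    (hl : l ∈ C) (hk : k ∈ C) {x d e : ℕ} (hd : (x, d) ∈ l.occs)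
    (he : (x, e) ∈ k.occs) (h : e < d) : {skel l, (skel k).dual} ∈ ren S :=
  Set.mem_biUnion hC (.inr ⟨l, hl, k, hk, exists_tmin_lt_tmax_iff.2 ⟨x, d, e, hd, he, h⟩, rfl⟩)

theorem holds_or_holds_of_mem {T : Set (Finset PropLit)} {a b : PropLit} (h : {a, b} ∈ T)
    {M : Set PredSym} (hM : ∀ C ∈ T, ∃ l ∈ C, l.Holds M) : a.Holds M ∨ b.Holds M := by
  obtain ⟨l, hl, hl'⟩ := hM _ h
  rw [Finset.mem_insert, Finset.mem_singleton] at hl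
  rcases hl with rfl | rfl
  · exact .inl hl'
  · exact .inr hl'

theorem spec_sameBlockAtom {w : List Letter} {T : Set (Finset PropLit)} {ρ : Fin 6 → ℕ}
    {swap : Bool} (h : Spec w T ((sameBlockAtom swap).eval ρ)) : SameBlock w (ρ 0) (ρ 1) := by
  cases swap
  · exact .inl h
  · exact .inr h

/-- Different positions do not imply different literals, because a list may repeat a literal. The
condition `l ≠ k` is therefore certified by opposite signs (`sign`) or by different bodies (`body`).
-/
theorem RenRule.sound (S : List (List Literal)) (k : RenRule) :
    k.rule.Sound (encodeClauses S) (Spec (encodeClauses S) (ren (clauseSetOf S))) := by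
  intro ρ hρ
  cases k <;> simp only [RenRule.rule, varGuards, pairAtoms, List.forall_mem_cons,
    List.not_mem_nil, false_imp_iff, implies_true, and_true, eqLetter, decide_eq_true_eq, and_imp]
  case unit =>
    rintro hi hu hv hiu huv e
    obtain ⟨C, hC, l, hl, -, -, hl', -⟩ := literalAt_of_sameBlock hi hi (.inl (Seg.refl (hρ 0)))
    refine ⟨skel l, skel l, hl'.litAt, hl'.litAt, fun M hM => ?_⟩
    have := mem_ren_of_unit (mem_clauseSetOf.2 ⟨C, hC, rfl⟩) (List.mem_toFinset.2 hl)
      (hl'.exists_one_lt_occ_iff.2 ⟨ρ 2, ρ 3, hiu, hu, huv, hv, e⟩)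
    obtain ⟨k, hk, hk'⟩ := hM _ this
    rw [Finset.mem_singleton] at hk
    exact .inl (hk ▸ hk')
  case sign swap b =>
    rintro hi hj hu hv hs hiu hjv e
    obtain ⟨C, hC, l, hl, k, hk, hl', hk', x, d, e, hx, hy, -⟩ := exists_common_var
      (by rw [hi]; exact Letter.isSign_iff.2 ⟨_, rfl⟩)
      (by rw [hj]; exact Letter.isSign_iff.2 ⟨_, rfl⟩) (spec_sameBlockAtom hs) hu hv hiu hjv e
    refine ⟨skel l, skel k, hl'.litAt, hk'.litAt, fun M hM =>
      holds_or_holds_of_mem (mem_ren_of_common_var hC hl hk ?_ hx hy) hM⟩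
    rintro rfl
    have h₁ := hl'.litAt.getElem?.symm.trans hi
    have h₂ := hk'.litAt.getElem?.symm.trans hj
    rw [h₁, Option.some.injEq] at h₂
    exact absurd (encodeSign_injective h₂) (by simp)
  case body swap =>
    rintro hi hj hu hv hne hs hiu hjv e
    obtain ⟨C, hC, l, hl, k, hk, hl', hk', x, d, e, hx, hy, -⟩ := exists_common_var hi hj
      (spec_sameBlockAtom hs) hu hv hiu hjv e
    refine ⟨skel l, skel k, hl'.litAt, hk'.litAt, fun M hM =>
      holds_or_holds_of_mem (mem_ren_of_common_var hC hl hk ?_ hx hy) hM⟩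
    rintro rfl
    exact hne (hl'.takeWhile.trans hk'.takeWhile.symm)
  case depth swap =>
    rintro hi hj hu hv hd he hlt hs hiu hjv e
    obtain ⟨C, hC, l, hl, k, hk, hl', hk', x, d, e, hx, hy, hd', he'⟩ := exists_common_var hi hj
      (spec_sameBlockAtom hs) hu hv hiu hjv e
    refine ⟨skel l, skel k, hl'.litAt, hk'.litAt, fun M hM =>
      holds_or_holds_of_mem (mem_ren_of_depth hC hl hk hx hy ?_) hM⟩
    rw [← hd' _ hd, ← he' _ he]
    exact hlt

/-- The values `d` and `e` of the last two variables do not matter here; they are left open so that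
the `depth` rule can use them for nesting depths. -/
theorem der_pairAtoms {R : List (Rule Rel (Fin 6))} (hR : ∀ c : Common, c.rule ∈ R)
    {w : List Letter} {i j u v : ℕ} (d e : ℕ) (h : SameBlock w i j)
    (hu : w[u]? = some .variable) (hv : w[v]? = some .variable)
    (hiu : Seg Letter.inner w (i + 1) u) (hjv : Seg Letter.inner w (j + 1) v)
    (huv : (w.drop (u + 1)).takeWhile Letter.isSym = (w.drop (v + 1)).takeWhile Letter.isSym) :
    ∃ swap, ∀ a ∈ pairAtoms swap, Der R w (a.eval (asg i j u v d e)) := by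
  have h₁ : ∀ swap, Der R w ((sameBlockAtom swap).eval (asg i j u v d e)) →
      ∀ a ∈ pairAtoms swap, Der R w (a.eval (asg i j u v d e)) := by
    intro swap hs
    simp only [pairAtoms, List.forall_mem_cons, List.not_mem_nil, false_imp_iff, implies_true,
      and_true]
    exact ⟨hs, der_inner hR hiu, der_inner hR hjv, der_eqs hR
      (List.getElem?_eq_some_iff.1 hu).1 (List.getElem?_eq_some_iff.1 hv).1 huv⟩
  rcases h with h | h
  · exact ⟨false, h₁ false (der_noBrace hR h)⟩
  · exact ⟨true, h₁ true (der_noBrace hR h)⟩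

theorem decidableInPolyTime_ren : DecidableInPolyTime encodeClauses
    fun S : List (List Literal) => PropSatisfiable (ren (clauseSetOf S)) := by
  refine decidableInPolyTime_of_rules ((Finset.univ : Finset RenRule).toList.map RenRule.rule)
    ?_ ?_ ?_
  · intro S i z hi hz
    obtain ⟨C₁, l, C₂, h⟩ := signedEncoding_encodeLiteral.exists_itemAt hz hi
    exact ⟨_, h.literalAt.litAt⟩
  · intro S r hr
    obtain ⟨k, -, rfl⟩ := List.mem_map.1 hr
    exact k.sound S
  · intro R hR hb S c hc
    have hb' : ∀ k : RenRule, k.rule ∈ R := fun k => hb _ (List.mem_map_of_mem (by simp))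
    right
    simp only [ren, Set.mem_iUnion, Set.mem_union] at hc
    obtain ⟨_, hC', hc⟩ := hc
    obtain ⟨C, hC, rfl⟩ := mem_clauseSetOf.1 hC'
    obtain (⟨l, hl, h, rfl⟩ | ⟨l, hl, k, hk, hne, ⟨x, hx⟩, rfl⟩) | ⟨l, hl, k, hk, h, rfl⟩ := hc
    · rw [List.mem_toFinset] at hl
      obtain ⟨i, -, -, hi, -⟩ := exists_sameBlock hC hl hl
      obtain ⟨u, v, hiu, hu, huv, hv, e⟩ := hi.exists_one_lt_occ_iff.1 h
      have hu' := (List.getElem?_eq_some_iff.1 hu).1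
      have hv' := (List.getElem?_eq_some_iff.1 hv).1
      refine ⟨skel l, skel l, i, i, true, true, hi.litAt, hi.litAt, by simp [PropLit.pol],
        by simp [PropLit.pol], Der.intro (R := R) (RenRule.rule .unit) (hb' _) (asg i 0 u v 0 0)
        (asg_le hi.litAt.lt.le (by simp) hu'.le hv'.le (by simp) (by simp)) ?_ ?_⟩
      · simp only [RenRule.rule, varGuards, List.forall_mem_cons, List.not_mem_nil, false_imp_iff,
          implies_true, and_true, eqLetter, decide_eq_true_eq]
        exact ⟨hi.isSign, hu, hv⟩
      · simp only [RenRule.rule, List.forall_mem_cons, List.not_mem_nil, false_imp_iff,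
          implies_true, and_true]
        exact ⟨der_inner hR hiu, der_inner hR huv, der_eqs hR hu' hv' e⟩
    · rw [List.mem_toFinset] at hl hk
      rw [Finset.mem_inter, Literal.mem_vars_iff, Literal.mem_vars_iff] at hx
      obtain ⟨⟨d, hd⟩, e, he⟩ := hx
      obtain ⟨i, j, hs, hi, hj⟩ := exists_sameBlock hC hl hk
      obtain ⟨u, hiu, hu, hu₁, -⟩ := hi.exists_position hd
      obtain ⟨v, hjv, hv, hv₁, -⟩ := hj.exists_position he
      obtain ⟨swap, hp⟩ := der_pairAtoms hR 0 0 hs hu hv hiu hjv (hu₁.trans hv₁.symm)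
      have hle := asg_le hi.litAt.lt.le hj.litAt.lt.le (List.getElem?_eq_some_iff.1 hu).1.le
        (List.getElem?_eq_some_iff.1 hv).1.le (Nat.zero_le _) (Nat.zero_le _)
      refine ⟨skel l, skel k, i, j, true, true, hi.litAt, hj.litAt, by simp [PropLit.pol],
        by simp [PropLit.pol], ?_⟩
      -- Literals with the same sign and the same body are equal, so one of the two rules for `l ≠
      -- k` applies.
      by_cases hsg : l.sign = k.sign
      · refine Der.intro (R := R) (RenRule.rule (.body swap)) (hb' _) _ hle ?_ ?_
        · simp only [RenRule.rule, varGuards, List.forall_mem_cons, List.not_mem_nil,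
            false_imp_iff, implies_true, and_true, eqLetter, decide_eq_true_eq]
          exact ⟨hi.isSign, hj.isSign, hu, hv⟩
        · refine List.forall_mem_cons.2 ⟨der_neq hR hi.litAt.lt hj.litAt.lt fun e => ?_, hp⟩
          exact hne (encodeBody_inj hsg (hi.takeWhile.symm.trans (e.trans hj.takeWhile)))
      · refine Der.intro (R := R) (RenRule.rule (.sign swap l.sign)) (hb' _) _ hle ?_ hp
        simp only [RenRule.rule, varGuards, List.forall_mem_cons, List.not_mem_nil,
            false_imp_iff, implies_true, and_true, eqLetter, decide_eq_true_eq]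
        have : (!l.sign) = k.sign := by
          cases h₁ : l.sign <;> cases h₂ : k.sign <;> simp_all
        exact ⟨hi.litAt.getElem?, by rw [this]; exact hj.litAt.getElem?, hu, hv⟩
    · rw [List.mem_toFinset] at hl hk
      obtain ⟨x, d, e, hd, he, hlt⟩ := exists_tmin_lt_tmax_iff.1 h
      obtain ⟨i, j, hs, hi, hj⟩ := exists_sameBlock hC hl hk
      obtain ⟨u, hiu, hu, hu₁, hu₂⟩ := hi.exists_position hd
      obtain ⟨v, hjv, hv, hv₁, hv₂⟩ := hj.exists_position he
      obtain ⟨swap, hp⟩ := der_pairAtoms hR d e hs hu hv hiu hjv (hu₁.trans hv₁.symm)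
      have hu' := (List.getElem?_eq_some_iff.1 hu).1.le
      have hv' := (List.getElem?_eq_some_iff.1 hv).1.le
      refine ⟨skel l, skel k, i, j, true, false, hi.litAt, hj.litAt, by simp [PropLit.pol],
        by simp [PropLit.pol], Der.intro (R := R) (RenRule.rule (.depth swap)) (hb' _)
          (asg i j u v d e) (asg_le hi.litAt.lt.le hj.litAt.lt.le hu' hv' (hu₂.le.trans hu')
          (hv₂.le.trans hv')) ?_ ?_⟩
      · simp only [RenRule.rule, varGuards, List.forall_mem_cons, List.not_mem_nil,
          false_imp_iff, implies_true, and_true, eqLetter, decide_eq_true_eq]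
        exact ⟨hi.isSign, hj.isSign, hu, hv⟩
      · simp only [RenRule.rule, List.forall_mem_cons]
        exact ⟨der_depth hR hu₂, der_depth hR hv₂, der_lt hR hlt (hu₂.le.trans hu'), hp⟩

end OccRen

theorem mainTheorem4 :
    OccRen.DecidableInPolyTime OccRen.encodeClauses
      (fun S : List (List OccRen.Literal) => OccRen.RenamableToOCC1N (OccRen.clauseSetOf S)) ∧
    (∃ p : Polynomial ℕ, ∀ S : List (List OccRen.Literal),
      (∀ c ∈ OccRen.ren (OccRen.clauseSetOf S), c.card ≤ 2) ∧
      ∃ T : OccRen.KromClauses, OccRen.kromSetOf T = OccRen.ren (OccRen.clauseSetOf S) ∧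
        (OccRen.encodeKrom T).length ≤ p.eval (OccRen.encodeClauses S).length) ∧
    OccRen.DecidableInPolyTime OccRen.encodeKrom
      (fun T : OccRen.KromClauses => OccRen.PropSatisfiable (OccRen.kromSetOf T)) := by
  refine ⟨?_, OccRen.exists_poly_length_ren, OccRen.decidableInPolyTime_krom⟩
  simpa only [OccRen.renamableToOCC1N_iff] using OccRen.decidableInPolyTime_ren
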